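/- **Setting.** Let $R,V,L,\tau>0$. Let $v\in C^2([0,R];[0,V])$ with $v'\le 0$, $v(0)=V$, $v(R)=0$; $f\in C^1([0,R];[0,1])$ with $f'\le 0$, $f(0)=1$, $f(R)=0$; and $\omega\in C^1([0,L];[0,\infty))$ with $\omega'\le 0$ and $\int_0^L\omega=1$. Extend $f$ by $f(\rho)=1$ for $\rho<0$ and $f(\rho)=0$ for $\rho>R$, put $F(\rho)=\rho f(\rho)$ and $(\rho*\omega)(t,x)=\int_0^L\rho(t,x+y)\,\omega(y)\,dy$. Write $\|v'\|,\|v''\|,\|f'\|$ for sup norms on $[0,R]$, $\|\omega\|$ for the sup norm on $[0,L]$, and $\mathrm{TV}$ for the total variation of an $L^1$ function, $\mathrm{TV}(u)=\sup\{\int u\varphi' : \varphi\in C^1_c(\mathbb R),\ |\varphi|\le 1\}$. $\mathbf{BV}(\mathbb R;[0,R])$ is the set of $u\in L^1(\mathbb R)$ with values a.e. in $[0,R]$ and $\mathrm{TV}(u)<\infty$. For $\rho^0\in\mathbf{BV}(\mathbb R;[0,R])$ and $T>0$ consider $$\partial_t\rho+\partial_x\big(\rho f(\rho)\,v((\rho*\omega)(t-\tau,x))\big)=0,\qquad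 \rho(t,x)=\rho^0(x)\ \text{ for } t\in[-\tau,0].$$ An *entropy weak solution* on $[0,T]$ is a $\rho\in L^1([0,T]\times\mathbb R)$, extended by $\rho^0$ to $[-\tau,0]$, such that for all $\phi\in C^1_c([0,T)\times\mathbb R;[0,\infty))$ and $\kappa\in\mathbb R$ $$\int_0^T\!\!\int_{\mathbb R}\Big(|\rho-\kappa|\,\partial_t\phi+\mathrm{sgn}(\rho-\kappa)\big(F(\rho)-F(\kappa)\big)v((\rho*\omega)(t-\tau,x))\,\partial_x\phi-\mathrm{sgn}(\rho-\kappa)F(\kappa)\,\partial_x v((\rho*\omega)(t-\tau,x))\,\phi\Big)dx\,dt+\int_{\mathbb R}|\rho^0(x)-\kappa|\,\phi(0,x)\,dx\ \ge 0 .$$ Let $\alpha\ge V(1+R\|f'\|)$ and put $$\mathcal M=2\|\omega\|R\big(\|v'\|+R\max\{3\|v''\|,\ \|v'\|\|f'\|\}\big),\qquad g(t)=\big(2e^{\mathcal M(t-\lfloor t/\tau\rfloor\tau)}-1\big)\big(2e^{\mathcal M\tau}-1\big)^{\lfloor t/\tau\rfloor},$$ $$\mathcal K=\big[\alpha+(1+R\|f'\|)V\big]\,g(T)\,\mathrm{TV}(\rho^0)+2R\|\omega\|\|v'\|\,\|\rho^0\|_{1}.$$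 *Approximations.* For positive integers $N,h$ let $\Delta x=L/N$, $\Delta t=\tau/h$, $\lambda=\Delta t/\Delta x$, and, for $j\in\mathbb Z$ and $0\le k<N$, $$\rho^0_j=\tfrac1{\Delta x}\int_{(j-1)\Delta x}^{j\Delta x}\rho^0,\qquad \rho^{-n}_j=\rho^0_j\ (1\le n\le h),\qquad \omega^k=\tfrac1{\Delta x}\int_{k\Delta x}^{(k+1)\Delta x}\omega,\qquad V^n_j=v\Big(\Delta x\sum_{k=0}^{N-1}\omega^k\rho^n_{j+k}\Big).$$ The Lax-Friedrichs (LF) scheme with viscosity $\alpha$ is $$\rho^{n+1}_j=\rho^n_j+\tfrac{\lambda\alpha}2(\rho^n_{j+1}-2\rho^n_j+\rho^n_{j-1})-\tfrac\lambda2\big(F(\rho^n_{j+1})V^{n-h}_{j+1}-F(\rho^n_{j-1})V^{n-h}_{j-1}\big),$$ and the Hilliges-Weidlich (HW) scheme is $$\rho^{n+1}_j=\rho^n_j-\lambda\big(\rho^n_jf(\rho^n_{j+1})V^{n-h}_{j+1}-\rho^n_{j-1}f(\rho^n_j)V^{n-h}_j\big).$$ The approximate solution equals $\rho^n_j$ on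 $[n\Delta t,(n+1)\Delta t)\times[(j-1)\Delta x,j\Delta x)$. **Theorem (Existence).** There is an entropy weak solution $\rho$ on $[0,T]$ such that 1. for all $t\in[0,T]$, $\rho(t,x)\in[0,R]$ for a.e. $x\in\mathbb R$; 2. $\|\rho(t,\cdot)\|_1=\|\rho^0\|_1$ for all $t\in[0,T]$; 3. $\mathrm{TV}(\rho(t,\cdot))\le g(t)\,\mathrm{TV}(\rho^0)$ for all $t\in[0,T]$; 4. $\|\rho(t_1,\cdot)-\rho(t_2,\cdot)\|_1\le\mathcal K|t_1-t_2|$ for all $t_1,t_2\in[0,T]$. Moreover, for every sequence of meshes with $\Delta x\to0$ and $\lambda\le \frac1{\alpha+V(1+R\|f'\|)}$, a subsequence of the LF approximate solutions converges in $L^1_{loc}([0,T]\times\mathbb R)$ to an entropy weak solution with properties 1-4; and for every sequence of meshes with $\Delta x\to0$ and $\lambda\le\frac1{V(1+R\|f'\|)}$ the same holds for the HW approximate solutions. -/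

import Mathlib

open Set Filter Topology MeasureTheory
open scoped ENNReal

noncomputable section

namespace DelayTraffic

/-- The data of the model: maximal density `R`, maximal speed `V`, look-ahead distance `L`,
delay `τ`, speed `v` (used on `[0, R]` only), saturation `f` (its values on `[0, R]`), and kernel
`ω` (its values on `[0, L]`). -/
structure Model where
  R : ℝ
  V : ℝ
  L : ℝ
  τ : ℝ
  v : ℝ → ℝ
  f : ℝ → ℝ
  ω : ℝ → ℝ

/-- The sup norm of a real function over a set. -/
def supNormOn (s : Set ℝ) (g : ℝ → ℝ) : ℝ := sSup ((fun x => |g x|) '' s)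

/-- The total variation of a locally integrable function (class) on the line,
`sup { ∫ u φ' : φ ∈ C¹_c(ℝ), |φ| ≤ 1 }`. -/
def totalVar (u : ℝ → ℝ) : ℝ≥0∞ :=
  ⨆ φ ∈ {φ : ℝ → ℝ | ContDiff ℝ 1 φ ∧ HasCompactSupport φ ∧ ∀ x, |φ x| ≤ 1},
    ENNReal.ofReal (∫ x, u x * deriv φ x)

/-- `u ∈ BV(ℝ; [0, R])`, where `BV ⊆ L¹`. -/
structure IsBV (R : ℝ) (u : ℝ → ℝ) : Prop where
  integrable : Integrable u
  mem_Icc : ∀ᵐ x, u x ∈ Icc 0 R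
  totalVar_lt_top : totalVar u < ∞

namespace Model

variable (P : Model)

/-- The standing assumptions on the data. -/
structure Admissible : Prop where
  R_pos : 0 < P.R
  V_pos : 0 < P.V
  L_pos : 0 < P.L
  τ_pos : 0 < P.τ
  v_contDiffOn : ContDiffOn ℝ 2 P.v (Icc 0 P.R)
  v_mapsTo : MapsTo P.v (Icc 0 P.R) (Icc 0 P.V)
  v_deriv_nonpos : ∀ r ∈ Icc 0 P.R, derivWithin P.v (Icc 0 P.R) r ≤ 0
  v_zero : P.v 0 = P.V
  v_R : P.v P.R = 0
  f_contDiffOn : ContDiffOn ℝ 1 P.f (Icc 0 P.R)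
  f_mapsTo : MapsTo P.f (Icc 0 P.R) (Icc 0 1)
  f_deriv_nonpos : ∀ r ∈ Icc 0 P.R, derivWithin P.f (Icc 0 P.R) r ≤ 0
  f_zero : P.f 0 = 1
  f_R : P.f P.R = 0
  ω_contDiffOn : ContDiffOn ℝ 1 P.ω (Icc 0 P.L)
  ω_nonneg : ∀ x ∈ Icc 0 P.L, 0 ≤ P.ω x
  ω_deriv_nonpos : ∀ x ∈ Icc 0 P.L, derivWithin P.ω (Icc 0 P.L) x ≤ 0
  ω_integral : ∫ x in (0 : ℝ)..P.L, P.ω x = 1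

/-- The saturation function extended by `1` to the left of `0` and by `0` to the right of `R`. -/
def fExt (r : ℝ) : ℝ := if r < 0 then 1 else if P.R < r then 0 else P.f r

/-- The local flux factor `F(r) = r f(r)`. -/
def F (r : ℝ) : ℝ := r * P.fExt r

/-- The downstream average `(u * ω)(x) = ∫_x^{x+L} u(y) ω(y - x) dy`. -/
def conv (u : ℝ → ℝ) (x : ℝ) : ℝ := ∫ y in (0 : ℝ)..P.L, u (x + y) * P.ω y

/-- The non-local speed `v((u * ω)(x))`. If `0 ≤ u ≤ R` a.e., then the argument of `v` is in
`[0, R]` for every `x`, and the speed is Lipschitz in `x`. -/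
def speed (u : ℝ → ℝ) (x : ℝ) : ℝ := P.v (P.conv u x)

/-! ### Constants -/

/-- `‖v'‖`. -/
def normV' : ℝ := supNormOn (Icc 0 P.R) (derivWithin P.v (Icc 0 P.R))

/-- `‖v''‖`. -/
def normV'' : ℝ := supNormOn (Icc 0 P.R) (iteratedDerivWithin 2 P.v (Icc 0 P.R))

/-- `‖f'‖`. -/
def normF' : ℝ := supNormOn (Icc 0 P.R) (derivWithin P.f (Icc 0 P.R))

/-- `‖ω‖`. -/
def normω : ℝ := supNormOn (Icc 0 P.L) P.ω

/-- `ℳ = 2 ‖ω‖ R (‖v'‖ + R max {3 ‖v''‖, ‖v'‖ ‖f'‖})`. -/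
def M : ℝ :=
  2 * P.normω * P.R * (P.normV' + P.R * max (3 * P.normV'') (P.normV' * P.normF'))

/-- The growth factor of the total variation at time `t`. -/
def growth (t : ℝ) : ℝ :=
  (2 * Real.exp (P.M * (t - ⌊t / P.τ⌋₊ * P.τ)) - 1) *
    (2 * Real.exp (P.M * P.τ) - 1) ^ ⌊t / P.τ⌋₊

/-- The Lipschitz constant in time, for the viscosity coefficient `α` and the horizon `T`. -/
def K (α T : ℝ) (ρ₀ : ℝ → ℝ) : ℝ :=
  (α + (1 + P.R * P.normF') * P.V) * P.growth T * (totalVar ρ₀).toReal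
    + 2 * P.R * P.normω * P.normV' * ∫ x, |ρ₀ x|

/-! ### Entropy weak solutions -/

/-- Test functions in `C¹_c([0, T) × ℝ; ℝ₊)`, given through a `C¹` extension to the plane. -/
structure IsTest (T : ℝ) (φ : ℝ → ℝ → ℝ) : Prop where
  contDiff : ContDiff ℝ 1 (Function.uncurry φ)
  compact : HasCompactSupport (Function.uncurry φ)
  support : tsupport (Function.uncurry φ) ⊆ Iio T ×ˢ univ
  nonneg : ∀ t x, 0 ≤ t → 0 ≤ φ t x

/-- `ρ` is an entropy weak solution on `[0, T]` with datum `ρ₀`, extended to the past `[-τ, 0]` as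
the constant `ρ₀`. -/
structure IsEntropyWeakSolution (T : ℝ) (ρ₀ : ℝ → ℝ) (ρ : ℝ → ℝ → ℝ) : Prop where
  integrable : Integrable (Function.uncurry ρ) (volume.restrict (Icc 0 T ×ˢ univ))
  past : ∀ t ∈ Icc (-P.τ) 0, ρ t =ᵐ[volume] ρ₀
  entropy : ∀ φ, IsTest T φ → ∀ κ : ℝ,
    0 ≤ (∫ t in (0 : ℝ)..T, ∫ x,
          (|ρ t x - κ| * deriv (fun s => φ s x) t
            + Real.sign (ρ t x - κ) * (P.F (ρ t x) - P.F κ) * P.speed (ρ (t - P.τ)) x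
                * deriv (fun y => φ t y) x
            - Real.sign (ρ t x - κ) * P.F κ * deriv (fun y => P.speed (ρ (t - P.τ)) y) x
                * φ t x))
        + ∫ x, |ρ₀ x - κ| * φ 0 x

/-- Maximum principle, conservation of the `L¹` norm, bound on the total variation, and Lipschitz
continuity in time with values in `L¹`. -/
structure Estimates (α T : ℝ) (ρ₀ : ℝ → ℝ) (ρ : ℝ → ℝ → ℝ) : Prop where
  mem_Icc : ∀ t ∈ Icc 0 T, ∀ᵐ x, ρ t x ∈ Icc 0 P.R
  integrable : ∀ t ∈ Icc 0 T, Integrable (ρ t)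
  norm_eq : ∀ t ∈ Icc 0 T, ∫ x, |ρ t x| = ∫ x, |ρ₀ x|
  totalVar_le : ∀ t ∈ Icc 0 T, totalVar (ρ t) ≤ ENNReal.ofReal (P.growth t) * totalVar ρ₀
  lipschitz : ∀ t₁ ∈ Icc 0 T, ∀ t₂ ∈ Icc 0 T,
    ∫ x, |ρ t₁ x - ρ t₂ x| ≤ P.K α T ρ₀ * |t₁ - t₂|

/-! ### Finite volume approximations

The mesh is given by two positive integers `N` and `h`, through `L = N Δx` and `τ = h Δt`. -/

/-- The space step. -/
def dx (N : ℕ) : ℝ := P.L / N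

/-- The time step. -/
def dt (h : ℕ) : ℝ := P.τ / h

/-- `λ = Δt / Δx`. -/
def lam (N h : ℕ) : ℝ := P.dt h / P.dx N

/-- The mean of the datum over the `j`-th cell `[(j - 1) Δx, j Δx)`. -/
def cellMean (N : ℕ) (ρ₀ : ℝ → ℝ) (j : ℤ) : ℝ :=
  (1 / P.dx N) * ∫ x in ((j - 1) * P.dx N)..(j * P.dx N), ρ₀ x

/-- The mean of the kernel over `[k Δx, (k + 1) Δx]`, for `k < N`. -/
def kernelMean (N k : ℕ) : ℝ :=
  (1 / P.dx N) * ∫ x in (k * P.dx N)..((k + 1) * P.dx N), P.ω x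

/-- The discrete non-local speed `V_j`. -/
def cellSpeed (N : ℕ) (u : ℤ → ℝ) (j : ℤ) : ℝ :=
  P.v (P.dx N * ∑ k ∈ Finset.range N, P.kernelMean N k * u (j + k))

/-- One step of the Lax-Friedrichs scheme from `u = ρⁿ`, with delayed values `w = ρⁿ⁻ʰ`. -/
def stepLF (α : ℝ) (N h : ℕ) (u w : ℤ → ℝ) (j : ℤ) : ℝ :=
  u j + P.lam N h * α / 2 * (u (j + 1) - 2 * u j + u (j - 1))
    - P.lam N h / 2 * (P.F (u (j + 1)) * P.cellSpeed N w (j + 1)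
        - P.F (u (j - 1)) * P.cellSpeed N w (j - 1))

/-- One step of the Hilliges-Weidlich scheme from `u = ρⁿ`, with delayed values `w = ρⁿ⁻ʰ`. -/
def stepHW (N h : ℕ) (u w : ℤ → ℝ) (j : ℤ) : ℝ :=
  u j - P.lam N h * (u j * P.fExt (u (j + 1)) * P.cellSpeed N w (j + 1)
    - u (j - 1) * P.fExt (u j) * P.cellSpeed N w j)

/-- The delayed recursion `ρⁿ⁺¹ = step ρⁿ ρⁿ⁻ʰ`. The truncated subtraction `n - h` gives the
constant past `ρ⁻ʰ = ⋯ = ρ⁻¹ = ρ⁰`. -/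
def iterate (step : (ℤ → ℝ) → (ℤ → ℝ) → ℤ → ℝ) (h : ℕ) (u₀ : ℤ → ℝ) : ℕ → ℤ → ℝ
  | 0 => u₀
  | n + 1 => step (iterate step h u₀ n) (iterate step h u₀ (n - h))
termination_by n => n
decreasing_by all_goals omega

/-- The piecewise constant function equal to `ρⁿⱼ` on `[n Δt, (n + 1) Δt) × [(j - 1) Δx, j Δx)`. -/
def piecewiseConst (N h : ℕ) (u : ℕ → ℤ → ℝ) (t x : ℝ) : ℝ :=
  u ⌊t / P.dt h⌋₊ (⌊x / P.dx N⌋ + 1)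

/-- The Lax-Friedrichs approximate solution. -/
def approxLF (α : ℝ) (N h : ℕ) (ρ₀ : ℝ → ℝ) : ℝ → ℝ → ℝ :=
  P.piecewiseConst N h (iterate (P.stepLF α N h) h (P.cellMean N ρ₀))

/-- The Hilliges-Weidlich approximate solution. -/
def approxHW (N h : ℕ) (ρ₀ : ℝ → ℝ) : ℝ → ℝ → ℝ :=
  P.piecewiseConst N h (iterate (P.stepHW N h) h (P.cellMean N ρ₀))

end Model

/-- Convergence in `L¹_loc([0, T] × ℝ)`. -/
def TendstoL1Loc (T : ℝ) (u : ℕ → ℝ → ℝ → ℝ) (ρ : ℝ → ℝ → ℝ) : Prop :=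
  ∀ X : ℝ, Tendsto
    (fun k => ∫⁻ z in Icc 0 T ×ˢ Icc (-X) X, ‖u k z.1 z.2 - ρ z.1 z.2‖ₑ) atTop (𝓝 0)

end DelayTraffic

end

/-! ### Bounds on the data of the model and cell means of the kernel. -/

namespace DelayTraffic

/-! Both schemes are instances of one three point conservative scheme (`NumFlux`), which under the
CFL condition is monotone for every fixed choice of the speeds (`lfFlux_isMonotone`,
`hwFlux_isMonotone`). Cell sequences are replaced by piecewise constant functions on the line, so
that sums over cells become integrals, and reindexing and telescoping become translation invariance
of Lebesgue measure.

Monotonicity gives the maximum principle, since the constants `0` and `R` are fixed points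
(`next_mem`), and the Crandall-Majda inequality between two states moved by the same speeds
(`contraction`). Comparing with a constant gives discrete entropy inequalities (`entropy_le`).
Comparing with the translate by one cell gives the variation bound (`incr_step_le`): the error from
using unshifted speeds consists of second differences of the speed, and of first differences times
increments of the density. The kernel is nonnegative and nonincreasing, so summation by parts bounds
the second differences by the cell size times the variation at the delayed time
(`integral_abs_vel_second_le`). The variation therefore satisfies a linear recursion with delay, for
which the growth factor is a supersolution (`growth_step`).

For compactness, the primitives in space are equi-Lipschitz in space and almost equi-Lipschitz in
time. A subsequence converges at every point, and the uniform variation bound upgrades this to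
convergence in `L¹_loc` at every time, to the derivative of the limit primitive
(`L1Loc.of_primitives`, `exists_limit`). The total variation defined by duality is exchanged with
`L¹` bounds on increments (`incr_le_totalVar`, `totalVar_le_of_incr_le`). Mass is not lost at
infinity because it moves at bounded speed (`mass_le`).

In the entropy inequality the discrete speeds converge pointwise. Their difference quotients
converge in `L¹_loc` by the same compactness lemma, because second differences bound their variation
(`quot_tendsto`). The only discontinuous coefficient is the sign in the source term. It is harmless
when the limit takes the value `κ` on a null set only, hence for all but countably many `κ`
(`entropy_of_ae_ne`, `dense_generic`). For the other constants, the inequalities for generic values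
slightly above and below `κ` are averaged, which produces the sign with value `0` at `0`
(`entropy_weighted`). -/

theorem abs_le_supNormOn {s : Set ℝ} {g : ℝ → ℝ} (hs : IsCompact s) (hg : ContinuousOn g s) {x : ℝ}
    (hx : x ∈ s) : |g x| ≤ supNormOn s g :=
  le_csSup (hs.image_of_continuousOn hg.abs).bddAbove (mem_image_of_mem _ hx)

theorem supNormOn_nonneg (s : Set ℝ) (g : ℝ → ℝ) : 0 ≤ supNormOn s g :=
  Real.sSup_nonneg (by rintro _ ⟨x, -, rfl⟩; exact abs_nonneg _)

namespace Model

variable {P : Model}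

theorem normV'_nonneg : 0 ≤ P.normV' := supNormOn_nonneg _ _
theorem normV''_nonneg : 0 ≤ P.normV'' := supNormOn_nonneg _ _
theorem normF'_nonneg : 0 ≤ P.normF' := supNormOn_nonneg _ _
theorem normω_nonneg : 0 ≤ P.normω := supNormOn_nonneg _ _

namespace Admissible

theorem uniqueDiffOn (hP : P.Admissible) : UniqueDiffOn ℝ (Icc 0 P.R) :=
  uniqueDiffOn_Icc hP.R_pos

theorem M_nonneg (hP : P.Admissible) : 0 ≤ P.M := by
  have := hP.R_pos
  have h1 : 0 ≤ max (3 * P.normV'') (P.normV' * P.normF') :=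
    le_max_of_le_right (mul_nonneg normV'_nonneg normF'_nonneg)
  have := normV'_nonneg (P := P)
  have := normω_nonneg (P := P)
  unfold M
  positivity

theorem one_le_fluxLip (hP : P.Admissible) : 1 ≤ 1 + P.R * P.normF' :=
  le_add_of_nonneg_right (mul_nonneg hP.R_pos.le normF'_nonneg)

theorem zero_mem (hP : P.Admissible) : (0 : ℝ) ∈ Icc 0 P.R := left_mem_Icc.2 hP.R_pos.le

theorem R_mem (hP : P.Admissible) : P.R ∈ Icc 0 P.R := right_mem_Icc.2 hP.R_pos.le

theorem max_mem {a b : ℝ} (ha : a ∈ Icc 0 P.R) (hb : b ∈ Icc 0 P.R) :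
    max a b ∈ Icc 0 P.R := ⟨le_max_of_le_left ha.1, max_le ha.2 hb.2⟩

theorem min_mem {a b : ℝ} (ha : a ∈ Icc 0 P.R) (hb : b ∈ Icc 0 P.R) :
    min a b ∈ Icc 0 P.R := ⟨le_min ha.1 hb.1, min_le_of_left_le ha.2⟩

/-! ### The speed -/

theorem v_deriv_contDiffOn (hP : P.Admissible) :
    ContDiffOn ℝ 1 (derivWithin P.v (Icc 0 P.R)) (Icc 0 P.R) :=
  hP.v_contDiffOn.derivWithin hP.uniqueDiffOn (by norm_num)

theorem v_deriv_abs_le (hP : P.Admissible) {x : ℝ} (hx : x ∈ Icc 0 P.R) :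
    |derivWithin P.v (Icc 0 P.R) x| ≤ P.normV' :=
  abs_le_supNormOn isCompact_Icc hP.v_deriv_contDiffOn.continuousOn hx

theorem v_hasDerivWithinAt (hP : P.Admissible) {x : ℝ} (hx : x ∈ Icc 0 P.R) :
    HasDerivWithinAt P.v (derivWithin P.v (Icc 0 P.R) x) (Icc 0 P.R) x :=
  ((hP.v_contDiffOn.differentiableOn (by norm_num)) x hx).hasDerivWithinAt

theorem v_abs_sub_le (hP : P.Admissible) {x y : ℝ} (hx : x ∈ Icc 0 P.R) (hy : y ∈ Icc 0 P.R) :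
    |P.v x - P.v y| ≤ P.normV' * |x - y| :=
  (convex_Icc 0 P.R).norm_image_sub_le_of_norm_derivWithin_le
    (hP.v_contDiffOn.differentiableOn (by norm_num)) (fun _ h => hP.v_deriv_abs_le h) hy hx

theorem v_deriv_abs_sub_le (hP : P.Admissible) {x y : ℝ} (hx : x ∈ Icc 0 P.R)
    (hy : y ∈ Icc 0 P.R) :
    |derivWithin P.v (Icc 0 P.R) x - derivWithin P.v (Icc 0 P.R) y| ≤ P.normV'' * |x - y| := by
  have h2 : iteratedDerivWithin 2 P.v (Icc 0 P.R)
      = derivWithin (derivWithin P.v (Icc 0 P.R)) (Icc 0 P.R) := by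
    have : iteratedDerivWithin 1 P.v (Icc 0 P.R) = derivWithin P.v (Icc 0 P.R) := by
      ext x; exact congrFun (iteratedDerivWithin_one (𝕜 := ℝ) (f := P.v)) x
    ext x
    rw [show (2 : ℕ) = 1 + 1 from rfl, iteratedDerivWithin_succ, this]
  refine (convex_Icc 0 P.R).norm_image_sub_le_of_norm_derivWithin_le
    (hP.v_deriv_contDiffOn.differentiableOn (by norm_num)) (fun z hz => ?_) hy hx
  rw [← h2]
  refine abs_le_supNormOn isCompact_Icc ?_ hz
  rw [h2]
  exact hP.v_deriv_contDiffOn.continuousOn_derivWithin hP.uniqueDiffOn (by norm_num)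

theorem v_continuousOn (hP : P.Admissible) : ContinuousOn P.v (Icc 0 P.R) :=
  hP.v_contDiffOn.continuousOn

/-- The mean value theorem is applied once, to the difference of `v` along the segments from `q` to
`p` and from `s` to `r`, so that both derivatives are taken at the same parameter. Two separate
applications would give unrelated intermediate points, and the mixed difference `p - q - r + s`
would not appear. -/
theorem v_mixed_abs_le (hP : P.Admissible) {p q r s : ℝ} (hp : p ∈ Icc 0 P.R)
    (hq : q ∈ Icc 0 P.R) (hr : r ∈ Icc 0 P.R) (hs : s ∈ Icc 0 P.R) :
    |P.v p - P.v q - P.v r + P.v s| ≤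
      P.normV' * |p - q - r + s| + P.normV'' * ((|q - s| + |p - r|) * |r - s|) := by
  set v' := derivWithin P.v (Icc 0 P.R)
  have mem : ∀ {a b : ℝ}, a ∈ Icc 0 P.R → b ∈ Icc 0 P.R → ∀ θ ∈ Icc (0 : ℝ) 1,
      a + θ * (b - a) ∈ Icc 0 P.R := by
    intro a b ha hb θ hθ
    constructor
    · nlinarith [mul_nonneg hθ.1 hb.1, mul_nonneg (sub_nonneg.2 hθ.2) ha.1]
    · nlinarith [mul_nonneg hθ.1 (sub_nonneg.2 hb.2),
        mul_nonneg (sub_nonneg.2 hθ.2) (sub_nonneg.2 ha.2)]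
  have der : ∀ {a b : ℝ}, a ∈ Icc 0 P.R → b ∈ Icc 0 P.R → ∀ θ ∈ Icc (0 : ℝ) 1,
      HasDerivWithinAt (fun θ => P.v (a + θ * (b - a))) (v' (a + θ * (b - a)) * (b - a))
        (Icc 0 1) θ := by
    intro a b ha hb θ hθ
    have h1 : HasDerivWithinAt (fun θ : ℝ => a + θ * (b - a)) (b - a) (Icc 0 1) θ := by
      simpa using ((hasDerivAt_id θ).mul_const (b - a)).const_add a |>.hasDerivWithinAt
    exact (hP.v_hasDerivWithinAt (mem ha hb θ hθ)).comp θ h1 (fun θ' h => mem ha hb θ' h)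
  have der' : ∀ θ ∈ Icc (0 : ℝ) 1, HasDerivWithinAt
      (fun θ => P.v (q + θ * (p - q)) - P.v (s + θ * (r - s)))
      (v' (q + θ * (p - q)) * (p - q) - v' (s + θ * (r - s)) * (r - s)) (Icc 0 1) θ :=
    fun θ hθ => (der hq hp θ hθ).sub (der hs hr θ hθ)
  obtain ⟨θ, hθ, h⟩ := exists_hasDerivAt_eq_slope
    (fun θ => P.v (q + θ * (p - q)) - P.v (s + θ * (r - s))) _ zero_lt_one
    (fun θ hθ => (der' θ hθ).continuousWithinAt)
    (fun θ hθ => (der' θ (Ioo_subset_Icc_self hθ)).hasDerivAt (Icc_mem_nhds hθ.1 hθ.2))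
  have hθ' := Ioo_subset_Icc_self hθ
  simp only [one_mul, zero_mul, add_zero, sub_zero, div_one] at h
  have e : P.v p - P.v q - P.v r + P.v s = v' (q + θ * (p - q)) * (p - q - r + s)
      + (v' (q + θ * (p - q)) - v' (s + θ * (r - s))) * (r - s) := by
    rw [show q + (p - q) = p by ring, show s + (r - s) = r by ring] at h
    linear_combination -h
  rw [e]
  refine (abs_add_le _ _).trans (add_le_add ?_ ?_)
  · rw [abs_mul]
    exact mul_le_mul_of_nonneg_right (hP.v_deriv_abs_le (mem hq hp θ hθ')) (abs_nonneg _)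
  · rw [abs_mul, ← mul_assoc]
    refine mul_le_mul_of_nonneg_right ?_ (abs_nonneg _)
    refine (hP.v_deriv_abs_sub_le (mem hq hp θ hθ') (mem hs hr θ hθ')).trans
      (mul_le_mul_of_nonneg_left ?_ normV''_nonneg)
    -- The two intermediate points differ by a convex combination of the differences of the
    -- endpoints.
    rw [show q + θ * (p - q) - (s + θ * (r - s)) = (1 - θ) * (q - s) + θ * (p - r) by ring]
    refine (abs_add_le _ _).trans ?_
    rw [abs_mul, abs_mul, abs_of_nonneg hθ'.1, abs_of_nonneg (sub_nonneg.2 hθ'.2)]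
    nlinarith [abs_nonneg (q - s), abs_nonneg (p - r), hθ'.1, hθ'.2]

/-! ### The saturation -/

theorem fExt_eq {r : ℝ} (hr : r ∈ Icc 0 P.R) : P.fExt r = P.f r := by
  simp [fExt, hr.1.not_gt, hr.2.not_gt]

theorem fExt_mem (hP : P.Admissible) (r : ℝ) : P.fExt r ∈ Icc (0 : ℝ) 1 := by
  unfold fExt
  split_ifs with h1 h2
  · simp
  · simp
  · exact hP.f_mapsTo ⟨not_lt.1 h1, not_lt.1 h2⟩

theorem f_abs_sub_le (hP : P.Admissible) {x y : ℝ} (hx : x ∈ Icc 0 P.R) (hy : y ∈ Icc 0 P.R) :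
    |P.fExt x - P.fExt y| ≤ P.normF' * |x - y| := by
  rw [fExt_eq hx, fExt_eq hy]
  exact (convex_Icc 0 P.R).norm_image_sub_le_of_norm_derivWithin_le
    (hP.f_contDiffOn.differentiableOn (by norm_num)) (fun _ h => abs_le_supNormOn isCompact_Icc
      (hP.f_contDiffOn.continuousOn_derivWithin hP.uniqueDiffOn (by norm_num)) h) hy hx

theorem antitoneOn_of_derivWithin_nonpos {a b : ℝ} {g : ℝ → ℝ}
    (hg : ContDiffOn ℝ 1 g (Icc a b)) (h : ∀ x ∈ Icc a b, derivWithin g (Icc a b) x ≤ 0) :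
    AntitoneOn g (Icc a b) := by
  refine antitoneOn_of_deriv_nonpos (convex_Icc a b) hg.continuousOn
    ((hg.differentiableOn (by norm_num)).mono interior_subset) fun x hx => ?_
  rw [← derivWithin_of_mem_nhds (mem_interior_iff_mem_nhds.1 hx)]
  exact h x (interior_subset hx)

theorem f_anti (hP : P.Admissible) {x y : ℝ} (hx : x ∈ Icc 0 P.R) (hy : y ∈ Icc 0 P.R)
    (h : x ≤ y) : P.fExt y ≤ P.fExt x := by
  rw [fExt_eq hx, fExt_eq hy]
  exact antitoneOn_of_derivWithin_nonpos hP.f_contDiffOn hP.f_deriv_nonpos hx hy h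

/-- The values `f 0 = 1` and `f R = 0` match the extension, which is thus `f` composed with the
projection onto `[0, R]`. -/
theorem fExt_continuous (hP : P.Admissible) : Continuous P.fExt := by
  have : P.fExt = fun r => P.f (projIcc 0 P.R hP.R_pos.le r) := by
    ext r
    unfold fExt
    split_ifs with h1 h2
    · rw [projIcc_of_le_left _ h1.le, hP.f_zero]
    · rw [projIcc_of_right_le _ h2.le, hP.f_R]
    · rw [projIcc_of_mem _ ⟨not_lt.1 h1, not_lt.1 h2⟩]
  rw [this]
  exact hP.f_contDiffOn.continuousOn.comp_continuous
    (continuous_subtype_val.comp continuous_projIcc) fun r => (projIcc 0 P.R _ r).2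

theorem F_continuous (hP : P.Admissible) : Continuous P.F :=
  continuous_id.mul hP.fExt_continuous

theorem F_zero : P.F 0 = 0 := by simp [F]

theorem F_R (hP : P.Admissible) : P.F P.R = 0 := by
  rw [F, fExt_eq hP.R_mem, hP.f_R, mul_zero]

theorem F_nonneg (hP : P.Admissible) {r : ℝ} (hr : 0 ≤ r) : 0 ≤ P.F r :=
  mul_nonneg hr (hP.fExt_mem r).1

theorem F_le (hP : P.Admissible) {r : ℝ} (hr : 0 ≤ r) : P.F r ≤ r :=
  mul_le_of_le_one_right hr (hP.fExt_mem r).2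

theorem F_abs_sub_le (hP : P.Admissible) {x y : ℝ} (hx : x ∈ Icc 0 P.R) (hy : y ∈ Icc 0 P.R) :
    |P.F x - P.F y| ≤ (1 + P.R * P.normF') * |x - y| := by
  have e : P.F x - P.F y = (x - y) * P.fExt x + y * (P.fExt x - P.fExt y) := by unfold F; ring
  rw [e]
  refine (abs_add_le _ _).trans ?_
  rw [abs_mul, abs_mul, abs_of_nonneg (hP.fExt_mem x).1, abs_of_nonneg hy.1, add_mul, one_mul]
  refine add_le_add (mul_le_of_le_one_right (abs_nonneg _) (hP.fExt_mem x).2) ?_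
  rw [mul_assoc]
  exact mul_le_mul hy.2 (hP.f_abs_sub_le hx hy) (abs_nonneg _) hP.R_pos.le

/-! ### The kernel -/

theorem ω_le (hP : P.Admissible) {x : ℝ} (hx : x ∈ Icc 0 P.L) : P.ω x ≤ P.normω :=
  (le_abs_self _).trans (abs_le_supNormOn isCompact_Icc hP.ω_contDiffOn.continuousOn hx)

theorem ω_anti (hP : P.Admissible) : AntitoneOn P.ω (Icc 0 P.L) :=
  antitoneOn_of_derivWithin_nonpos hP.ω_contDiffOn hP.ω_deriv_nonpos

theorem ω_intervalIntegrable (hP : P.Admissible) {a b : ℝ} (ha : a ∈ Icc 0 P.L)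
    (hb : b ∈ Icc 0 P.L) : IntervalIntegrable P.ω volume a b :=
  (hP.ω_contDiffOn.continuousOn.mono (uIcc_subset_Icc ha hb)).intervalIntegrable

theorem dx_pos (hP : P.Admissible) {N : ℕ} (hN : 0 < N) : 0 < P.dx N :=
  div_pos hP.L_pos (Nat.cast_pos.2 hN)

theorem mul_dx {N : ℕ} (hN : 0 < N) : N * P.dx N = P.L := by
  have : (N : ℝ) ≠ 0 := by positivity
  unfold dx; field_simp

theorem dt_pos (hP : P.Admissible) {h : ℕ} (hh : 0 < h) : 0 < P.dt h :=
  div_pos hP.τ_pos (Nat.cast_pos.2 hh)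

theorem mul_dt {h : ℕ} (hh : 0 < h) : h * P.dt h = P.τ := by
  have : (h : ℝ) ≠ 0 := by positivity
  unfold dt; field_simp

theorem node_mem (hP : P.Admissible) {N k : ℕ} (hN : 0 < N) (hk : k ≤ N) :
    k * P.dx N ∈ Icc 0 P.L :=
  ⟨mul_nonneg k.cast_nonneg (hP.dx_pos hN).le, by
    rw [← mul_dx hN]; exact mul_le_mul_of_nonneg_right (by exact_mod_cast hk) (hP.dx_pos hN).le⟩

theorem node_mem_succ (hP : P.Admissible) {N k : ℕ} (hN : 0 < N) (hk : k < N) :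
    ((k : ℝ) + 1) * P.dx N ∈ Icc 0 P.L := by
  exact_mod_cast hP.node_mem hN hk

theorem kernelMean_mem (hP : P.Admissible) {N k : ℕ} (hN : 0 < N) (hk : k < N) {m M : ℝ}
    (h : ∀ x ∈ Icc (k * P.dx N) ((k + 1) * P.dx N), P.ω x ∈ Icc m M) :
    P.kernelMean N k ∈ Icc m M := by
  have hd := hP.dx_pos hN
  have hle : k * P.dx N ≤ (k + 1) * P.dx N := by nlinarith
  have hi := hP.ω_intervalIntegrable (hP.node_mem hN hk.le) (hP.node_mem_succ hN hk)
  have h1 := intervalIntegral.integral_mono_on hle intervalIntegrable_const hi fun x hx => (h x hx).1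
  have h2 := intervalIntegral.integral_mono_on hle hi intervalIntegrable_const fun x hx => (h x hx).2
  simp only [intervalIntegral.integral_const, smul_eq_mul] at h1 h2
  have e : ((k : ℝ) + 1) * P.dx N - k * P.dx N = P.dx N := by ring
  rw [e] at h1 h2
  unfold kernelMean
  rw [one_div_mul_eq_div]
  exact ⟨(le_div_iff₀ hd).2 (by linarith), (div_le_iff₀ hd).2 (by linarith)⟩

theorem cell_subset (hP : P.Admissible) {N k : ℕ} (hN : 0 < N) (hk : k < N) :
    Icc (k * P.dx N) ((k + 1) * P.dx N) ⊆ Icc 0 P.L :=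
  Icc_subset_Icc (hP.node_mem hN hk.le).1 (hP.node_mem_succ hN hk).2

theorem kernelMean_nonneg (hP : P.Admissible) {N k : ℕ} (hN : 0 < N) (hk : k < N) :
    0 ≤ P.kernelMean N k :=
  (hP.kernelMean_mem hN hk fun x hx => ⟨hP.ω_nonneg x (hP.cell_subset hN hk hx),
    hP.ω_le (hP.cell_subset hN hk hx)⟩).1

theorem kernelMean_le (hP : P.Admissible) {N k : ℕ} (hN : 0 < N) (hk : k < N) :
    P.kernelMean N k ≤ P.normω :=
  (hP.kernelMean_mem hN hk fun x hx => ⟨hP.ω_nonneg x (hP.cell_subset hN hk hx),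
    hP.ω_le (hP.cell_subset hN hk hx)⟩).2

/-- The value of the kernel at the node shared by the two cells separates their means. -/
theorem kernelMean_anti (hP : P.Admissible) {N k : ℕ} (hN : 0 < N) (hk : k + 1 < N) :
    P.kernelMean N (k + 1) ≤ P.kernelMean N k := by
  have hm := hP.node_mem_succ hN (k.lt_succ_self.trans hk)
  have h1 := hP.kernelMean_mem hN hk (m := 0) (M := P.ω ((k + 1) * P.dx N)) fun x hx =>
    ⟨hP.ω_nonneg x (hP.cell_subset hN hk hx),
      hP.ω_anti hm (hP.cell_subset hN hk hx) (by simpa using hx.1)⟩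
  have h2 := hP.kernelMean_mem hN (k.lt_succ_self.trans hk) (m := P.ω ((k + 1) * P.dx N))
    (M := P.normω) fun x hx => ⟨hP.ω_anti (hP.cell_subset hN (k.lt_succ_self.trans hk) hx) hm hx.2,
      hP.ω_le (hP.cell_subset hN (k.lt_succ_self.trans hk) hx)⟩
  exact h1.2.trans h2.1

theorem sum_kernelMean (hP : P.Admissible) {N : ℕ} (hN : 0 < N) :
    P.dx N * ∑ k ∈ Finset.range N, P.kernelMean N k = 1 := by
  have hd := (hP.dx_pos hN).ne'
  have := intervalIntegral.sum_integral_adjacent_intervals (f := P.ω) (μ := volume)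
    (a := fun k : ℕ => k * P.dx N) (n := N) fun k hk => by
      have := hP.ω_intervalIntegrable (hP.node_mem hN hk.le) (hP.node_mem_succ hN hk)
      exact_mod_cast this
  simp only [Nat.cast_zero, zero_mul, mul_dx hN, hP.ω_integral, Nat.cast_add, Nat.cast_one] at this
  simp only [kernelMean, ← Finset.mul_sum, this]
  field_simp

end Admissible

end Model

end DelayTraffic

/-! ### Discrete averages and speeds: first and second differences. -/

namespace DelayTraffic

/-- Measurable integrable densities with values in `[0, R]` at every point. -/
structure IsDensity (R : ℝ) (u : ℝ → ℝ) : Prop where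
  measurable : Measurable u
  integrable : Integrable u
  mem : ∀ x, u x ∈ Icc 0 R

/-- The integral of the absolute increments of step `a`. -/
noncomputable def incr (u : ℝ → ℝ) (a : ℝ) : ℝ := ∫ x, |u (x + a) - u x|

theorem incr_nonneg (u : ℝ → ℝ) (a : ℝ) : 0 ≤ incr u a := integral_nonneg fun _ => abs_nonneg _

theorem _root_.MeasureTheory.Integrable.incr {u : ℝ → ℝ} (hu : Integrable u) (a : ℝ) :
    Integrable fun x => u (x + a) - u x := (hu.comp_add_right a).sub hu

theorem integral_add_three {f g h : ℝ → ℝ} (hf : Integrable f) (hg : Integrable g)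
    (hh : Integrable h) :
    ∫ x, (f x + g x + h x) = (∫ x, f x) + (∫ x, g x) + ∫ x, h x := by
  rw [← integral_add hf hg]
  exact integral_add (hf.add hg) hh

/-- Summation by parts; it moves the differences from the density to the kernel weights. -/
theorem sum_mul_increment (c s : ℕ → ℝ) (n : ℕ) :
    ∑ k ∈ Finset.range (n + 1), c k * (s (k + 1) - s k)
      = c n * s (n + 1) - c 0 * s 0 + ∑ k ∈ Finset.range n, (c k - c (k + 1)) * s (k + 1) := by
  induction n with
  | zero => simp; ring
  | succ n ih => rw [Finset.sum_range_succ, ih, Finset.sum_range_succ]; ring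

/-- For nonnegative nonincreasing weights all coefficients on the right are nonnegative, and they
add up to `2 * c 0`. This is where the monotonicity of the kernel enters. -/
theorem abs_sum_mul_increment_le {c : ℕ → ℝ} {n : ℕ} (hc : ∀ k ≤ n, 0 ≤ c k)
    (ha : ∀ k < n, c (k + 1) ≤ c k) (s : ℕ → ℝ) :
    |∑ k ∈ Finset.range (n + 1), c k * (s (k + 1) - s k)|
      ≤ c n * |s (n + 1)| + c 0 * |s 0|
        + ∑ k ∈ Finset.range n, (c k - c (k + 1)) * |s (k + 1)| := by
  rw [sum_mul_increment]
  refine (abs_add_le _ _).trans (add_le_add ((abs_sub _ _).trans (le_of_eq ?_))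
    ((Finset.abs_sum_le_sum_abs _ _).trans (Finset.sum_le_sum fun k hk => le_of_eq ?_)))
  · rw [abs_mul, abs_mul, abs_of_nonneg (hc n le_rfl), abs_of_nonneg (hc 0 n.zero_le)]
  · rw [abs_mul, abs_of_nonneg (sub_nonneg.2 (ha k (Finset.mem_range.1 hk)))]

theorem sum_decrements (c : ℕ → ℝ) (n : ℕ) :
    ∑ k ∈ Finset.range n, (c k - c (k + 1)) = c 0 - c n :=
  Finset.sum_range_sub' c n

namespace Model

variable {P : Model}

/-- The discrete downstream average, as an operator on functions on the line. -/
noncomputable def avg (P : Model) (N : ℕ) (w : ℝ → ℝ) (x : ℝ) : ℝ :=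
  P.dx N * ∑ k ∈ Finset.range N, P.kernelMean N k * w (x + k * P.dx N)

/-- The discrete non-local speed, as an operator on functions on the line. -/
noncomputable def vel (P : Model) (N : ℕ) (w : ℝ → ℝ) (x : ℝ) : ℝ := P.v (P.avg N w x)

theorem avg_shift_sub (N : ℕ) (w : ℝ → ℝ) (x a : ℝ) :
    P.avg N w (x + a) - P.avg N w x = P.avg N (fun y => w (y + a) - w y) x := by
  simp only [avg, mul_sub, add_right_comm]
  rw [Finset.sum_sub_distrib, mul_sub]

theorem avg_measurable (N : ℕ) {w : ℝ → ℝ} (hw : Measurable w) : Measurable (P.avg N w) := by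
  unfold avg; fun_prop

theorem avg_integrable (N : ℕ) {w : ℝ → ℝ} (hw : Integrable w) : Integrable (P.avg N w) :=
  (integrable_finsetSum (Finset.range N) fun k _ =>
    (hw.comp_add_right (k * P.dx N)).const_mul (P.kernelMean N k)).const_mul (P.dx N)

namespace Admissible

variable {N : ℕ}

theorem avg_mem (hP : P.Admissible) (hN : 0 < N) {w : ℝ → ℝ} (hw : ∀ x, w x ∈ Icc 0 P.R) (x : ℝ) :
    P.avg N w x ∈ Icc 0 P.R := by
  have hd := hP.dx_pos hN
  have h0 : ∀ k ∈ Finset.range N, 0 ≤ P.kernelMean N k :=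
    fun k hk => hP.kernelMean_nonneg hN (Finset.mem_range.1 hk)
  refine ⟨mul_nonneg hd.le (Finset.sum_nonneg fun k hk => mul_nonneg (h0 k hk) (hw _).1), ?_⟩
  calc P.avg N w x ≤ P.dx N * ∑ k ∈ Finset.range N, P.kernelMean N k * P.R :=
        mul_le_mul_of_nonneg_left (Finset.sum_le_sum fun k hk =>
          mul_le_mul_of_nonneg_left (hw _).2 (h0 k hk)) hd.le
    _ = P.R := by rw [← Finset.sum_mul, ← mul_assoc, hP.sum_kernelMean hN, one_mul]

theorem integral_abs_avg_le (hP : P.Admissible) (hN : 0 < N) {e : ℝ → ℝ} (he : Integrable e) :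
    ∫ x, |P.avg N e x| ≤ ∫ x, |e x| := by
  have hd := hP.dx_pos hN
  have hi : ∀ k : ℕ, Integrable fun x => P.kernelMean N k * |e (x + k * P.dx N)| :=
    fun k => (he.comp_add_right (k * P.dx N)).abs.const_mul _
  calc ∫ x, |P.avg N e x|
      ≤ ∫ x, P.dx N * ∑ k ∈ Finset.range N, P.kernelMean N k * |e (x + k * P.dx N)| := by
        refine integral_mono (avg_integrable N he).abs
          ((integrable_finsetSum _ fun k _ => hi k).const_mul _) fun x => ?_
        simp only [avg, abs_mul, abs_of_pos hd]
        refine mul_le_mul_of_nonneg_left ((Finset.abs_sum_le_sum_abs _ _).trans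
          (Finset.sum_le_sum fun k hk => ?_)) hd.le
        rw [abs_mul, abs_of_nonneg (hP.kernelMean_nonneg hN (Finset.mem_range.1 hk))]
    _ = ∫ x, |e x| := by
        rw [integral_const_mul, integral_finsetSum _ fun k _ => hi k]
        simp only [integral_const_mul]
        simp only [integral_add_right_eq_self fun x => |e x|]
        rw [← Finset.sum_mul, ← mul_assoc, hP.sum_kernelMean hN, one_mul]

/-- Translating by one cell advances the summation index by one, so the increment of the average is
a weighted sum of consecutive differences, to which summation by parts applies. No regularity of `e`
is needed, and a factor of the cell size is gained. -/
theorem abs_avg_increment_le (hP : P.Admissible) (hN : 0 < N) (e : ℝ → ℝ) (x : ℝ) :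
    |P.avg N e (x + P.dx N) - P.avg N e x| ≤ P.dx N *
      (P.kernelMean N (N - 1) * |e (x + N * P.dx N)| + P.kernelMean N 0 * |e x|
        + ∑ k ∈ Finset.range (N - 1), (P.kernelMean N k - P.kernelMean N (k + 1))
          * |e (x + (k + 1) * P.dx N)|) := by
  obtain ⟨n, rfl⟩ : ∃ n, N = n + 1 := ⟨N - 1, by omega⟩
  have h := abs_sum_mul_increment_le (c := P.kernelMean (n + 1)) (n := n)
    (fun k hk => hP.kernelMean_nonneg hN (by omega))
    (fun k hk => hP.kernelMean_anti hN (by omega)) fun k => e (x + k * P.dx (n + 1))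
  have h2 : P.avg (n + 1) e (x + P.dx (n + 1)) - P.avg (n + 1) e x = P.dx (n + 1) *
      ∑ k ∈ Finset.range (n + 1), P.kernelMean (n + 1) k
        * (e (x + (k + 1 : ℕ) * P.dx (n + 1)) - e (x + k * P.dx (n + 1))) := by
    simp only [avg, mul_sub, Finset.sum_sub_distrib]
    congr 3
    ext k
    congr 2
    push_cast; ring
  rw [h2, abs_mul, abs_of_pos (hP.dx_pos hN)]
  refine mul_le_mul_of_nonneg_left (h.trans (le_of_eq ?_)) (hP.dx_pos hN).le
  simp

theorem abs_avg_increment_le_const (hP : P.Admissible) (hN : 0 < N) {w : ℝ → ℝ}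
    (hw : ∀ x, w x ∈ Icc 0 P.R) (x : ℝ) :
    |P.avg N w (x + P.dx N) - P.avg N w x| ≤ 2 * P.normω * P.R * P.dx N := by
  have hw' : ∀ x, |w x| ≤ P.R := fun x => by rw [abs_of_nonneg (hw x).1]; exact (hw x).2
  refine (hP.abs_avg_increment_le hN w x).trans ?_
  rw [mul_comm (2 * P.normω * P.R) (P.dx N)]
  refine mul_le_mul_of_nonneg_left ?_ (hP.dx_pos hN).le
  have h1 := mul_le_mul_of_nonneg_left (hw' (x + N * P.dx N))
    (hP.kernelMean_nonneg hN (Nat.sub_lt hN one_pos))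
  have h2 := mul_le_mul_of_nonneg_left (hw' x) (hP.kernelMean_nonneg hN hN)
  have h3 : ∑ k ∈ Finset.range (N - 1), (P.kernelMean N k - P.kernelMean N (k + 1))
      * |w (x + (k + 1) * P.dx N)|
      ≤ ∑ k ∈ Finset.range (N - 1), (P.kernelMean N k - P.kernelMean N (k + 1)) * P.R :=
    Finset.sum_le_sum fun k hk => mul_le_mul_of_nonneg_left (hw' _)
      (sub_nonneg.2 (hP.kernelMean_anti hN (by have := Finset.mem_range.1 hk; omega)))
  rw [← Finset.sum_mul, sum_decrements] at h3
  nlinarith [hP.kernelMean_le hN hN, hP.R_pos]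

/-- After integration every translate of `|e|` has the same integral, and the weights telescope to
twice the first kernel mean, which is at most `‖ω‖`. -/
theorem integral_abs_avg_increment_le (hP : P.Admissible) (hN : 0 < N) {e : ℝ → ℝ}
    (he : Integrable e) :
    ∫ x, |P.avg N e (x + P.dx N) - P.avg N e x| ≤ 2 * P.normω * P.dx N * ∫ x, |e x| := by
  have hi : ∀ c a : ℝ, Integrable fun x => c * |e (x + a)| :=
    fun c a => (he.comp_add_right a).abs.const_mul _
  have hi0 : Integrable fun x => P.kernelMean N 0 * |e x| := he.abs.const_mul _
  have hs : Integrable fun x => ∑ k ∈ Finset.range (N - 1),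
      (P.kernelMean N k - P.kernelMean N (k + 1)) * |e (x + (k + 1) * P.dx N)| :=
    integrable_finsetSum _ fun k _ => hi _ _
  refine (integral_mono ((avg_integrable N he).incr _).abs
    ((((hi _ _).add hi0).add hs).const_mul (P.dx N)) fun x => hP.abs_avg_increment_le hN e x).trans ?_
  simp only [Pi.add_apply]
  rw [integral_const_mul, integral_add_three (hi _ _) hi0 hs,
    integral_finsetSum _ fun k _ => hi _ _]
  simp only [integral_const_mul]
  simp only [integral_add_right_eq_self fun x => |e x|]
  rw [← Finset.sum_mul, sum_decrements]
  have h0 : 0 ≤ ∫ x, |e x| := integral_nonneg fun _ => abs_nonneg _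
  have := mul_le_mul_of_nonneg_right (hP.kernelMean_le hN hN) (mul_nonneg (hP.dx_pos hN).le h0)
  linarith

/-- The function `v` is controlled only on `[0, R]`; composing it with the projection gives a
continuous function with the same values along `g`. -/
theorem v_comp_measurable {ι : Type*} [MeasurableSpace ι] (hP : P.Admissible) {g : ι → ℝ}
    (hg : Measurable g) (hm : ∀ x, g x ∈ Icc 0 P.R) : Measurable fun x => P.v (g x) := by
  have h : Continuous fun r : ℝ => P.v (projIcc 0 P.R hP.R_pos.le r) :=
    hP.v_continuousOn.comp_continuous (continuous_subtype_val.comp continuous_projIcc)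
      fun r => (projIcc 0 P.R _ r).2
  have : (fun x => P.v (g x)) = fun x => P.v (projIcc 0 P.R hP.R_pos.le (g x)) := by
    ext x; rw [projIcc_of_mem _ (hm x)]
  rw [this]
  exact h.measurable.comp hg

theorem vel_measurable (hP : P.Admissible) (hN : 0 < N) {w : ℝ → ℝ} (hw : IsDensity P.R w) :
    Measurable (P.vel N w) :=
  hP.v_comp_measurable (avg_measurable N hw.measurable) (hP.avg_mem hN hw.mem)

theorem vel_mem (hP : P.Admissible) (hN : 0 < N) {w : ℝ → ℝ} (hw : IsDensity P.R w) (x : ℝ) :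
    P.vel N w x ∈ Icc 0 P.V := hP.v_mapsTo (hP.avg_mem hN hw.mem x)

theorem abs_vel_increment_le (hP : P.Admissible) (hN : 0 < N) {w : ℝ → ℝ} (hw : IsDensity P.R w)
    (x : ℝ) : |P.vel N w (x + P.dx N) - P.vel N w x|
      ≤ 2 * P.normω * P.R * P.normV' * P.dx N := by
  refine (hP.v_abs_sub_le (hP.avg_mem hN hw.mem _) (hP.avg_mem hN hw.mem _)).trans ?_
  have := mul_le_mul_of_nonneg_left (hP.abs_avg_increment_le_const hN hw.mem x)
    (normV'_nonneg (P := P))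
  linarith

/-- The speed itself is not expected to be integrable, as it equals `V` in vacuum. Its increments
are dominated by those of the average. -/
theorem vel_increment_integrable (hP : P.Admissible) (hN : 0 < N) {w : ℝ → ℝ}
    (hw : IsDensity P.R w) (a : ℝ) : Integrable fun x => P.vel N w (x + a) - P.vel N w x := by
  have hm := hP.vel_measurable hN hw
  refine (((avg_integrable (P := P) N hw.integrable).incr a).abs.const_mul P.normV').mono'
    (by fun_prop) (ae_of_all _ fun x => ?_)
  exact hP.v_abs_sub_le (hP.avg_mem hN hw.mem _) (hP.avg_mem hN hw.mem _)

/-- The factor in the bound on the second differences of the discrete speed. -/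
noncomputable def _root_.DelayTraffic.Model.curv (P : Model) : ℝ :=
  2 * P.normω * (P.normV' + 2 * P.R * P.normV'')

/-- The mixed difference estimate is used at the averages over `x + 2d`, `x + d` (twice) and `x`.
The term with `v'` is the increment of the average of `e`, the increment of `w`. In the quadratic
term one factor is bounded pointwise by `2‖ω‖R d` and the other one is integrated. It occurs twice,
whence the factor `2R‖v''‖` in `curv`. -/
theorem integral_abs_vel_second_le (hP : P.Admissible) (hN : 0 < N) {w : ℝ → ℝ}
    (hw : IsDensity P.R w) :
    incr (fun x => P.vel N w (x + P.dx N) - P.vel N w x) (P.dx N)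
      ≤ P.curv * P.dx N * incr w (P.dx N) := by
  set d := P.dx N
  set e := fun x => w (x + d) - w x with he
  have hei : Integrable e := hw.integrable.incr d
  have hE : ∀ x, P.avg N w (x + d) - P.avg N w x = P.avg N e x := fun x => avg_shift_sub N w x d
  have i1 : Integrable fun x => P.normV' * |P.avg N e (x + d) - P.avg N e x| :=
    ((avg_integrable N hei).incr d).abs.const_mul _
  have i2 : Integrable fun x => P.normV'' * (|P.avg N e x| * (2 * P.normω * P.R * d)) :=
    ((avg_integrable N hei).abs.mul_const _).const_mul _
  have i3 : Integrable fun x => P.normV'' * (|P.avg N e (x + d)| * (2 * P.normω * P.R * d)) :=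
    i2.comp_add_right d
  have key : incr (fun x => P.vel N w (x + d) - P.vel N w x) d
      ≤ ∫ x, (P.normV' * |P.avg N e (x + d) - P.avg N e x|
        + P.normV'' * (|P.avg N e x| * (2 * P.normω * P.R * d))
        + P.normV'' * (|P.avg N e (x + d)| * (2 * P.normω * P.R * d))) := by
    refine integral_mono ((hP.vel_increment_integrable hN hw d).incr d).abs
      ((i1.add i2).add i3) fun x => ?_
    have hm := hP.avg_mem hN hw.mem
    have h := hP.v_mixed_abs_le (hm (x + d + d)) (hm (x + d)) (hm (x + d)) (hm x)
    have h0 := hP.abs_avg_increment_le_const hN hw.mem x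
    have h1 : P.avg N w (x + d + d) - P.avg N w (x + d) - P.avg N w (x + d) + P.avg N w x
        = P.avg N e (x + d) - P.avg N e x := by rw [← hE, ← hE]; ring
    rw [h1, hE, hE] at h
    rw [hE] at h0
    have h2 : |P.vel N w (x + d + d) - P.vel N w (x + d) - (P.vel N w (x + d) - P.vel N w x)|
        = |P.v (P.avg N w (x + d + d)) - P.v (P.avg N w (x + d)) - P.v (P.avg N w (x + d))
          + P.v (P.avg N w x)| := by unfold vel; congr 1; ring
    simp only [h2]
    refine h.trans ?_
    rw [add_assoc, ← mul_add, ← add_mul]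
    gcongr
    exact normV''_nonneg
  refine key.trans ?_
  rw [integral_add_three i1 i2 i3,
    integral_add_right_eq_self fun x => P.normV'' * (|P.avg N e x| * (2 * P.normω * P.R * d))]
  simp only [integral_const_mul, integral_mul_const]
  have a1 := mul_le_mul_of_nonneg_left (hP.integral_abs_avg_increment_le hN hei)
    (normV'_nonneg (P := P))
  have hd := (hP.dx_pos hN).le
  have hR := hP.R_pos.le
  have hω := normω_nonneg (P := P)
  have hv := normV''_nonneg (P := P)
  have hp : 0 ≤ P.normV'' * (2 * P.normω * P.R * d) := by positivity
  have a2 := mul_le_mul_of_nonneg_left (hP.integral_abs_avg_le hN hei) hp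
  have : incr w d = ∫ x, |e x| := rfl
  rw [this]
  unfold curv
  linarith

end Admissible

end Model

end DelayTraffic

/-! ### Monotone conservative schemes on the line: contraction, entropy and one-step bounds. -/

namespace DelayTraffic

theorem integral_sub_mul_sub {f g h : ℝ → ℝ} (c : ℝ) (hf : Integrable f) (hg : Integrable g)
    (hh : Integrable h) :
    ∫ x, (f x - c * (g x - h x)) = (∫ x, f x) - c * ((∫ x, g x) - ∫ x, h x) := by
  have h1 : Integrable fun x => g x - h x := hg.sub hh
  rw [← integral_sub hg hh, ← integral_const_mul]
  exact integral_sub hf (h1.const_mul c)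

/-- A three point conservative scheme whose flux between two neighbouring cells is
`β / 2 (a - b) + g₁(a, b) p + g₂(a, b) q`, for densities `a, b` and speeds `p, q`. -/
structure NumFlux where
  β : ℝ
  θ : ℝ
  ℓ₁ : ℝ
  ℓ₂ : ℝ
  g₁ : ℝ → ℝ → ℝ
  g₂ : ℝ → ℝ → ℝ

namespace NumFlux

/-- The numerical flux. -/
noncomputable def flux (G : NumFlux) (a b p q : ℝ) : ℝ :=
  G.β / 2 * (a - b) + G.g₁ a b * p + G.g₂ a b * q

/-- The updated value in a cell. -/
noncomputable def next (G : NumFlux) (lam a b c p q s : ℝ) : ℝ :=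
  b - lam * (G.flux b c q s - G.flux a b p q)

/-- The numerical entropy flux of Crandall and Majda. -/
noncomputable def entFlux (G : NumFlux) (a b a' b' p q : ℝ) : ℝ :=
  G.flux (max a a') (max b b') p q - G.flux (min a a') (min b b') p q

/-- The flux of a density on the line. -/
noncomputable def fluxFn (G : NumFlux) (d : ℝ) (V u : ℝ → ℝ) (x : ℝ) : ℝ :=
  G.flux (u x) (u (x + d)) (V x) (V (x + d))

/-- One step of the scheme on a density on the line. -/
noncomputable def step (G : NumFlux) (lam d : ℝ) (V u : ℝ → ℝ) (x : ℝ) : ℝ :=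
  G.next lam (u (x - d)) (u x) (u (x + d)) (V (x - d)) (V x) (V (x + d))

/-- Consistency, regularity and monotonicity of the scheme with mesh ratio `lam`. -/
structure IsMonotone (G : NumFlux) (P : Model) (lam : ℝ) : Prop where
  lam_nonneg : 0 ≤ lam
  β_nonneg : 0 ≤ G.β
  θ_mem : G.θ ∈ Icc (0 : ℝ) 1
  ℓ_add : G.ℓ₁ + G.ℓ₂ = 1 + P.R * P.normF'
  continuous₁ : Continuous (Function.uncurry G.g₁)
  continuous₂ : Continuous (Function.uncurry G.g₂)
  diag₁ : ∀ r, G.g₁ r r = (1 - G.θ) * P.F r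
  diag₂ : ∀ r, G.g₂ r r = G.θ * P.F r
  nonneg₁ : ∀ a ∈ Icc 0 P.R, ∀ b ∈ Icc 0 P.R, 0 ≤ G.g₁ a b
  nonneg₂ : ∀ a ∈ Icc 0 P.R, ∀ b ∈ Icc 0 P.R, 0 ≤ G.g₂ a b
  le₁ : ∀ a ∈ Icc 0 P.R, ∀ b ∈ Icc 0 P.R, G.g₁ a b ≤ (1 - G.θ) * P.R
  le₂ : ∀ a ∈ Icc 0 P.R, ∀ b ∈ Icc 0 P.R, G.g₂ a b ≤ G.θ * P.R
  add_le : ∀ a ∈ Icc 0 P.R, ∀ b ∈ Icc 0 P.R, G.g₁ a b + G.g₂ a b ≤ G.θ * a + (1 - G.θ) * b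
  lip : ∀ a ∈ Icc 0 P.R, ∀ b ∈ Icc 0 P.R, ∀ a' ∈ Icc 0 P.R, ∀ b' ∈ Icc 0 P.R,
    |G.g₁ a b - G.g₁ a' b'| + |G.g₂ a b - G.g₂ a' b'| ≤ G.ℓ₁ * |a - a'| + G.ℓ₂ * |b - b'|
  mono : ∀ a ∈ Icc 0 P.R, ∀ b ∈ Icc 0 P.R, ∀ c ∈ Icc 0 P.R,
    ∀ a' ∈ Icc 0 P.R, ∀ b' ∈ Icc 0 P.R, ∀ c' ∈ Icc 0 P.R,
    ∀ p ∈ Icc 0 P.V, ∀ q ∈ Icc 0 P.V, ∀ s ∈ Icc 0 P.V, a ≤ a' → b ≤ b' → c ≤ c' →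
    G.next lam a b c p q s ≤ G.next lam a' b' c' p q s

/-- Measurable velocity fields with values in `[0, V]` and increments bounded by `S` and
integrable. -/
structure IsVelocity (P : Model) (d S : ℝ) (V : ℝ → ℝ) : Prop where
  measurable : Measurable V
  mem : ∀ x, V x ∈ Icc 0 P.V
  increment_le : ∀ x, |V (x + d) - V x| ≤ S
  integrable : Integrable fun x => V (x + d) - V x

variable {G : NumFlux} {P : Model} {lam : ℝ}

theorem flux_diag (hG : G.IsMonotone P lam) (r p q : ℝ) :
    G.flux r r p q = P.F r * ((1 - G.θ) * p + G.θ * q) := by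
  rw [flux, hG.diag₁, hG.diag₂]; ring

theorem next_diag (hG : G.IsMonotone P lam) (r p q s : ℝ) :
    G.next lam r r r p q s
      = r - lam * P.F r * (((1 - G.θ) * q + G.θ * s) - ((1 - G.θ) * p + G.θ * q)) := by
  rw [next, flux_diag hG, flux_diag hG]; ring

/-- Since `F` vanishes at `0` and at `R`, these constants are stationary whatever the speeds are,
and monotonicity compares the update with them. -/
theorem next_mem (hP : P.Admissible) (hG : G.IsMonotone P lam) {a b c p q s : ℝ}
    (ha : a ∈ Icc 0 P.R) (hb : b ∈ Icc 0 P.R) (hc : c ∈ Icc 0 P.R)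
    (hp : p ∈ Icc 0 P.V) (hq : q ∈ Icc 0 P.V) (hs : s ∈ Icc 0 P.V) :
    G.next lam a b c p q s ∈ Icc 0 P.R := by
  have h0 := hG.mono 0 hP.zero_mem 0 hP.zero_mem 0 hP.zero_mem a ha b hb c hc p hp q hq s hs
    ha.1 hb.1 hc.1
  have hR := hG.mono a ha b hb c hc _ hP.R_mem _ hP.R_mem _ hP.R_mem p hp q hq s hs
    ha.2 hb.2 hc.2
  rw [next_diag hG, Model.Admissible.F_zero, mul_zero, zero_mul, sub_zero] at h0
  rw [next_diag hG, hP.F_R, mul_zero, zero_mul, sub_zero] at hR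
  exact ⟨h0, hR⟩

/-- The updates of the maxima and of the minima of the two states enclose both updates by
monotonicity, and the difference of these two updates is exactly the right-hand side. Both states
must be moved by the same speeds. -/
theorem contraction (hG : G.IsMonotone P lam) {a b c a' b' c' p q s : ℝ}
    (ha : a ∈ Icc 0 P.R) (hb : b ∈ Icc 0 P.R) (hc : c ∈ Icc 0 P.R)
    (ha' : a' ∈ Icc 0 P.R) (hb' : b' ∈ Icc 0 P.R) (hc' : c' ∈ Icc 0 P.R)
    (hp : p ∈ Icc 0 P.V) (hq : q ∈ Icc 0 P.V) (hs : s ∈ Icc 0 P.V) :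
    |G.next lam a b c p q s - G.next lam a' b' c' p q s|
      ≤ |b - b'| - lam * (G.entFlux b c b' c' q s - G.entFlux a b a' b' p q) := by
  have mM : ∀ {x y : ℝ}, x ∈ Icc 0 P.R → y ∈ Icc 0 P.R → max x y ∈ Icc 0 P.R :=
    Model.Admissible.max_mem
  have mm : ∀ {x y : ℝ}, x ∈ Icc 0 P.R → y ∈ Icc 0 P.R → min x y ∈ Icc 0 P.R :=
    Model.Admissible.min_mem
  have h1 := hG.mono a ha b hb c hc _ (mM ha ha') _ (mM hb hb') _ (mM hc hc') p hp q hq s hs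
    (le_max_left _ _) (le_max_left _ _) (le_max_left _ _)
  have h2 := hG.mono a' ha' b' hb' c' hc' _ (mM ha ha') _ (mM hb hb') _ (mM hc hc') p hp q hq s hs
    (le_max_right _ _) (le_max_right _ _) (le_max_right _ _)
  have h3 := hG.mono _ (mm ha ha') _ (mm hb hb') _ (mm hc hc') a ha b hb c hc p hp q hq s hs
    (min_le_left _ _) (min_le_left _ _) (min_le_left _ _)
  have h4 := hG.mono _ (mm ha ha') _ (mm hb hb') _ (mm hc hc') a' ha' b' hb' c' hc' p hp q hq s hs
    (min_le_right _ _) (min_le_right _ _) (min_le_right _ _)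
  have e : |b - b'| - lam * (G.entFlux b c b' c' q s - G.entFlux a b a' b' p q)
      = G.next lam (max a a') (max b b') (max c c') p q s
        - G.next lam (min a a') (min b b') (min c c') p q s := by
    rw [← max_sub_min_eq_abs']; unfold next entFlux; ring
  rw [e, abs_le]
  constructor <;> linarith

theorem sign_mul_self (x : ℝ) : Real.sign x * x = |x| := by
  rcases lt_trichotomy x 0 with h | rfl | h
  · rw [Real.sign_of_neg h, abs_of_neg h]; ring
  · simp
  · rw [Real.sign_of_pos h, abs_of_pos h]; ring

theorem sign_mul_le_abs (x y : ℝ) : Real.sign x * y ≤ |y| := by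
  rcases Real.sign_apply_eq x with h | h | h <;> rw [h]
  · rw [neg_one_mul]; exact neg_le_abs y
  · rw [zero_mul]; exact abs_nonneg y
  · rw [one_mul]; exact le_abs_self y

/-- The discrete entropy inequality. -/
theorem entropy_le (hP : P.Admissible) (hG : G.IsMonotone P lam) {a b c p q s : ℝ}
    (ha : a ∈ Icc 0 P.R) (hb : b ∈ Icc 0 P.R) (hc : c ∈ Icc 0 P.R)
    (hp : p ∈ Icc 0 P.V) (hq : q ∈ Icc 0 P.V) (hs : s ∈ Icc 0 P.V) (κ : ℝ) :
    |G.next lam a b c p q s - κ| ≤ |b - κ|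
      - lam * (G.entFlux b c κ κ q s - G.entFlux a b κ κ p q)
      - lam * (Real.sign (G.next lam a b c p q s - κ) * P.F κ *
        (((1 - G.θ) * q + G.θ * s) - ((1 - G.θ) * p + G.θ * q))) := by
  have hn := next_mem hP hG ha hb hc hp hq hs
  set D := ((1 - G.θ) * q + G.θ * s) - ((1 - G.θ) * p + G.θ * q) with hD
  have hd1 := flux_diag hG κ q s
  have hd2 := flux_diag hG κ p q
  -- Monotonicity is known only for states in `[0, R]`. For `κ` outside of this interval all maxima
  -- and minima are explicit, and the claim is an equality by conservativity.
  rcases lt_or_ge κ 0 with h0 | h0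
  · have e : ∀ {x}, x ∈ Icc 0 P.R → κ ≤ x := fun h => h0.le.trans h.1
    simp only [entFlux, max_eq_left (e ha), max_eq_left (e hb), max_eq_left (e hc),
      min_eq_right (e ha), min_eq_right (e hb), min_eq_right (e hc), hd1, hd2]
    rw [Real.sign_of_pos (by linarith [hn.1]), abs_of_nonneg (by linarith [hn.1]),
      abs_of_nonneg (by linarith [hb.1])]
    refine le_of_eq ?_
    unfold next
    rw [hD]; ring
  rcases lt_or_ge P.R κ with hR | hR
  · have e : ∀ {x}, x ∈ Icc 0 P.R → x ≤ κ := fun h => h.2.trans hR.le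
    simp only [entFlux, max_eq_right (e ha), max_eq_right (e hb), max_eq_right (e hc),
      min_eq_left (e ha), min_eq_left (e hb), min_eq_left (e hc), hd1, hd2]
    rw [Real.sign_of_neg (by linarith [hn.2]), abs_of_neg (by linarith [hn.2]),
      abs_of_neg (by linarith [hb.2])]
    refine le_of_eq ?_
    unfold next
    rw [hD]; ring
  · have hκ : κ ∈ Icc 0 P.R := ⟨h0, hR⟩
    have h := contraction hG ha hb hc hκ hκ hκ hp hq hs
    -- A constant is not preserved when the speed varies: the update of `κ` is `κ - lam * F κ * D`,
    -- and this defect is the source term.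
    rw [next_diag hG, ← hD] at h
    set n := G.next lam a b c p q s
    -- Testing with the sign of the updated value, rather than of the old one, replaces the distance
    -- to the updated constant by the distance to `κ`. The source term is therefore evaluated at the
    -- new time.
    have h1 := sign_mul_le_abs (n - κ) (n - (κ - lam * P.F κ * D))
    have h2 := sign_mul_self (n - κ)
    have h3 : Real.sign (n - κ) * (n - (κ - lam * P.F κ * D))
        = Real.sign (n - κ) * (n - κ) + lam * (Real.sign (n - κ) * P.F κ * D) := by ring
    linarith

/-- A bound linear in the densities makes fluxes integrable, and after integration the weights of
the two cells add up to `β + V`. -/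
theorem abs_flux_le (hG : G.IsMonotone P lam) {a b p q : ℝ}
    (ha : a ∈ Icc 0 P.R) (hb : b ∈ Icc 0 P.R) (hp : p ∈ Icc 0 P.V) (hq : q ∈ Icc 0 P.V) :
    |G.flux a b p q| ≤ (G.β / 2 + P.V * G.θ) * a + (G.β / 2 + P.V * (1 - G.θ)) * b := by
  have h1 := hG.nonneg₁ a ha b hb
  have h2 := hG.nonneg₂ a ha b hb
  have h3 := hG.add_le a ha b hb
  have hβ := hG.β_nonneg
  have h4 := mul_le_mul_of_nonneg_left h3 (hp.1.trans hp.2)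
  have h5 := mul_le_mul_of_nonneg_left hp.2 h1
  have h6 := mul_le_mul_of_nonneg_left hq.2 h2
  have h7 := mul_nonneg h1 hp.1
  have h8 := mul_nonneg h2 hq.1
  have h9 := mul_nonneg hβ ha.1
  have h10 := mul_nonneg hβ hb.1
  unfold flux
  rw [abs_le]
  constructor <;> nlinarith

section Step

variable {d S : ℝ} {V u : ℝ → ℝ}

theorem _root_.DelayTraffic.IsDensity.comp_add (hu : IsDensity P.R u) (a : ℝ) :
    IsDensity P.R fun x => u (x + a) :=
  ⟨hu.measurable.comp (measurable_add_const a), hu.integrable.comp_add_right a, fun _ => hu.mem _⟩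

theorem _root_.DelayTraffic.IsDensity.max {w : ℝ → ℝ} (hu : IsDensity P.R u)
    (hw : IsDensity P.R w) : IsDensity P.R fun x => max (u x) (w x) :=
  ⟨hu.measurable.max hw.measurable, hu.integrable.sup hw.integrable,
    fun x => Model.Admissible.max_mem (hu.mem x) (hw.mem x)⟩

theorem _root_.DelayTraffic.IsDensity.min {w : ℝ → ℝ} (hu : IsDensity P.R u)
    (hw : IsDensity P.R w) : IsDensity P.R fun x => min (u x) (w x) :=
  ⟨hu.measurable.min hw.measurable, hu.integrable.inf hw.integrable,
    fun x => Model.Admissible.min_mem (hu.mem x) (hw.mem x)⟩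

theorem measurable₁ (hG : G.IsMonotone P lam) {ι : Type*} [MeasurableSpace ι] {f g : ι → ℝ}
    (hf : Measurable f) (hg : Measurable g) : Measurable fun x => G.g₁ (f x) (g x) :=
  hG.continuous₁.measurable.comp (hf.prodMk hg)

theorem measurable₂ (hG : G.IsMonotone P lam) {ι : Type*} [MeasurableSpace ι] {f g : ι → ℝ}
    (hf : Measurable f) (hg : Measurable g) : Measurable fun x => G.g₂ (f x) (g x) :=
  hG.continuous₂.measurable.comp (hf.prodMk hg)

theorem measurable_flux (hG : G.IsMonotone P lam) {ι : Type*} [MeasurableSpace ι]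
    {f g p q : ι → ℝ} (hf : Measurable f) (hg : Measurable g) (hp : Measurable p)
    (hq : Measurable q) : Measurable fun x => G.flux (f x) (g x) (p x) (q x) := by
  have := measurable₁ hG hf hg
  have := measurable₂ hG hf hg
  unfold flux
  fun_prop

theorem fluxFn_measurable (hG : G.IsMonotone P lam) (hV : Measurable V) (hu : Measurable u) :
    Measurable (G.fluxFn d V u) :=
  measurable_flux hG hu (hu.comp (measurable_add_const d)) hV (hV.comp (measurable_add_const d))

theorem fluxFn_integrable (hG : G.IsMonotone P lam) (hV : IsVelocity P d S V)
    (hu : IsDensity P.R u) : Integrable (G.fluxFn d V u) :=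
  ((hu.integrable.const_mul (G.β / 2 + P.V * G.θ)).add
    ((hu.comp_add d).integrable.const_mul (G.β / 2 + P.V * (1 - G.θ)))).mono'
    (fluxFn_measurable hG hV.measurable hu.measurable).aestronglyMeasurable
    (ae_of_all _ fun _ => abs_flux_le hG (hu.mem _) (hu.mem _) (hV.mem _) (hV.mem _))

theorem integral_abs_fluxFn_le (hG : G.IsMonotone P lam) (hV : IsVelocity P d S V)
    (hu : IsDensity P.R u) : ∫ x, |G.fluxFn d V u x| ≤ (G.β + P.V) * ∫ x, u x := by
  refine (integral_mono (fluxFn_integrable hG hV hu).abs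
    ((hu.integrable.const_mul (G.β / 2 + P.V * G.θ)).add
    ((hu.comp_add d).integrable.const_mul (G.β / 2 + P.V * (1 - G.θ)))) fun x =>
      abs_flux_le hG (hu.mem _) (hu.mem _) (hV.mem _) (hV.mem _)).trans (le_of_eq ?_)
  simp only [Pi.add_apply]
  rw [integral_add (hu.integrable.const_mul _) ((hu.comp_add d).integrable.const_mul _),
    integral_const_mul, integral_const_mul, integral_add_right_eq_self]
  ring

theorem step_eq (G : NumFlux) (lam d : ℝ) (V u : ℝ → ℝ) (x : ℝ) :
    G.step lam d V u x = u x - lam * (G.fluxFn d V u x - G.fluxFn d V u (x - d)) := by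
  simp [step, next, fluxFn]

theorem step_isDensity (hP : P.Admissible) (hG : G.IsMonotone P lam) (hV : IsVelocity P d S V)
    (hu : IsDensity P.R u) : IsDensity P.R (G.step lam d V u) where
  measurable := by
    have := fluxFn_measurable (d := d) hG hV.measurable hu.measurable
    have := hu.measurable
    rw [funext (step_eq G lam d V u)]
    fun_prop
  integrable := by
    have := fluxFn_integrable hG hV hu
    rw [funext (step_eq G lam d V u)]
    exact hu.integrable.sub ((this.sub (this.comp_sub_right d)).const_mul lam)
  mem x := next_mem hP hG (hu.mem _) (hu.mem _) (hu.mem _) (hV.mem _) (hV.mem _) (hV.mem _)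

theorem integral_step (hG : G.IsMonotone P lam) (hV : IsVelocity P d S V)
    (hu : IsDensity P.R u) : ∫ x, G.step lam d V u x = ∫ x, u x := by
  have h := fluxFn_integrable hG hV hu
  simp only [step_eq]
  rw [integral_sub_mul_sub lam hu.integrable h (h.comp_sub_right d), integral_sub_right_eq_self,
    sub_self, mul_zero, sub_zero]

/-- The conservative form lets a translation move the flux difference to the weight `ψ`. With a
slowly varying cut-off this controls how fast mass travels. -/
theorem integral_step_mul_le (hG : G.IsMonotone P lam) (hV : IsVelocity P d S V)
    (hu : IsDensity P.R u) {ψ : ℝ → ℝ} (hψ : Measurable ψ) {B K : ℝ} (hB : ∀ x, |ψ x| ≤ B)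
    (hK : ∀ x, |ψ (x + d) - ψ x| ≤ K) :
    ∫ x, G.step lam d V u x * ψ x ≤ (∫ x, u x * ψ x) + lam * (K * ((G.β + P.V) * ∫ x, u x)) := by
  set Γ := G.fluxFn d V u
  have h : Integrable Γ := fluxFn_integrable hG hV hu
  have mul : ∀ {f ψ : ℝ → ℝ} {B : ℝ}, Integrable f → Measurable ψ → (∀ x, |ψ x| ≤ B) →
      Integrable fun x => f x * ψ x :=
    fun hf hψ hB => hf.mul_bdd (c := _) hψ.aestronglyMeasurable (ae_of_all _ hB)
  have i0 := mul hu.integrable hψ hB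
  have i1 := mul h hψ hB
  have i2 := mul (h.comp_sub_right d) hψ hB
  have i3 : Integrable fun x => Γ x * ψ (x + d) :=
    mul h (hψ.comp (measurable_add_const d)) fun x => hB _
  have e2 : ∫ x, Γ (x - d) * ψ x = ∫ x, Γ x * ψ (x + d) := by
    rw [← integral_add_right_eq_self (fun x => Γ (x - d) * ψ x) d]
    simp
  have e : ∫ x, G.step lam d V u x * ψ x
      = (∫ x, u x * ψ x) + lam * ∫ x, Γ x * (ψ (x + d) - ψ x) := by
    have : ∀ x, G.step lam d V u x * ψ x
        = u x * ψ x - lam * (Γ x * ψ x - Γ (x - d) * ψ x) := fun x => by rw [step_eq]; ring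
    simp only [this, mul_sub (Γ _)]
    rw [integral_sub_mul_sub lam i0 i1 i2, e2, integral_sub i3 i1]
    ring
  rw [e]
  have hK0 : 0 ≤ K := (abs_nonneg _).trans (hK 0)
  gcongr
  · exact hG.lam_nonneg
  · refine (le_trans ?_ (mul_le_mul_of_nonneg_left (integral_abs_fluxFn_le hG hV hu) hK0))
    rw [← integral_const_mul]
    refine integral_mono ?_ (h.abs.const_mul K) fun x => ?_
    · simp only [mul_sub]
      exact i3.sub i1
    · refine (le_abs_self _).trans ?_
      rw [abs_mul, mul_comm]
      exact mul_le_mul_of_nonneg_right (hK x) (abs_nonneg _)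

theorem integral_abs_sub_shift (f : ℝ → ℝ) (d : ℝ) : ∫ x, |f x - f (x - d)| = incr f d := by
  unfold incr
  rw [← integral_add_right_eq_self (fun x => |f x - f (x - d)|) d]
  simp

/-- The flux difference is split into viscosity, increments of the density at fixed speeds, and
increments of the speed weighted by the density. After integration the two neighbours merge, through
`ℓ₁ + ℓ₂` and through `θ + (1 - θ) = 1`. -/
theorem integral_abs_step_sub_le (hP : P.Admissible) (hG : G.IsMonotone P lam)
    (hV : IsVelocity P d S V) (hu : IsDensity P.R u) :
    ∫ x, |G.step lam d V u x - u x|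
      ≤ lam * ((G.β + (1 + P.R * P.normF') * P.V) * incr u d + S * ∫ x, u x) := by
  have hV0 := hP.V_pos.le
  have hS : 0 ≤ S := (abs_nonneg _).trans (hV.increment_le 0)
  have hu' := hu.integrable
  have i1 : Integrable fun x => (G.β / 2 + P.V * G.ℓ₁) * |u x - u (x - d)| :=
    (hu'.sub (hu'.comp_sub_right d)).abs.const_mul _
  have i2 : Integrable fun x => (G.β / 2 + P.V * G.ℓ₂) * |u (x + d) - u x| :=
    (hu'.incr d).abs.const_mul _
  have i4 : Integrable fun x => S * G.θ * u (x - d) := (hu'.comp_sub_right d).const_mul _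
  have i5 : Integrable fun x => S * (1 - G.θ) * u x := hu'.const_mul _
  have i3 : Integrable fun x => S * G.θ * u (x - d) + S * (1 - G.θ) * u x := i4.add i5
  have key : ∫ x, |G.step lam d V u x - u x| ≤ ∫ x, lam * (
      (G.β / 2 + P.V * G.ℓ₁) * |u x - u (x - d)| + (G.β / 2 + P.V * G.ℓ₂) * |u (x + d) - u x|
      + (S * G.θ * u (x - d) + S * (1 - G.θ) * u x)) := by
    refine integral_mono ((step_isDensity hP hG hV hu).integrable.sub hu').abs
      (((i1.add i2).add i3).const_mul lam) fun x => ?_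
    have e : |G.step lam d V u x - u x|
        = lam * |G.fluxFn d V u x - G.fluxFn d V u (x - d)| := by
      rw [step_eq, sub_sub_cancel_left, abs_neg, abs_mul, abs_of_nonneg hG.lam_nonneg]
    simp only [e]
    refine mul_le_mul_of_nonneg_left ?_ hG.lam_nonneg
    have hl := hG.lip _ (hu.mem x) _ (hu.mem (x + d)) _ (hu.mem (x - d)) _ (hu.mem x)
    have ha := hG.add_le _ (hu.mem (x - d)) _ (hu.mem x)
    have hn1 := hG.nonneg₁ _ (hu.mem (x - d)) _ (hu.mem x)
    have hn2 := hG.nonneg₂ _ (hu.mem (x - d)) _ (hu.mem x)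
    have hs1 : |V x - V (x - d)| ≤ S := by simpa using hV.increment_le (x - d)
    have hs2 := hV.increment_le x
    have v1 := hV.mem x
    have v2 := hV.mem (x + d)
    have hb : |G.g₁ (u x) (u (x + d)) - G.g₁ (u (x - d)) (u x)| * V x
        + |G.g₂ (u x) (u (x + d)) - G.g₂ (u (x - d)) (u x)| * V (x + d)
        ≤ P.V * (G.ℓ₁ * |u x - u (x - d)| + G.ℓ₂ * |u (x + d) - u x|) := by
      have a1 := mul_le_mul_of_nonneg_left v1.2
        (abs_nonneg (G.g₁ (u x) (u (x + d)) - G.g₁ (u (x - d)) (u x)))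
      have a2 := mul_le_mul_of_nonneg_left v2.2
        (abs_nonneg (G.g₂ (u x) (u (x + d)) - G.g₂ (u (x - d)) (u x)))
      have a3 := mul_le_mul_of_nonneg_left hl hV0
      linarith
    have hc : G.g₁ (u (x - d)) (u x) * |V x - V (x - d)|
        + G.g₂ (u (x - d)) (u x) * |V (x + d) - V x|
        ≤ S * (G.θ * u (x - d) + (1 - G.θ) * u x) := by
      have a1 := mul_le_mul_of_nonneg_left hs1 hn1
      have a2 := mul_le_mul_of_nonneg_left hs2 hn2
      have a3 := mul_le_mul_of_nonneg_left ha hS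
      linarith
    have hf : G.fluxFn d V u x - G.fluxFn d V u (x - d)
        = G.β / 2 * (u x - u (x - d)) + -(G.β / 2 * (u (x + d) - u x))
          + (G.g₁ (u x) (u (x + d)) - G.g₁ (u (x - d)) (u x)) * V x
          + (G.g₂ (u x) (u (x + d)) - G.g₂ (u (x - d)) (u x)) * V (x + d)
          + G.g₁ (u (x - d)) (u x) * (V x - V (x - d))
          + G.g₂ (u (x - d)) (u x) * (V (x + d) - V x) := by
      simp only [fluxFn, flux, sub_add_cancel]; ring
    have hβ : 0 ≤ G.β / 2 := div_nonneg hG.β_nonneg zero_le_two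
    have t : ∀ a b c d e f : ℝ, |a + b + c + d + e + f| ≤ |a| + |b| + |c| + |d| + |e| + |f| := by
      intro a b c d e f
      refine (abs_add_le _ _).trans (add_le_add_left ?_ _)
      refine (abs_add_le _ _).trans (add_le_add_left ?_ _)
      refine (abs_add_le _ _).trans (add_le_add_left ?_ _)
      exact (abs_add_le _ _).trans (add_le_add_left (abs_add_le _ _) _)
    rw [hf]
    refine (t _ _ _ _ _ _).trans ?_
    rw [abs_neg]
    simp only [abs_mul, abs_of_nonneg hβ, abs_of_nonneg v1.1, abs_of_nonneg v2.1,
      abs_of_nonneg hn1, abs_of_nonneg hn2]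
    linarith
  refine key.trans (le_of_eq ?_)
  rw [integral_const_mul, integral_add_three i1 i2 i3, integral_add i4 i5]
  simp only [integral_const_mul]
  rw [integral_abs_sub_shift, integral_sub_right_eq_self, ← hG.ℓ_add]
  unfold incr
  ring

/-- The growth of the variation in one step. -/
theorem incr_step_le (hP : P.Admissible) (hG : G.IsMonotone P lam)
    (hV : IsVelocity P d S V) (hu : IsDensity P.R u) :
    incr (G.step lam d V u) d ≤ incr u d + lam * (P.R * incr (fun x => V (x + d) - V x) d
      + S * ((1 + P.R * P.normF') * incr u d)) := by
  have hu' := hu.integrable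
  have hR := hP.R_pos.le
  have hS : 0 ≤ S := (abs_nonneg _).trans (hV.increment_le 0)
  have hud := hu.comp_add d
  -- `Ψ` is the Crandall-Majda flux between the translated and the original density, both moved by
  -- the unshifted speeds. Its differences integrate to zero.
  set Ψ : ℝ → ℝ := fun x => G.fluxFn d V (fun x => max (u (x + d)) (u x)) x
    - G.fluxFn d V (fun x => min (u (x + d)) (u x)) x
  have iΨ : Integrable Ψ :=
    (fluxFn_integrable hG hV (hud.max hu)).sub (fluxFn_integrable hG hV (hud.min hu))
  set e : ℝ → ℝ := fun x => u (x + d) - u x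
  have ie : Integrable e := hu'.incr d
  set W : ℝ → ℝ := fun x => V (x + d) - V x
  have iW : Integrable fun x => |W (x + d) - W x| := (hV.integrable.incr d).abs
  have iW' : Integrable fun x => |W x - W (x - d)| := by
    simpa using iW.comp_sub_right d
  have j1 : Integrable fun x => lam * (P.R * (1 - G.θ) * |W x - W (x - d)|) :=
    (iW'.const_mul _).const_mul _
  have j2 : Integrable fun x => lam * (P.R * G.θ * |W (x + d) - W x|) :=
    (iW.const_mul _).const_mul _
  have j3 : Integrable fun x => lam * (S * G.ℓ₁ * |e x|) := (ie.abs.const_mul _).const_mul _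
  have j4 : Integrable fun x => lam * (S * G.ℓ₂ * |e (x + d)|) :=
    ((ie.comp_add_right d).abs.const_mul _).const_mul _
  have j12 : Integrable fun x => lam * (P.R * (1 - G.θ) * |W x - W (x - d)|)
      + lam * (P.R * G.θ * |W (x + d) - W x|) := j1.add j2
  have j34 : Integrable fun x => lam * (S * G.ℓ₁ * |e x|) + lam * (S * G.ℓ₂ * |e (x + d)|) :=
    j3.add j4
  have iΨd : Integrable fun x => |e x| - lam * (Ψ x - Ψ (x - d)) :=
    ie.abs.sub ((iΨ.sub (iΨ.comp_sub_right d)).const_mul lam)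
  have key : incr (G.step lam d V u) d ≤ ∫ x, ((|e x| - lam * (Ψ x - Ψ (x - d)))
      + (lam * (P.R * (1 - G.θ) * |W x - W (x - d)|) + lam * (P.R * G.θ * |W (x + d) - W x|))
      + (lam * (S * G.ℓ₁ * |e x|) + lam * (S * G.ℓ₂ * |e (x + d)|))) := by
    refine integral_mono ((step_isDensity hP hG hV hu).integrable.incr d).abs
      ((iΨd.add j12).add j34) fun x => ?_
    simp only [step, add_sub_cancel_right]
    -- `A` is the update at `x + d`, while `B` uses the same densities with the speeds belonging to
    -- the update at `x`. The contraction compares `B` with the latter, so only `A - B` has to be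
    -- estimated directly.
    set A := G.next lam (u x) (u (x + d)) (u (x + d + d)) (V x) (V (x + d)) (V (x + d + d))
    set B := G.next lam (u x) (u (x + d)) (u (x + d + d)) (V (x - d)) (V x) (V (x + d)) with hB
    have h1 := contraction hG (hu.mem x) (hu.mem (x + d)) (hu.mem (x + d + d)) (hu.mem (x - d))
      (hu.mem x) (hu.mem (x + d)) (hV.mem (x - d)) (hV.mem x) (hV.mem (x + d))
    rw [← hB] at h1
    have h2 : G.entFlux (u (x + d)) (u (x + d + d)) (u x) (u (x + d)) (V x) (V (x + d))
        = Ψ x := rfl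
    have h3 : G.entFlux (u x) (u (x + d)) (u (x - d)) (u x) (V (x - d)) (V x)
        = Ψ (x - d) := by
      simp only [entFlux, Ψ, fluxFn, sub_add_cancel]
    rw [h2, h3] at h1
    have hl := hG.lip _ (hu.mem (x + d)) _ (hu.mem (x + d + d)) _ (hu.mem x) _ (hu.mem (x + d))
    have hn1 := hG.nonneg₁ _ (hu.mem (x + d)) _ (hu.mem (x + d + d))
    have hn2 := hG.nonneg₂ _ (hu.mem (x + d)) _ (hu.mem (x + d + d))
    have hl1 := hG.le₁ _ (hu.mem (x + d)) _ (hu.mem (x + d + d))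
    have hl2 := hG.le₂ _ (hu.mem (x + d)) _ (hu.mem (x + d + d))
    have hs1 : |W (x - d)| ≤ S := hV.increment_le (x - d)
    have hs2 : |W x| ≤ S := hV.increment_le x
    -- The terms are grouped so that second differences of the speed meet the bounded factors `g₁`
    -- and `g₂`, and first differences meet increments of these factors, hence of the density.
    have hAB : A - B = -(lam * (G.g₁ (u (x + d)) (u (x + d + d)) * (W x - W (x - d))
        + G.g₂ (u (x + d)) (u (x + d + d)) * (W (x + d) - W x)
        + (G.g₁ (u (x + d)) (u (x + d + d)) - G.g₁ (u x) (u (x + d))) * W (x - d)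
        + (G.g₂ (u (x + d)) (u (x + d + d)) - G.g₂ (u x) (u (x + d))) * W x)) := by
      simp only [A, B, W, next, flux, sub_add_cancel]; ring
    have t : ∀ a b c d : ℝ, |a + b + c + d| ≤ |a| + |b| + |c| + |d| := by
      intro a b c d
      refine (abs_add_le _ _).trans (add_le_add_left ?_ _)
      exact (abs_add_le _ _).trans (add_le_add_left (abs_add_le _ _) _)
    have h4 : |A - B| ≤ lam * ((P.R * (1 - G.θ) * |W x - W (x - d)| + P.R * G.θ * |W (x + d) - W x|)
        + (S * G.ℓ₁ * |e x| + S * G.ℓ₂ * |e (x + d)|)) := by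
      rw [hAB, abs_neg, abs_mul, abs_of_nonneg hG.lam_nonneg]
      refine mul_le_mul_of_nonneg_left ((t _ _ _ _).trans ?_) hG.lam_nonneg
      simp only [abs_mul, abs_of_nonneg hn1, abs_of_nonneg hn2]
      have a1 := mul_le_mul_of_nonneg_right hl1 (abs_nonneg (W x - W (x - d)))
      have a2 := mul_le_mul_of_nonneg_right hl2 (abs_nonneg (W (x + d) - W x))
      have a3 := mul_le_mul_of_nonneg_left hs1 (abs_nonneg
        (G.g₁ (u (x + d)) (u (x + d + d)) - G.g₁ (u x) (u (x + d))))
      have a4 := mul_le_mul_of_nonneg_left hs2 (abs_nonneg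
        (G.g₂ (u (x + d)) (u (x + d + d)) - G.g₂ (u x) (u (x + d))))
      have a5 := mul_le_mul_of_nonneg_left hl hS
      simp only [e]
      linarith
    have h5 := abs_sub_le A B
      (G.next lam (u (x - d)) (u x) (u (x + d)) (V (x - d)) (V x) (V (x + d)))
    simp only [e] at h4 ⊢
    linarith
  refine key.trans (le_of_eq ?_)
  rw [integral_add_three iΨd j12 j34, integral_add j1 j2, integral_add j3 j4,
    integral_sub_mul_sub lam ie.abs iΨ (iΨ.comp_sub_right d)]
  simp only [integral_const_mul]
  rw [integral_sub_right_eq_self, integral_abs_sub_shift,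
    integral_add_right_eq_self (fun x => |e x|), ← hG.ℓ_add]
  have : ∫ x, |e x| = incr u d := rfl
  rw [this]
  have : ∫ x, |W (x + d) - W x| = incr W d := rfl
  rw [this]
  ring

end Step

end NumFlux

end DelayTraffic

/-! ### Monotonicity of the two schemes, the delayed growth estimate, and bounds on the discrete
solutions. -/

namespace DelayTraffic

/-! ### The two schemes -/

/-- The Lax-Friedrichs flux. -/
noncomputable def lfFlux (P : Model) (α : ℝ) : NumFlux where
  β := α
  θ := 1 / 2
  ℓ₁ := (1 + P.R * P.normF') / 2
  ℓ₂ := (1 + P.R * P.normF') / 2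
  g₁ a _ := P.F a / 2
  g₂ _ b := P.F b / 2

/-- The Hilliges-Weidlich flux. -/
noncomputable def hwFlux (P : Model) : NumFlux where
  β := 0
  θ := 1
  ℓ₁ := 1
  ℓ₂ := P.R * P.normF'
  g₁ _ _ := 0
  g₂ a b := a * P.fExt b

variable {P : Model}

/-- In the update the central flux cancels, which leaves the central value with coefficient `1 - lam
* α`. The neighbours enter through `α a + F a p` and `α c - F c s`, which are nondecreasing because
`α` dominates `V` times the Lipschitz constant of `F`. -/
theorem lfFlux_isMonotone (hP : P.Admissible) {α lam : ℝ}
    (hα : P.V * (1 + P.R * P.normF') ≤ α) (h0 : 0 ≤ lam)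
    (h1 : lam ≤ 1 / (α + P.V * (1 + P.R * P.normF'))) : (lfFlux P α).IsMonotone P lam := by
  have hc := hP.one_le_fluxLip
  have hR := hP.R_pos.le
  set c := 1 + P.R * P.normF' with hc_def
  have hVc : 0 < P.V * c := mul_pos hP.V_pos (by linarith)
  have hlam : lam * (α + P.V * c) ≤ 1 := (le_div_iff₀ (by linarith)).1 h1
  have hlα : lam * α ≤ 1 := by nlinarith
  have hFle : ∀ a ∈ Icc 0 P.R, P.F a ≤ a := fun a ha => hP.F_le ha.1
  have hF0 : ∀ a ∈ Icc 0 P.R, 0 ≤ P.F a := fun a ha => hP.F_nonneg ha.1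
  refine ⟨h0, hVc.le.trans hα, by norm_num [lfFlux], by simp only [lfFlux]; linarith,
    (hP.F_continuous.comp continuous_fst).div_const 2,
    (hP.F_continuous.comp continuous_snd).div_const 2, ?_, ?_, ?_, ?_, ?_, ?_, ?_, ?_, ?_⟩
  · intro r; simp only [lfFlux]; ring
  · intro r; simp only [lfFlux]; ring
  · intro a ha b _; simp only [lfFlux]; linarith [hF0 a ha]
  · intro a _ b hb; simp only [lfFlux]; linarith [hF0 b hb]
  · intro a ha b _; simp only [lfFlux]; linarith [hFle a ha, ha.2]
  · intro a _ b hb; simp only [lfFlux]; linarith [hFle b hb, hb.2]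
  · intro a ha b hb; simp only [lfFlux]; linarith [hFle b hb, hFle a ha]
  · intro a ha b hb a' ha' b' hb'
    have h1 := hP.F_abs_sub_le ha ha'
    have h2 := hP.F_abs_sub_le hb hb'
    simp only [lfFlux, ← sub_div, abs_div, abs_two]
    linarith
  · intro a ha b hb x hx a' ha' b' hb' x' hx' p hp q hq s hs haa hbb hxx
    have k1 := hP.F_abs_sub_le ha' ha
    have k2 := hP.F_abs_sub_le hx' hx
    rw [abs_of_nonneg (sub_nonneg.2 haa), abs_le] at k1
    rw [abs_of_nonneg (sub_nonneg.2 hxx), abs_le] at k2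
    have k3 : 0 ≤ (P.F a' - P.F a) * p + α * (a' - a) := by
      have : -(α * (a' - a)) ≤ (P.F a' - P.F a) * p := by
        have e1 := mul_le_mul_of_nonneg_right k1.1 hp.1
        have e2 := mul_le_mul_of_nonneg_right hp.2
          (mul_nonneg (by linarith : 0 ≤ c) (sub_nonneg.2 haa))
        have e3 := mul_le_mul_of_nonneg_right hα (sub_nonneg.2 haa)
        nlinarith
      linarith
    have k4 : (P.F x' - P.F x) * s ≤ α * (x' - x) := by
      have e1 := mul_le_mul_of_nonneg_right k2.2 hs.1
      have e2 := mul_le_mul_of_nonneg_right hs.2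
        (mul_nonneg (by linarith : 0 ≤ c) (sub_nonneg.2 hxx))
      have e3 := mul_le_mul_of_nonneg_right hα (sub_nonneg.2 hxx)
      nlinarith
    have k5 := mul_nonneg h0 k3
    have k6 := mul_le_mul_of_nonneg_left k4 h0
    have k7 := mul_le_mul_of_nonneg_right hlα (sub_nonneg.2 hbb)
    simp only [NumFlux.next, NumFlux.flux, lfFlux]
    nlinarith

/-- The update is `b - lam (b f(c) s - a f(b) q)`. It is nondecreasing in `a` since `f ≥ 0`, and in
`c` since `f` is nonincreasing. The loss in `b` is at most `lam (V + R‖f'‖V)` times the increment,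
which is what the CFL condition absorbs. -/
theorem hwFlux_isMonotone (hP : P.Admissible) {lam : ℝ} (h0 : 0 ≤ lam)
    (h1 : lam ≤ 1 / (P.V * (1 + P.R * P.normF'))) : (hwFlux P).IsMonotone P lam := by
  have hc := hP.one_le_fluxLip
  have hR := hP.R_pos.le
  have hf := hP.fExt_mem
  have hVc : 0 < P.V * (1 + P.R * P.normF') := mul_pos hP.V_pos (by linarith)
  have hlam : lam * (P.V * (1 + P.R * P.normF')) ≤ 1 := (le_div_iff₀ hVc).1 h1
  have hle : ∀ a ∈ Icc 0 P.R, ∀ b, a * P.fExt b ≤ a :=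
    fun a ha b => mul_le_of_le_one_right ha.1 (hf b).2
  refine ⟨h0, le_rfl, by simp [hwFlux],
    rfl, continuous_const,
    continuous_fst.mul (hP.fExt_continuous.comp continuous_snd), ?_, ?_, ?_, ?_, ?_, ?_, ?_, ?_, ?_⟩
  · intro r; simp [hwFlux]
  · intro r; simp [hwFlux, Model.F]
  · intro a _ b _; exact le_rfl
  · intro a ha b _; exact mul_nonneg ha.1 (hf b).1
  · intro a _ b _; simp [hwFlux]
  · intro a ha b _; simpa [hwFlux] using (hle a ha b).trans ha.2
  · intro a ha b _; simpa [hwFlux] using hle a ha b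
  · intro a ha b hb a' ha' b' hb'
    have e : a * P.fExt b - a' * P.fExt b'
        = (a - a') * P.fExt b + a' * (P.fExt b - P.fExt b') := by ring
    simp only [hwFlux, sub_self, abs_zero, zero_add, e, one_mul]
    refine (abs_add_le _ _).trans ?_
    rw [abs_mul, abs_mul, abs_of_nonneg (hf b).1, abs_of_nonneg ha'.1, mul_assoc]
    exact add_le_add (mul_le_of_le_one_right (abs_nonneg _) (hf b).2)
      (mul_le_mul ha'.2 (hP.f_abs_sub_le hb hb') (abs_nonneg _) hR)
  · intro a ha b hb x hx a' ha' b' hb' x' hx' p hp q hq s hs haa hbb hxx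
    have k1 : a * P.fExt b * q ≤ a' * P.fExt b * q :=
      mul_le_mul_of_nonneg_right (mul_le_mul_of_nonneg_right haa (hf b).1) hq.1
    have k2 : b' * P.fExt x' * s ≤ b' * P.fExt x * s :=
      mul_le_mul_of_nonneg_right (mul_le_mul_of_nonneg_left (hP.f_anti hx hx' hxx) hb'.1) hs.1
    have hD := (abs_le.1 (hP.f_abs_sub_le hb' hb)).1
    rw [abs_of_nonneg (sub_nonneg.2 hbb)] at hD
    have hfn : 0 ≤ P.normF' * (b' - b) := mul_nonneg Model.normF'_nonneg (sub_nonneg.2 hbb)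
    -- The inflow decreases when the central cell fills up; this costs the share `R‖f'‖` of the CFL
    -- condition, and the outflow in `k4` costs the share `1`.
    have k3 : a' * q * (P.fExt b - P.fExt b') ≤ P.R * P.V * (P.normF' * (b' - b)) :=
      (mul_le_mul_of_nonneg_left (by linarith) (mul_nonneg ha'.1 hq.1)).trans
        (mul_le_mul_of_nonneg_right (mul_le_mul ha'.2 hq.2 hq.1 hR) hfn)
    have k4 : (b' - b) * (P.fExt x * s) ≤ (b' - b) * P.V :=
      mul_le_mul_of_nonneg_left ((mul_le_of_le_one_left hs.1 (hf x).2).trans hs.2)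
        (sub_nonneg.2 hbb)
    have k5 := mul_le_mul_of_nonneg_right hlam (sub_nonneg.2 hbb)
    have k6 := mul_le_mul_of_nonneg_left (add_le_add (add_le_add k1 k2) (add_le_add k3 k4)) h0
    simp only [NumFlux.next, NumFlux.flux, hwFlux]
    nlinarith

/-! ### From sequences to functions on the line -/

/-- The piecewise constant function on the cells of length `d`. -/
noncomputable def lift (d : ℝ) (q : ℤ → ℝ) (x : ℝ) : ℝ := q (⌊x / d⌋ + 1)

theorem lift_measurable (d : ℝ) (q : ℤ → ℝ) : Measurable (lift d q) :=
  (measurable_from_top (f := fun i : ℤ => q (i + 1))).comp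
    (Int.measurable_floor.comp (measurable_id.div_const d))

theorem floor_add_nat_mul_div {d : ℝ} (hd : 0 < d) (x : ℝ) (k : ℕ) :
    ⌊(x + k * d) / d⌋ = ⌊x / d⌋ + k := by
  rw [add_div, mul_div_cancel_right₀ _ hd.ne', Int.floor_add_natCast]

theorem floor_add_div {d : ℝ} (hd : 0 < d) (x : ℝ) : ⌊(x + d) / d⌋ = ⌊x / d⌋ + 1 := by
  simpa using floor_add_nat_mul_div hd x 1

theorem floor_sub_div {d : ℝ} (hd : 0 < d) (x : ℝ) : ⌊(x - d) / d⌋ = ⌊x / d⌋ - 1 := by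
  rw [sub_div, div_self hd.ne', Int.floor_sub_one]

/-- One step of the scheme on sequences. -/
noncomputable def seqStep (P : Model) (G : NumFlux) (N h : ℕ) (u w : ℤ → ℝ) (j : ℤ) : ℝ :=
  G.next (P.lam N h) (u (j - 1)) (u j) (u (j + 1))
    (P.cellSpeed N w (j - 1)) (P.cellSpeed N w j) (P.cellSpeed N w (j + 1))

theorem stepLF_eq (α : ℝ) (N h : ℕ) : P.stepLF α N h = seqStep P (lfFlux P α) N h := by
  ext u w j
  simp only [Model.stepLF, seqStep, NumFlux.next, NumFlux.flux, lfFlux]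
  ring

theorem stepHW_eq (N h : ℕ) : P.stepHW N h = seqStep P (hwFlux P) N h := by
  ext u w j
  simp only [Model.stepHW, seqStep, NumFlux.next, NumFlux.flux, hwFlux]
  ring

theorem vel_lift (hP : P.Admissible) {N : ℕ} (hN : 0 < N) (w : ℤ → ℝ) (x : ℝ) :
    P.vel N (lift (P.dx N) w) x = P.cellSpeed N w (⌊x / P.dx N⌋ + 1) := by
  have hd := hP.dx_pos hN
  unfold Model.vel Model.avg Model.cellSpeed lift
  congr 3 with k
  rw [floor_add_nat_mul_div hd, add_right_comm]

/-- Translations by one cell commute with the integer part, so the scheme on sequences is the scheme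
on the line restricted to piecewise constant functions, and the integral estimates apply to it. -/
theorem lift_seqStep (hP : P.Admissible) {N : ℕ} (hN : 0 < N) (G : NumFlux) (h : ℕ)
    (u w : ℤ → ℝ) : lift (P.dx N) (seqStep P G N h u w)
      = G.step (P.lam N h) (P.dx N) (P.vel N (lift (P.dx N) w)) (lift (P.dx N) u) := by
  ext x
  have hd := hP.dx_pos hN
  simp only [NumFlux.step, vel_lift hP hN]
  simp only [lift, seqStep, floor_add_div hd, floor_sub_div hd, add_sub_cancel_right,
    sub_add_cancel]

/-- The discrete solution at step `n`, as a function on the line. -/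
noncomputable def sol (P : Model) (G : NumFlux) (N h : ℕ) (u₀ : ℤ → ℝ) (n : ℕ) : ℝ → ℝ :=
  lift (P.dx N) (Model.iterate (seqStep P G N h) h u₀ n)

theorem sol_zero (G : NumFlux) (N h : ℕ) (u₀ : ℤ → ℝ) :
    sol P G N h u₀ 0 = lift (P.dx N) u₀ := by
  rw [sol, Model.iterate]

theorem sol_succ (hP : P.Admissible) (G : NumFlux) {N : ℕ} (hN : 0 < N) (h : ℕ) (u₀ : ℤ → ℝ)
    (n : ℕ) : sol P G N h u₀ (n + 1) = G.step (P.lam N h) (P.dx N)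
      (P.vel N (sol P G N h u₀ (n - h))) (sol P G N h u₀ n) := by
  rw [sol, Model.iterate, lift_seqStep hP hN]
  rfl

/-! ### The growth factor -/

namespace Model

/-- The growth of the total variation over one delay. -/
noncomputable def delayGrowth (P : Model) : ℝ := 2 * Real.exp (P.M * P.τ) - 1

theorem Admissible.one_le_two_exp_sub {x : ℝ} (hx : 0 ≤ x) : 1 ≤ 2 * Real.exp x - 1 := by
  linarith [Real.one_le_exp hx]

theorem Admissible.one_le_delayGrowth (hP : P.Admissible) : 1 ≤ P.delayGrowth :=
  one_le_two_exp_sub (mul_nonneg hP.M_nonneg hP.τ_pos.le)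

/-- The formula of the `k`-th delay interval also holds at its right endpoint, where the integer
part jumps: there `2e^{ℳτ} - 1` becomes one more factor of the power and the new exponential is `1`.
A time step may therefore end on a multiple of the delay. -/
theorem Admissible.growth_eq (hP : P.Admissible) (k : ℕ) {s : ℝ} (hs : s ∈ Icc 0 P.τ) :
    P.growth (k * P.τ + s) = (2 * Real.exp (P.M * s) - 1) * P.delayGrowth ^ k := by
  have hτ := hP.τ_pos
  have hdiv : (k * P.τ + s) / P.τ = k + s / P.τ := by field_simp
  rcases hs.2.eq_or_lt with rfl | h
  · have hf : ⌊(k * P.τ + P.τ) / P.τ⌋₊ = k + 1 := by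
      rw [hdiv, div_self hτ.ne']
      exact_mod_cast Nat.floor_natCast (k + 1)
    rw [growth, hf, show (k * P.τ + P.τ - ((k + 1 : ℕ) : ℝ) * P.τ) = 0 by push_cast; ring,
      pow_succ, delayGrowth]
    norm_num
    ring
  · have hf : ⌊(k * P.τ + s) / P.τ⌋₊ = k := by
      rw [hdiv, Nat.floor_eq_iff (by have := hs.1; positivity)]
      exact ⟨by have := hs.1; simp; positivity, by
        have := (div_lt_one hτ).2 h; linarith⟩
    rw [growth, hf, add_sub_cancel_left, delayGrowth]

theorem Admissible.exists_delay_decomp (hP : P.Admissible) {t : ℝ} (ht : 0 ≤ t) :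
    ∃ (k : ℕ) (s : ℝ), s ∈ Ico 0 P.τ ∧ t = k * P.τ + s := by
  have hτ := hP.τ_pos
  have h1 := Nat.floor_le (div_nonneg ht hτ.le)
  have h2 := Nat.lt_floor_add_one (t / P.τ)
  rw [le_div_iff₀ hτ] at h1
  rw [div_lt_iff₀ hτ] at h2
  exact ⟨⌊t / P.τ⌋₊, t - ⌊t / P.τ⌋₊ * P.τ, ⟨by linarith, by linarith⟩, by ring⟩

theorem Admissible.growth_mono (hP : P.Admissible) {s t : ℝ} (hs : 0 ≤ s) (hst : s ≤ t) :
    P.growth s ≤ P.growth t := by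
  have hM := hP.M_nonneg
  have hΓ := hP.one_le_delayGrowth
  obtain ⟨k, r, hr, rfl⟩ := hP.exists_delay_decomp hs
  obtain ⟨l, q, hq, rfl⟩ := hP.exists_delay_decomp (hs.trans hst)
  rw [hP.growth_eq k ⟨hr.1, hr.2.le⟩, hP.growth_eq l ⟨hq.1, hq.2.le⟩]
  have hkl : k ≤ l := by
    by_contra! h
    have : ((l : ℝ) + 1) * P.τ ≤ k * P.τ :=
      mul_le_mul_of_nonneg_right (by exact_mod_cast h) hP.τ_pos.le
    linarith [hr.1, hq.2]
  have h1 := one_le_two_exp_sub (mul_nonneg hM hq.1)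
  rcases hkl.eq_or_lt with rfl | hlt
  · have : P.M * r ≤ P.M * q := mul_le_mul_of_nonneg_left (by linarith) hM
    gcongr
  · calc (2 * Real.exp (P.M * r) - 1) * P.delayGrowth ^ k
        ≤ P.delayGrowth * P.delayGrowth ^ k := by
          have : P.M * r ≤ P.M * P.τ := mul_le_mul_of_nonneg_left hr.2.le hM
          unfold delayGrowth at hΓ ⊢
          gcongr
      _ = P.delayGrowth ^ (k + 1) := by ring
      _ ≤ P.delayGrowth ^ l := pow_le_pow_right₀ hΓ hlt
      _ ≤ _ := le_mul_of_one_le_left (by positivity) h1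

theorem Admissible.growth_zero (hP : P.Admissible) : P.growth 0 = 1 := by
  have := hP.growth_eq 0 (left_mem_Icc.2 hP.τ_pos.le)
  simpa [show (2 : ℝ) - 1 = 1 by norm_num] using this

theorem Admissible.one_le_growth (hP : P.Admissible) {t : ℝ} (ht : 0 ≤ t) : 1 ≤ P.growth t := by
  simpa [hP.growth_zero] using hP.growth_mono le_rfl ht

/-- With `Γ` the growth over one delay, the delayed value is at most `Γ^k` on the `k`-th delay
interval. There `y(s) = (2e^{ℳs} - 1) Γ^k` solves `y' = ℳ (Γ^k + y)`, and `e^x ≥ 1 + x` turns this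
into the discrete inequality. -/
theorem Admissible.growth_step (hP : P.Admissible) {h : ℕ} (hh : 0 < h) (n : ℕ) :
    P.growth (n * P.dt h) + P.dt h * P.M * (P.growth ((n - h : ℕ) * P.dt h)
      + P.growth (n * P.dt h)) ≤ P.growth ((n + 1 : ℕ) * P.dt h) := by
  have hM := hP.M_nonneg
  have hδ := hP.dt_pos hh
  have hΓ := hP.one_le_delayGrowth
  have hτ : h * P.dt h = P.τ := mul_dt hh
  set δ := P.dt h
  set k := n / h
  set i := n % h
  have hi : i + 1 ≤ h := Nat.mod_lt n hh
  have hn : n = k * h + i := by rw [mul_comm]; exact (Nat.div_add_mod n h).symm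
  have hs : (i : ℝ) * δ + δ ≤ P.τ := by
    rw [← hτ, ← add_one_mul]
    exact mul_le_mul_of_nonneg_right (by exact_mod_cast hi) hδ.le
  have h0 : 0 ≤ (i : ℝ) * δ := by positivity
  have e1 : (n : ℝ) * δ = k * P.τ + i * δ := by rw [← hτ]; nth_rw 1 [hn]; push_cast; ring
  have e2 : ((n + 1 : ℕ) : ℝ) * δ = k * P.τ + (i * δ + δ) := by push_cast; rw [add_mul, e1]; ring
  rw [e1, e2, hP.growth_eq k ⟨h0, by linarith⟩, hP.growth_eq k ⟨by linarith, hs⟩]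
  have h3 : P.growth ((n - h : ℕ) * δ) ≤ P.delayGrowth ^ k := by
    rcases Nat.eq_zero_or_pos k with hk | hk
    -- During the first delay the truncated index is `0`, and the growth factor there is `1 = Γ^0`.
    · have : n - h = 0 := by rw [hn, hk]; omega
      simp [this, hk, hP.growth_zero]
    · obtain ⟨l, hl⟩ : ∃ l, k = l + 1 := ⟨k - 1, by omega⟩
      have : n - h = l * h + i := by
        rw [hn, hl, add_mul, one_mul]; omega
      rw [this, show ((l * h + i : ℕ) : ℝ) * δ = l * P.τ + i * δ by rw [← hτ]; push_cast; ring,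
        hP.growth_eq l ⟨h0, by linarith⟩, hl, pow_succ']
      have : P.M * (i * δ) ≤ P.M * P.τ := mul_le_mul_of_nonneg_left (by linarith) hM
      refine mul_le_mul_of_nonneg_right ?_ (by positivity)
      unfold delayGrowth
      gcongr
  have h4 : Real.exp (P.M * (i * δ)) * (1 + P.M * δ) ≤ Real.exp (P.M * (i * δ + δ)) := by
    rw [mul_add P.M, Real.exp_add]
    exact mul_le_mul_of_nonneg_left (by linarith [Real.add_one_le_exp (P.M * δ)])
      (Real.exp_pos _).le
  have hp : 0 ≤ P.delayGrowth ^ k := by positivity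
  have h5 := mul_le_mul_of_nonneg_right h4 hp
  have h6 := mul_le_mul_of_nonneg_left h3 (mul_nonneg hδ.le hM)
  nlinarith

end Model

/-! ### Bounds on the discrete solutions -/

theorem isVelocity_vel (hP : P.Admissible) {N : ℕ} (hN : 0 < N) {w : ℝ → ℝ}
    (hw : IsDensity P.R w) :
    NumFlux.IsVelocity P (P.dx N) (2 * P.normω * P.R * P.normV' * P.dx N) (P.vel N w) :=
  ⟨hP.vel_measurable hN hw, hP.vel_mem hN hw, hP.abs_vel_increment_le hN hw,
    hP.vel_increment_integrable hN hw _⟩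

theorem lam_mul_dx (hP : P.Admissible) {N : ℕ} (hN : 0 < N) (h : ℕ) :
    P.lam N h * P.dx N = P.dt h := div_mul_cancel₀ _ (hP.dx_pos hN).ne'

theorem lam_nonneg (hP : P.Admissible) {N h : ℕ} (hN : 0 < N) (hh : 0 < h) : 0 ≤ P.lam N h :=
  div_nonneg (hP.dt_pos hh).le (hP.dx_pos hN).le

theorem two_mul_normω_le_M (hP : P.Admissible) :
    2 * P.normω * P.R * P.normV' * (1 + P.R * P.normF') ≤ P.M := by
  have h1 : P.R * (P.normV' * P.normF') ≤ P.R * max (3 * P.normV'') (P.normV' * P.normF') :=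
    mul_le_mul_of_nonneg_left (le_max_right _ _) hP.R_pos.le
  have h2 : 0 ≤ 2 * P.normω * P.R :=
    mul_nonneg (mul_nonneg zero_le_two Model.normω_nonneg) hP.R_pos.le
  have h3 := mul_le_mul_of_nonneg_left h1 h2
  unfold Model.M
  linarith

/-- Here `2‖v''‖` would suffice in place of the `3‖v''‖` of `ℳ`. -/
theorem R_mul_curv_le_M (hP : P.Admissible) : P.R * P.curv ≤ P.M := by
  have h1 : P.R * (3 * P.normV'') ≤ P.R * max (3 * P.normV'') (P.normV' * P.normF') :=
    mul_le_mul_of_nonneg_left (le_max_left _ _) hP.R_pos.le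
  have h2 : 0 ≤ 2 * P.normω * P.R :=
    mul_nonneg (mul_nonneg zero_le_two Model.normω_nonneg) hP.R_pos.le
  have h3 := mul_le_mul_of_nonneg_left h1 h2
  have h4 : 0 ≤ 2 * P.normω * P.R * (P.R * P.normV'') :=
    mul_nonneg h2 (mul_nonneg hP.R_pos.le Model.normV''_nonneg)
  unfold Model.M Model.curv
  linarith

section Sol

variable {G : NumFlux} {N h : ℕ} {u₀ : ℤ → ℝ}

theorem sol_isDensity (hP : P.Admissible) (hN : 0 < N) (hG : G.IsMonotone P (P.lam N h))
    (h0 : IsDensity P.R (lift (P.dx N) u₀)) (n : ℕ) : IsDensity P.R (sol P G N h u₀ n) := by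
  induction n using Nat.strong_induction_on with
  | _ n ih =>
    cases n with
    | zero => rwa [sol_zero]
    | succ n =>
      rw [sol_succ hP G hN]
      exact NumFlux.step_isDensity hP hG (isVelocity_vel hP hN (ih _ (by omega)))
        (ih n n.lt_succ_self)

theorem integral_sol (hP : P.Admissible) (hN : 0 < N) (hG : G.IsMonotone P (P.lam N h))
    (h0 : IsDensity P.R (lift (P.dx N) u₀)) (n : ℕ) :
    ∫ x, sol P G N h u₀ n x = ∫ x, lift (P.dx N) u₀ x := by
  induction n with
  | zero => rw [sol_zero]
  | succ n ih =>
    have hs := sol_isDensity hP hN hG h0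
    rw [sol_succ hP G hN, NumFlux.integral_step hG (isVelocity_vel hP hN (hs _)) (hs n), ih]

/-- One step adds at most `Δt ℳ` times the sum of the current and the delayed variation, and the
growth factor is a supersolution of this recursion. The induction is strong because it refers to the
step `n - h`. -/
theorem incr_sol_le (hP : P.Admissible) (hN : 0 < N) (hh : 0 < h)
    (hG : G.IsMonotone P (P.lam N h)) (h0 : IsDensity P.R (lift (P.dx N) u₀)) {C : ℝ}
    (hC : incr (lift (P.dx N) u₀) (P.dx N) ≤ C * P.dx N) (n : ℕ) :
    incr (sol P G N h u₀ n) (P.dx N) ≤ P.growth (n * P.dt h) * (C * P.dx N) := by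
  have hs := sol_isDensity hP hN hG h0
  have hC0 : 0 ≤ C * P.dx N := (incr_nonneg _ _).trans hC
  induction n using Nat.strong_induction_on with
  | _ n ih =>
    cases n with
    | zero => simpa [sol_zero, hP.growth_zero] using hC
    | succ n =>
      have h1 := ih n n.lt_succ_self
      have h2 := ih (n - h) (by omega)
      have hd := hP.dx_pos hN
      rw [sol_succ hP G hN]
      refine (NumFlux.incr_step_le hP hG (isVelocity_vel hP hN (hs _)) (hs n)).trans ?_
      have h3 := hP.integral_abs_vel_second_le hN (hs (n - h))
      set d := P.dx N
      set U := incr (sol P G N h u₀ n) d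
      set W := incr (sol P G N h u₀ (n - h)) d
      have hU : 0 ≤ U := incr_nonneg _ _
      have hW : 0 ≤ W := incr_nonneg _ _
      have hl := lam_nonneg (h := h) hP hN hh
      have hδ : P.lam N h * d = P.dt h := lam_mul_dx hP hN h
      -- The second differences of the speed account for the delayed variation `W`, and its first
      -- differences account for the current variation `U`. Each coefficient is separately at most
      -- `ℳ`, and both carry a factor `d` which turns `λ` into `Δt`.
      have h4 : P.lam N h * (P.R * incr (fun x => P.vel N (sol P G N h u₀ (n - h)) (x + d)
          - P.vel N (sol P G N h u₀ (n - h)) x) d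
          + 2 * P.normω * P.R * P.normV' * d * ((1 + P.R * P.normF') * U))
          ≤ P.dt h * P.M * (W + U) := by
        have a1 := mul_le_mul_of_nonneg_left h3 hP.R_pos.le
        have a2 := mul_le_mul_of_nonneg_right (R_mul_curv_le_M hP) (mul_nonneg hd.le hW)
        have a3 := mul_le_mul_of_nonneg_right (two_mul_normω_le_M hP) (mul_nonneg hd.le hU)
        rw [← hδ, mul_assoc (P.lam N h), mul_assoc (P.lam N h)]
        exact mul_le_mul_of_nonneg_left (by linarith) hl
      have h5 : P.dt h * P.M * (W + U) ≤ P.dt h * P.M * (P.growth ((n - h : ℕ) * P.dt h)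
          + P.growth (n * P.dt h)) * (C * d) := by
        rw [mul_assoc (P.dt h * P.M), add_mul]
        exact mul_le_mul_of_nonneg_left (add_le_add h2 h1)
          (mul_nonneg (hP.dt_pos hh).le hP.M_nonneg)
      have h6 := mul_le_mul_of_nonneg_right (hP.growth_step hh n) hC0
      linarith

theorem integral_abs_sol_succ_sub_le (hP : P.Admissible) (hN : 0 < N) (hh : 0 < h)
    (hG : G.IsMonotone P (P.lam N h)) (h0 : IsDensity P.R (lift (P.dx N) u₀)) {C : ℝ}
    (hC : incr (lift (P.dx N) u₀) (P.dx N) ≤ C * P.dx N) (n : ℕ) :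
    ∫ x, |sol P G N h u₀ (n + 1) x - sol P G N h u₀ n x| ≤ P.dt h *
      ((G.β + (1 + P.R * P.normF') * P.V) * P.growth (n * P.dt h) * C
        + 2 * P.R * P.normω * P.normV' * ∫ x, lift (P.dx N) u₀ x) := by
  have hs := sol_isDensity hP hN hG h0
  rw [sol_succ hP G hN]
  refine (NumFlux.integral_abs_step_sub_le hP hG (isVelocity_vel hP hN (hs _)) (hs n)).trans ?_
  have hδ : ∀ X, P.dt h * X = P.lam N h * (P.dx N * X) := fun X => by
    rw [← mul_assoc, lam_mul_dx hP hN]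
  rw [integral_sol hP hN hG h0, hδ]
  refine mul_le_mul_of_nonneg_left ?_ (lam_nonneg hP hN hh)
  have : 0 ≤ G.β + (1 + P.R * P.normF') * P.V :=
    add_nonneg hG.β_nonneg (mul_nonneg (by linarith [hP.one_le_fluxLip]) hP.V_pos.le)
  have := mul_le_mul_of_nonneg_left (incr_sol_le hP hN hh hG h0 hC n) this
  linarith

theorem integral_sol_mul_le (hP : P.Admissible) (hN : 0 < N)
    (hG : G.IsMonotone P (P.lam N h)) (h0 : IsDensity P.R (lift (P.dx N) u₀)) {ψ : ℝ → ℝ}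
    (hψ : Measurable ψ) {B K : ℝ} (hB : ∀ x, |ψ x| ≤ B)
    (hK : ∀ x y, |ψ x - ψ y| ≤ K * |x - y|) (n : ℕ) :
    ∫ x, sol P G N h u₀ n x * ψ x ≤ (∫ x, lift (P.dx N) u₀ x * ψ x)
      + n * P.dt h * (K * ((G.β + P.V) * ∫ x, lift (P.dx N) u₀ x)) := by
  have hs := sol_isDensity hP hN hG h0
  induction n with
  | zero => simp [sol_zero]
  | succ n ih =>
    have hd := hP.dx_pos hN
    have h1 := NumFlux.integral_step_mul_le hG (isVelocity_vel hP hN (hs (n - h))) (hs n) hψ hB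
      (K := K * P.dx N) fun x => by simpa [abs_of_pos hd] using hK (x + P.dx N) x
    rw [sol_succ hP G hN]
    rw [integral_sol hP hN hG h0] at h1
    have : P.lam N h * (K * P.dx N * ((G.β + P.V) * ∫ x, lift (P.dx N) u₀ x))
        = P.dt h * (K * ((G.β + P.V) * ∫ x, lift (P.dx N) u₀ x)) := by
      rw [← lam_mul_dx hP hN]; ring
    push_cast
    linarith

end Sol

end DelayTraffic

/-! ### Increments in the mean, duality with the total variation, and cell means of the datum. -/

namespace DelayTraffic

/-! ### Increments in `L¹` -/

/-- The extended `L¹` norm of the increments of step `a`. -/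
noncomputable def lincr (u : ℝ → ℝ) (a : ℝ) : ℝ≥0∞ := ∫⁻ x, ‖u (x + a) - u x‖ₑ

theorem lincr_eq_ofReal_incr {u : ℝ → ℝ} {a : ℝ} (hu : Integrable fun x => u (x + a) - u x) :
    lincr u a = ENNReal.ofReal (incr u a) :=
  (ofReal_integral_norm_eq_lintegral_enorm hu).symm

theorem lincr_neg (u : ℝ → ℝ) (a : ℝ) : lincr u (-a) = lincr u a := by
  unfold lincr
  rw [← lintegral_add_right_eq_self (fun x => ‖u (x + -a) - u x‖ₑ) a]
  simp only [add_neg_cancel_right]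
  exact lintegral_congr fun x => by rw [← enorm_neg, neg_sub]

theorem lincr_nat_mul_le {u : ℝ → ℝ} (hu : Measurable u) (b : ℝ) (m : ℕ) :
    lincr u (m * b) ≤ m * lincr u b := by
  induction m with
  | zero => simp [lincr]
  | succ m ih =>
    have h1 : ∫⁻ x, ‖u (x + m * b + b) - u (x + m * b)‖ₑ = lincr u b :=
      lintegral_add_right_eq_self (fun x => ‖u (x + b) - u x‖ₑ) (m * b)
    calc lincr u ((m + 1 : ℕ) * b)
        ≤ ∫⁻ x, (‖u (x + m * b + b) - u (x + m * b)‖ₑ + ‖u (x + m * b) - u x‖ₑ) := by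
          refine lintegral_mono fun x => ?_
          have : u (x + (m + 1 : ℕ) * b) - u x
              = (u (x + m * b + b) - u (x + m * b)) + (u (x + m * b) - u x) := by
            rw [show x + ((m + 1 : ℕ) : ℝ) * b = x + m * b + b by push_cast; ring]; ring
          simp only [this]
          exact enorm_add_le _ _
      _ = lincr u b + lincr u (m * b) := by
          rw [lintegral_add_left (by fun_prop), h1]; rfl
      _ ≤ _ := by
          push_cast
          rw [add_mul, one_mul, add_comm]
          exact add_le_add_left ih _

theorem floor_div_eq_iff {d : ℝ} (hd : 0 < d) (x : ℝ) (i : ℤ) :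
    ⌊x / d⌋ = i ↔ x ∈ Ico (i * d) ((i + 1) * d) := by
  rw [Int.floor_eq_iff, le_div_iff₀ hd, div_lt_iff₀ hd, mem_Ico]

/-- The increments of a piecewise constant function are controlled by those over one cell. -/
theorem lincr_lift_le {d : ℝ} (hd : 0 < d) {q : ℤ → ℝ} {e : ℝ → ℝ≥0∞} (he : Measurable e)
    (hq : ∀ i : ℤ, ‖q (i + 1 + 1) - q (i + 1)‖ₑ
      ≤ ENNReal.ofReal (1 / d) * ∫⁻ y in Ico (i * d) ((i + 1) * d), e y) {a : ℝ} (ha : 0 < a) :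
    lincr (lift d q) a ≤ ENNReal.ofReal (a / d) * ∫⁻ y, e y := by
  have small : ∀ b, 0 < b → b ≤ d → lincr (lift d q) b ≤ ENNReal.ofReal (b / d) * ∫⁻ y, e y := by
    intro b hb hbd
    have hfl : Measurable fun x : ℝ => ⌊x / d⌋ :=
      Int.measurable_floor.comp (measurable_id.div_const d)
    -- For a shift `b ≤ d` the function changes only when `x + b` lies in the next cell. `A`
    -- collects these `x` together with the points `y` of the cell of `x`; for fixed `y` the
    -- admissible `x` have measure at most `b`, and Tonelli's theorem concludes.
    set A : Set (ℝ × ℝ) := {z | ⌊z.2 / d⌋ = ⌊z.1 / d⌋ ∧ ⌊(z.1 + b) / d⌋ = ⌊z.1 / d⌋ + 1} with hA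
    have hAm : MeasurableSet A := by
      have h1 : Measurable fun z : ℝ × ℝ => ⌊z.1 / d⌋ := hfl.comp measurable_fst
      have h2 : Measurable fun z : ℝ × ℝ => ⌊z.2 / d⌋ := hfl.comp measurable_snd
      have h3 : Measurable fun z : ℝ × ℝ => ⌊(z.1 + b) / d⌋ :=
        hfl.comp (measurable_fst.add_const b)
      exact (measurableSet_eq_fun h2 h1).inter (measurableSet_eq_fun h3 (h1.add_const 1))
    have point : ∀ x, ‖lift d q (x + b) - lift d q x‖ₑ
        ≤ ENNReal.ofReal (1 / d) * ∫⁻ y, A.indicator (fun z => e z.2) (x, y) := by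
      intro x
      obtain ⟨i, hi⟩ : ∃ i, ⌊x / d⌋ = i := ⟨_, rfl⟩
      have hx := (floor_div_eq_iff hd x i).1 hi
      rcases lt_or_ge (x + b) ((i + 1) * d) with h | h
      · have : ⌊(x + b) / d⌋ = i := (floor_div_eq_iff hd _ _).2 ⟨by linarith [hx.1], h⟩
        simp [lift, this, hi]
      · have h2 : ⌊(x + b) / d⌋ = i + 1 := (floor_div_eq_iff hd _ _).2
          ⟨by push_cast; exact h, by push_cast; linarith [hx.2]⟩
        simp only [lift, h2, hi]
        refine (hq i).trans (le_of_eq ?_)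
        rw [← lintegral_indicator measurableSet_Ico]
        congr 1
        refine lintegral_congr fun y => ?_
        by_cases hy : y ∈ Ico (i * d) ((i + 1) * d)
        · rw [indicator_of_mem hy, indicator_of_mem]
          exact ⟨((floor_div_eq_iff hd y i).2 hy).trans hi.symm, h2.trans (by rw [hi])⟩
        · rw [indicator_of_notMem hy, indicator_of_notMem]
          exact fun h => hy ((floor_div_eq_iff hd y i).1 (h.1.trans hi))
    have hm : Measurable (A.indicator fun z : ℝ × ℝ => e z.2) :=
      (he.comp measurable_snd).indicator hAm
    have slice : ∀ y, ∫⁻ x, A.indicator (fun z => e z.2) (x, y) ≤ ENNReal.ofReal b * e y := by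
      intro y
      set i := ⌊y / d⌋ with hi
      calc ∫⁻ x, A.indicator (fun z => e z.2) (x, y)
          ≤ ∫⁻ x, (Ico ((i + 1) * d - b) ((i + 1) * d)).indicator (fun _ => e y) x := by
            refine lintegral_mono fun x => ?_
            by_cases hz : (x, y) ∈ A
            · rw [indicator_of_mem hz, indicator_of_mem]
              have h1 := (floor_div_eq_iff hd x i).1 hz.1.symm
              have h2 := (floor_div_eq_iff hd (x + b) (i + 1)).1 (hz.2.trans (by rw [← hz.1]))
              push_cast at h2
              exact ⟨by linarith [h2.1], h1.2⟩
            · rw [indicator_of_notMem hz]; exact zero_le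
        _ = ENNReal.ofReal b * e y := by
            rw [lintegral_indicator measurableSet_Ico, setLIntegral_const, Real.volume_Ico,
              sub_sub_cancel, mul_comm]
    calc lincr (lift d q) b
        ≤ ∫⁻ x, ENNReal.ofReal (1 / d) * ∫⁻ y, A.indicator (fun z => e z.2) (x, y) :=
          lintegral_mono point
      _ = ENNReal.ofReal (1 / d) * ∫⁻ y, ∫⁻ x, A.indicator (fun z => e z.2) (x, y) := by
          rw [lintegral_const_mul' _ _ ENNReal.ofReal_ne_top,
            lintegral_lintegral_swap (f := fun x y => A.indicator (fun z => e z.2) (x, y))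
              hm.aemeasurable]
      _ ≤ ENNReal.ofReal (1 / d) * ∫⁻ y, ENNReal.ofReal b * e y := by gcongr with y; exact slice y
      _ = ENNReal.ofReal (b / d) * ∫⁻ y, e y := by
          rw [lintegral_const_mul' _ _ ENNReal.ofReal_ne_top, ← mul_assoc,
            ← ENNReal.ofReal_mul (by positivity)]
          congr 2; ring
  -- A long shift is cut into `m` equal shifts that are shorter than a cell.
  obtain ⟨m, hm⟩ := exists_nat_gt (a / d)
  have hm0 : (0 : ℝ) < m := (div_pos ha hd).trans hm
  have h1 : a / m ≤ d := by
    rw [div_le_iff₀ hm0]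
    rw [div_lt_iff₀ hd] at hm
    linarith
  have h2 := lincr_nat_mul_le (lift_measurable d q) (a / m) m
  rw [mul_div_cancel₀ _ hm0.ne'] at h2
  calc lincr (lift d q) a ≤ m * (ENNReal.ofReal (a / m / d) * ∫⁻ y, e y) :=
        h2.trans (by gcongr; exact small _ (by positivity) h1)
    _ = ENNReal.ofReal (a / d) * ∫⁻ y, e y := by
        rw [← mul_assoc, ← ENNReal.ofReal_natCast m, ← ENNReal.ofReal_mul hm0.le]
        congr 2; field_simp

/-- The increment over one cell length is constant on cells, so each jump is the cell mean of these
increments. -/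
theorem lincr_lift_le_self {d : ℝ} (hd : 0 < d) (q : ℤ → ℝ) {a : ℝ} (ha : 0 < a) :
    lincr (lift d q) a ≤ ENNReal.ofReal (a / d) * lincr (lift d q) d := by
  have hm := lift_measurable d q
  refine lincr_lift_le hd (by fun_prop) (fun i => ?_) ha
  have : ∫⁻ y in Ico (i * d) ((i + 1) * d), ‖lift d q (y + d) - lift d q y‖ₑ
      = ∫⁻ y in Ico (i * d) ((i + 1) * d), ‖q (i + 1 + 1) - q (i + 1)‖ₑ := by
    refine setLIntegral_congr_fun measurableSet_Ico fun y hy => ?_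
    simp only [lift, floor_add_div hd, (floor_div_eq_iff hd y i).2 hy]
  rw [this, setLIntegral_const, Real.volume_Ico, mul_comm, mul_assoc,
    ← ENNReal.ofReal_mul (by linarith), show ((i + 1) * d - i * d) * (1 / d) = 1 by field_simp; ring]
  simp

theorem lintegral_lintegral_incr {u : ℝ → ℝ} (hu : Measurable u) (S : Set ℝ) :
    ∫⁻ x, ∫⁻ z in S, ‖u (x + z) - u x‖ₑ = ∫⁻ z in S, lincr u z :=
  lintegral_lintegral_swap (f := fun x z => ‖u (x + z) - u x‖ₑ)
    (by fun_prop : Measurable fun p : ℝ × ℝ => ‖u (p.1 + p.2) - u p.1‖ₑ).aemeasurable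

/-! ### Duality -/

/-- The function `e` is approximated in `L¹` by a continuous `w` with compact support, and `w / (|w|
+ η)` serves as a continuous substitute for the sign of `e`. -/
theorem integral_abs_le_of_dual {e : ℝ → ℝ} (he : Integrable e) {C : ℝ}
    (h : ∀ ψ : ℝ → ℝ, Continuous ψ → HasCompactSupport ψ → (∀ x, |ψ x| ≤ 1) →
      ∫ x, e x * ψ x ≤ C) : ∫ x, |e x| ≤ C := by
  refine le_of_forall_pos_le_add fun ε hε => ?_
  obtain ⟨w, hw, hwe, hwc, hwi⟩ :=
    he.exists_hasCompactSupport_integral_sub_le (show 0 < ε / 4 by positivity)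
  set K := tsupport w
  have hK : IsCompact K := hw
  -- The loss `|w| - w ψ` is at most `η` and lives on `K`, so it costs `ε / 2`; the approximation
  -- error occurs twice and costs the other half.
  set η := ε / (2 * (volume.real K + 1)) with hη
  have hv : 0 ≤ volume.real K := measureReal_nonneg
  have hη0 : 0 < η := by positivity
  have hpos : ∀ x, 0 < |w x| + η := fun x => by positivity
  set ψ : ℝ → ℝ := fun x => w x / (|w x| + η)
  have hψc : Continuous ψ := hwc.div (hwc.abs.add continuous_const) fun x => (hpos x).ne'
  have hψ1 : ∀ x, |ψ x| ≤ 1 := fun x => by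
    rw [abs_div, abs_of_pos (hpos x), div_le_one (hpos x)]; linarith
  have hψK : HasCompactSupport ψ := hw.mono fun x hx => by
    contrapose! hx
    simp only [Function.mem_support, not_not] at hx ⊢
    simp [ψ, hx]
  have i1 : Integrable fun x => e x * ψ x :=
    he.mul_bdd (c := 1) hψc.aestronglyMeasurable (ae_of_all _ hψ1)
  have i2 : Integrable fun x => 2 * |e x - w x| := (he.sub hwi).abs.const_mul 2
  have i3 : Integrable (K.indicator fun _ => η) :=
    (integrable_indicator_iff hK.measurableSet).2 (integrableOn_const hK.measure_lt_top.ne)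
  have key : ∫ x, |e x| ≤ ∫ x, (e x * ψ x + 2 * |e x - w x| + K.indicator (fun _ => η) x) := by
    refine integral_mono he.abs ((i1.add i2).add i3) fun x => ?_
    have hwψ : |w x| - w x * ψ x ≤ K.indicator (fun _ => η) x := by
      by_cases hx : x ∈ K
      · rw [indicator_of_mem hx]
        have : |w x| - w x * ψ x = |w x| * η / (|w x| + η) := by
          have h3 : w x * w x = |w x| * |w x| := (abs_mul_abs_self _).symm
          simp only [ψ]
          rw [mul_div_assoc', h3, sub_eq_iff_eq_add, ← add_div, ← mul_add,
            eq_div_iff (hpos x).ne', add_comm η]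
        rw [this, div_le_iff₀ (hpos x)]
        nlinarith [abs_nonneg (w x)]
      · rw [indicator_of_notMem hx]
        simp [image_eq_zero_of_notMem_tsupport hx]
    have h2 : (w x - e x) * ψ x ≤ |e x - w x| := by
      refine (le_abs_self _).trans ?_
      rw [abs_mul, abs_sub_comm]
      exact mul_le_of_le_one_right (abs_nonneg _) (hψ1 x)
    have h3 : |e x| ≤ |w x| + |e x - w x| := by
      have := abs_add_le (w x) (e x - w x); rwa [add_sub_cancel] at this
    simp only
    linarith
  refine key.trans ?_
  rw [integral_add_three i1 i2 i3, integral_const_mul, integral_indicator hK.measurableSet,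
    setIntegral_const, smul_eq_mul]
  have h4 := h ψ hψc hψK hψ1
  have h5 : volume.real K * η ≤ ε / 2 := by
    rw [hη, mul_div_assoc', div_le_iff₀ (by positivity)]
    nlinarith
  have h6 : ∫ x, |e x - w x| ≤ ε / 4 := hwe
  linarith

theorem integral_mul_deriv_le {u φ : ℝ → ℝ} (htv : totalVar u ≠ ∞) (h1 : ContDiff ℝ 1 φ)
    (h2 : HasCompactSupport φ) (h3 : ∀ x, |φ x| ≤ 1) :
    ∫ x, u x * deriv φ x ≤ (totalVar u).toReal := by
  have : ENNReal.ofReal (∫ x, u x * deriv φ x) ≤ totalVar u :=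
    le_iSup₂_of_le φ ⟨h1, h2, h3⟩ le_rfl
  exact (ENNReal.ofReal_le_iff_le_toReal htv).1 this

/-- By duality the increments are tested against a continuous `ψ` with `|ψ| ≤ 1`. The mean of `-ψ`
over `[x - a, x]` is an admissible test function for the variation, and its derivative is a
difference quotient of `ψ`; translating it onto `u` gives the increment. -/
theorem incr_le_totalVar {u : ℝ → ℝ} (hu : Integrable u) (htv : totalVar u ≠ ∞) {a : ℝ}
    (ha : 0 < a) : incr u a ≤ (totalVar u).toReal * a := by
  refine integral_abs_le_of_dual (hu.incr a) fun ψ hc hK h1 => ?_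
  have hii : ∀ x y, IntervalIntegrable ψ volume x y := fun x y => hc.intervalIntegrable x y
  set Ψ : ℝ → ℝ := fun x => -(1 / a) * ((∫ y in (0 : ℝ)..x, ψ y) - ∫ y in (0 : ℝ)..(x - a), ψ y)
    with hΨ
  have hΨ' : ∀ x, Ψ x = -(1 / a) * ∫ y in (x - a)..x, ψ y := fun x => by
    rw [hΨ]; simp only; rw [intervalIntegral.integral_interval_sub_left (hii _ _) (hii _ _)]
  have hd : ∀ x, HasDerivAt Ψ (-(1 / a) * (ψ x - ψ (x - a))) x := fun x => by
    refine ((hc.integral_hasStrictDerivAt 0 x).hasDerivAt.sub ?_).const_mul _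
    exact (hc.integral_hasStrictDerivAt 0 (x - a)).hasDerivAt.comp_sub_const x a
  have hder : deriv Ψ = fun x => -(1 / a) * (ψ x - ψ (x - a)) := funext fun x => (hd x).deriv
  have hC1 : ContDiff ℝ 1 Ψ := by
    rw [contDiff_one_iff_deriv]
    refine ⟨fun x => (hd x).differentiableAt, ?_⟩
    rw [hder]; fun_prop
  have hb : ∀ x, |Ψ x| ≤ 1 := fun x => by
    rw [hΨ', abs_mul, abs_neg, abs_of_pos (by positivity : 0 < 1 / a)]
    have := intervalIntegral.norm_integral_le_of_norm_le_const (a := x - a) (b := x) (C := 1)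
      (f := ψ) fun y _ => h1 y
    rw [sub_sub_cancel, abs_of_pos ha, one_mul, Real.norm_eq_abs] at this
    calc 1 / a * |∫ y in (x - a)..x, ψ y| ≤ 1 / a * a := by gcongr
      _ = 1 := by field_simp
  have hcs : HasCompactSupport Ψ := by
    obtain ⟨B, hB⟩ := hK.isCompact.isBounded.subset_closedBall 0
    refine HasCompactSupport.intro (isCompact_Icc (a := -B) (b := B + a)) fun x hx => ?_
    rw [hΨ', intervalIntegral.integral_congr (g := fun _ => 0) fun y hy => ?_]
    · simp
    · by_contra hne
      have h5 := hB (subset_tsupport _ hne)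
      rw [mem_closedBall_zero_iff, Real.norm_eq_abs, abs_le] at h5
      rw [uIcc_of_le (by linarith)] at hy
      exact hx ⟨by linarith [hy.2], by linarith [hy.1]⟩
  have h := integral_mul_deriv_le htv hC1 hcs hb
  have bd : ∀ {f g : ℝ → ℝ}, Integrable f → Continuous g → (∀ x, |g x| ≤ 1) →
      Integrable fun x => f x * g x :=
    fun hf hg hb => hf.mul_bdd (c := 1) hg.aestronglyMeasurable (ae_of_all _ hb)
  have i1 := bd hu hc h1
  have i2 : Integrable fun x => u x * ψ (x - a) := bd hu (by fun_prop) fun x => h1 _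
  have i3 := bd (hu.comp_add_right a) hc h1
  have e1 : ∫ x, u x * ψ (x - a) = ∫ x, u (x + a) * ψ x := by
    rw [← integral_add_right_eq_self (fun x => u x * ψ (x - a)) a]
    simp
  have e2 : ∫ x, u x * deriv Ψ x = 1 / a * ∫ x, (u (x + a) - u x) * ψ x := by
    have r1 : ∀ x, u x * deriv Ψ x = 1 / a * (u x * ψ (x - a) - u x * ψ x) := fun x => by
      rw [hder]; ring
    simp only [r1, sub_mul]
    rw [integral_const_mul, integral_sub i2 i1, integral_sub i3 i1, e1]
  rw [e2, one_div_mul_eq_div, div_le_iff₀ ha] at h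
  exact h

/-- The derivative of a test function is the limit of its backward difference quotients, dominated
through the Lipschitz constant. Each quotient transfers by translation to an increment of `u`. -/
theorem totalVar_le_of_incr_le {u : ℝ → ℝ} (hu : Integrable u) {C : ℝ}
    (hC : ∀ a, 0 < a → incr u a ≤ C * a) : totalVar u ≤ ENNReal.ofReal C := by
  refine iSup₂_le fun φ ⟨h1, h2, h3⟩ => ENNReal.ofReal_le_ofReal ?_
  have hdiff : Differentiable ℝ φ := h1.differentiable (by norm_num)
  obtain ⟨K, hK⟩ := h1.lipschitzWith_of_hasCompactSupport h2 (by norm_num)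
  set a : ℕ → ℝ := fun n => 1 / ((n : ℝ) + 1) with ha_def
  have ha : ∀ n, 0 < a n := fun n => Nat.one_div_pos_of_nat
  have ha0 : Tendsto a atTop (𝓝 0) := tendsto_one_div_add_atTop_nhds_zero_nat
  have lim : Tendsto (fun n => ∫ x, u x * ((φ x - φ (x - a n)) / a n)) atTop
      (𝓝 (∫ x, u x * deriv φ x)) := by
    refine tendsto_integral_of_dominated_convergence (fun x => |u x| * K) (fun n => ?_)
      (hu.abs.mul_const _) (fun n => ae_of_all _ fun x => ?_) (ae_of_all _ fun x => ?_)
    · have := h1.continuous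
      exact hu.aestronglyMeasurable.mul
        (by fun_prop : Continuous fun x => (φ x - φ (x - a n)) / a n).aestronglyMeasurable
    · rw [Real.norm_eq_abs, abs_mul, abs_div, abs_of_pos (ha n)]
      gcongr
      rw [div_le_iff₀ (ha n)]
      have := hK.dist_le_mul x (x - a n)
      rw [Real.dist_eq, Real.dist_eq, sub_sub_cancel, abs_of_pos (ha n)] at this
      exact this
    · refine Tendsto.const_mul _ ?_
      have hs := (hdiff x).hasDerivAt.tendsto_slope_zero
      have hm : Tendsto (fun n => -a n) atTop (𝓝[≠] 0) :=
        tendsto_nhdsWithin_iff.2 ⟨by simpa using ha0.neg,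
          Eventually.of_forall fun n => neg_ne_zero.2 (ha n).ne'⟩
      refine (hs.comp hm).congr fun n => ?_
      simp only [Function.comp_apply, smul_eq_mul]
      have := (ha n).ne'
      rw [← sub_eq_add_neg]
      field_simp
      ring
  refine le_of_tendsto' lim fun n => ?_
  have bd : ∀ {f : ℝ → ℝ} (b : ℝ), Integrable f → Integrable fun x => f x * φ (x - b) :=
    fun b hf => hf.mul_bdd (c := 1) (by have := h1.continuous; fun_prop) (ae_of_all _ fun x => h3 _)
  have i1 : Integrable fun x => u x * φ x := by simpa using bd 0 hu
  have i2 := bd (a n) hu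
  have i3 : Integrable fun x => u (x + a n) * φ x := by simpa using bd 0 (hu.comp_add_right (a n))
  have e1 : ∫ x, u x * φ (x - a n) = ∫ x, u (x + a n) * φ x := by
    rw [← integral_add_right_eq_self (fun x => u x * φ (x - a n)) (a n)]
    simp
  have e2 : ∫ x, u x * ((φ x - φ (x - a n)) / a n)
      = 1 / a n * ∫ x, -((u (x + a n) - u x) * φ x) := by
    have r1 : ∀ x, u x * ((φ x - φ (x - a n)) / a n)
      = 1 / a n * (u x * φ x - u x * φ (x - a n)) := fun x => by ring
    have r2 : ∀ x, -((u (x + a n) - u x) * φ x) = u x * φ x - u (x + a n) * φ x := fun x => by ring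
    simp only [r1, r2]
    rw [integral_const_mul, integral_sub i1 i2, integral_sub i1 i3, e1]
  rw [e2, one_div_mul_eq_div, div_le_iff₀ (ha n)]
  refine (integral_mono ?_ (hu.incr (a n)).abs fun x => ?_).trans (hC _ (ha n))
  · simpa using (bd 0 (hu.incr (a n))).neg
  · refine (neg_le_abs _).trans ?_
    rw [abs_mul]
    exact mul_le_of_le_one_right (abs_nonneg _) (h3 x)

/-! ### Cell averages of the datum -/

section CellMean

variable {P : Model} {N : ℕ} {ρ₀ : ℝ → ℝ}

theorem cellMean_mem (hP : P.Admissible) (hN : 0 < N) (h : IsDensity P.R ρ₀) (j : ℤ) :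
    P.cellMean N ρ₀ j ∈ Icc 0 P.R := by
  have hd := hP.dx_pos hN
  have hle : (j - 1) * P.dx N ≤ j * P.dx N := by nlinarith
  have h1 := intervalIntegral.integral_mono_on (μ := volume) hle
    (intervalIntegrable_const (c := (0 : ℝ))) h.integrable.intervalIntegrable
    fun x _ => (h.mem x).1
  have h2 := intervalIntegral.integral_mono_on (μ := volume) hle h.integrable.intervalIntegrable
    (intervalIntegrable_const (c := P.R)) fun x _ => (h.mem x).2
  simp only [intervalIntegral.integral_const, smul_eq_mul] at h1 h2
  rw [show j * P.dx N - (j - 1) * P.dx N = P.dx N by ring] at h1 h2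
  unfold Model.cellMean
  rw [one_div_mul_eq_div]
  exact ⟨(le_div_iff₀ hd).2 (by linarith), (div_le_iff₀ hd).2 (by linarith)⟩

theorem lincr_le_totalVar (h : IsDensity P.R ρ₀) (htv : totalVar ρ₀ ≠ ∞) (z : ℝ) :
    lincr ρ₀ z ≤ ENNReal.ofReal ((totalVar ρ₀).toReal * |z|) := by
  have pos : ∀ z, 0 < z → lincr ρ₀ z ≤ ENNReal.ofReal ((totalVar ρ₀).toReal * |z|) := by
    intro z hz
    rw [lincr_eq_ofReal_incr (h.integrable.incr z), abs_of_pos hz]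
    exact ENNReal.ofReal_le_ofReal (incr_le_totalVar h.integrable htv hz)
  rcases lt_trichotomy z 0 with hz | rfl | hz
  · rw [← lincr_neg, ← abs_neg]; exact pos _ (neg_pos.2 hz)
  · simp [lincr]
  · exact pos z hz

/-- The difference of two consecutive cell means is the mean over one cell of the increment of `ρ₀`
by one cell length, so averaging does not increase the variation. -/
theorem lincr_cellMean_le (hP : P.Admissible) (hN : 0 < N) (h : IsDensity P.R ρ₀)
    (htv : totalVar ρ₀ ≠ ∞) {a : ℝ} (ha : 0 < a) :
    lincr (lift (P.dx N) (P.cellMean N ρ₀)) a ≤ ENNReal.ofReal ((totalVar ρ₀).toReal * a) := by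
  have hd := hP.dx_pos hN
  set d := P.dx N with hd_def
  have hm := h.measurable
  have h1 := lincr_lift_le hd (q := P.cellMean N ρ₀) (e := fun y => ‖ρ₀ (y + d) - ρ₀ y‖ₑ)
    (by fun_prop) (fun i => ?_) ha
  · refine h1.trans ((mul_le_mul_right (lincr_le_totalVar h htv d) _).trans (le_of_eq ?_))
    rw [← ENNReal.ofReal_mul (by positivity), abs_of_pos hd]
    congr 1; field_simp
  · have hi : ∀ x y, IntervalIntegrable ρ₀ volume x y :=
      fun x y => h.integrable.intervalIntegrable
    have e : P.cellMean N ρ₀ (i + 1 + 1) - P.cellMean N ρ₀ (i + 1)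
        = 1 / d * ∫ y in (i * d)..((i + 1) * d), (ρ₀ (y + d) - ρ₀ y) := by
      rw [intervalIntegral.integral_sub (h.comp_add d).integrable.intervalIntegrable (hi _ _),
        intervalIntegral.integral_comp_add_right (fun y => ρ₀ y), mul_sub]
      unfold Model.cellMean
      push_cast
      rw [← hd_def]
      congr 3 <;> ring_nf
    have hle : (i : ℝ) * d ≤ (i + 1) * d := by nlinarith
    rw [e, enorm_mul, Real.enorm_eq_ofReal (by positivity),
      intervalIntegral.integral_of_le hle, integral_Ioc_eq_integral_Ioo,
      ← integral_Ico_eq_integral_Ioo]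
    gcongr
    exact enorm_integral_le_lintegral_enorm _

/-- The cell containing `x` lies in `[x - d, x + d]`, so the error is bounded by `1 / d` times the
integral of the increments of steps in `[-d, d]`. The length `2d` of that interval is the source of
the factor `2`. -/
theorem lintegral_cellMean_sub_le (hP : P.Admissible) (hN : 0 < N) (h : IsDensity P.R ρ₀)
    (htv : totalVar ρ₀ ≠ ∞) :
    ∫⁻ x, ‖lift (P.dx N) (P.cellMean N ρ₀) x - ρ₀ x‖ₑ
      ≤ ENNReal.ofReal (2 * (totalVar ρ₀).toReal * P.dx N) := by
  have hd := hP.dx_pos hN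
  set d := P.dx N with hd_def
  have hm := h.measurable
  have point : ∀ x, ‖lift d (P.cellMean N ρ₀) x - ρ₀ x‖ₑ
      ≤ ENNReal.ofReal (1 / d) * ∫⁻ z in Icc (-d) d, ‖ρ₀ (x + z) - ρ₀ x‖ₑ := by
    intro x
    set i := ⌊x / d⌋ with hi
    have hx := (floor_div_eq_iff hd x i).1 rfl
    have hle : (i : ℝ) * d ≤ (i + 1) * d := by nlinarith
    have e : lift d (P.cellMean N ρ₀) x - ρ₀ x
        = 1 / d * ∫ y in (i * d)..((i + 1) * d), (ρ₀ y - ρ₀ x) := by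
      rw [intervalIntegral.integral_sub h.integrable.intervalIntegrable intervalIntegrable_const,
        intervalIntegral.integral_const, smul_eq_mul, mul_sub,
        show ((i : ℝ) + 1) * d - i * d = d by ring, ← mul_assoc (1 / d), one_div_mul_cancel hd.ne',
        one_mul]
      unfold lift Model.cellMean
      push_cast
      rw [← hd_def, ← hi]
      congr 3; ring_nf
    rw [e, enorm_mul, Real.enorm_eq_ofReal (by positivity), intervalIntegral.integral_of_le hle]
    gcongr
    refine (enorm_integral_le_lintegral_enorm _).trans ?_
    rw [← lintegral_indicator measurableSet_Ioc, ← lintegral_indicator measurableSet_Icc,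
      ← lintegral_add_left_eq_self _ x]
    refine lintegral_mono fun z => ?_
    by_cases hz : x + z ∈ Ioc (i * d) ((i + 1) * d)
    · rw [indicator_of_mem hz, indicator_of_mem]
      exact ⟨by linarith [hz.1, hx.2], by linarith [hz.2, hx.1]⟩
    · rw [indicator_of_notMem hz]; exact zero_le
  calc ∫⁻ x, ‖lift d (P.cellMean N ρ₀) x - ρ₀ x‖ₑ
      ≤ ∫⁻ x, ENNReal.ofReal (1 / d) * ∫⁻ z in Icc (-d) d, ‖ρ₀ (x + z) - ρ₀ x‖ₑ :=
        lintegral_mono point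
    _ = ENNReal.ofReal (1 / d) * ∫⁻ z in Icc (-d) d, lincr ρ₀ z := by
        rw [lintegral_const_mul' _ _ ENNReal.ofReal_ne_top, lintegral_lintegral_incr hm]
    _ ≤ ENNReal.ofReal (1 / d) *
          ∫⁻ _ in Icc (-d) d, ENNReal.ofReal ((totalVar ρ₀).toReal * d) := by
        refine mul_le_mul_right ?_ _
        refine setLIntegral_mono measurable_const fun z hz =>
          (lincr_le_totalVar h htv z).trans (ENNReal.ofReal_le_ofReal ?_)
        exact mul_le_mul_of_nonneg_left (abs_le.2 hz) ENNReal.toReal_nonneg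
    _ = _ := by
        rw [setLIntegral_const, Real.volume_Icc, ← ENNReal.ofReal_mul (by positivity),
          ← ENNReal.ofReal_mul (by positivity)]
        congr 1; field_simp; ring

theorem cellMean_isDensity (hP : P.Admissible) (hN : 0 < N) (h : IsDensity P.R ρ₀)
    (htv : totalVar ρ₀ ≠ ∞) : IsDensity P.R (lift (P.dx N) (P.cellMean N ρ₀)) where
  measurable := lift_measurable _ _
  integrable := by
    have hs : Integrable fun x => lift (P.dx N) (P.cellMean N ρ₀) x - ρ₀ x :=
      ⟨((lift_measurable _ _).sub h.measurable).aestronglyMeasurable,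
        (lintegral_cellMean_sub_le hP hN h htv).trans_lt ENNReal.ofReal_lt_top⟩
    exact (hs.add h.integrable).congr (ae_of_all _ fun x => by simp)
  mem x := cellMean_mem hP hN h _

theorem incr_cellMean_le (hP : P.Admissible) (hN : 0 < N) (h : IsDensity P.R ρ₀)
    (htv : totalVar ρ₀ ≠ ∞) :
    incr (lift (P.dx N) (P.cellMean N ρ₀)) (P.dx N) ≤ (totalVar ρ₀).toReal * P.dx N := by
  have h1 := lincr_cellMean_le hP hN h htv (hP.dx_pos hN)
  rw [lincr_eq_ofReal_incr ((cellMean_isDensity hP hN h htv).integrable.incr _)] at h1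
  exact (ENNReal.ofReal_le_ofReal_iff
    (mul_nonneg ENNReal.toReal_nonneg (hP.dx_pos hN).le)).1 h1

end CellMean

end DelayTraffic

/-! ### Local convergence in the mean and compactness through primitives. -/

namespace DelayTraffic

/-! ### Convergence in `L¹_loc(ℝ)` -/

/-- Convergence in `L¹_loc(ℝ)`. -/
def L1Loc (u : ℕ → ℝ → ℝ) (v : ℝ → ℝ) : Prop :=
  ∀ X : ℝ, Tendsto (fun k => ∫⁻ x in Icc (-X) X, ‖u k x - v x‖ₑ) atTop (𝓝 0)

theorem lintegral_enorm_sub_le (μ : Measure ℝ) {f g h : ℝ → ℝ} (hf : Measurable f)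
    (hg : Measurable g) :
    ∫⁻ x, ‖f x - h x‖ₑ ∂μ ≤ ∫⁻ x, ‖f x - g x‖ₑ ∂μ + ∫⁻ x, ‖g x - h x‖ₑ ∂μ := by
  rw [← lintegral_add_left (by fun_prop)]
  refine lintegral_mono fun x => ?_
  have : f x - h x = (f x - g x) + (g x - h x) := by ring
  simp only [this]
  exact enorm_add_le _ _

theorem lintegral_enorm_sub_comm (μ : Measure ℝ) (f g : ℝ → ℝ) :
    ∫⁻ x, ‖f x - g x‖ₑ ∂μ = ∫⁻ x, ‖g x - f x‖ₑ ∂μ :=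
  lintegral_congr fun x => by rw [← enorm_neg, neg_sub]

namespace L1Loc

variable {u w : ℕ → ℝ → ℝ} {v z : ℝ → ℝ}

theorem of_close (h : L1Loc u v) (hu : ∀ k, Measurable (u k)) (hw : ∀ k, Measurable (w k))
    (hd : Tendsto (fun k => ∫⁻ x, ‖w k x - u k x‖ₑ) atTop (𝓝 0)) : L1Loc w v := by
  intro X
  have := hd.add (h X)
  rw [add_zero] at this
  refine tendsto_of_tendsto_of_tendsto_of_le_of_le tendsto_const_nhds this (fun _ => zero_le)
    fun k => (lintegral_enorm_sub_le _ (hw k) (hu k)).trans ?_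
  gcongr
  exact Measure.restrict_le_self

theorem of_tendsto (hd : Tendsto (fun k => ∫⁻ x, ‖u k x - v x‖ₑ) atTop (𝓝 0)) : L1Loc u v :=
  fun _ => tendsto_of_tendsto_of_tendsto_of_le_of_le tendsto_const_nhds hd (fun _ => zero_le)
    fun _ => setLIntegral_le_lintegral _ _

theorem sub (h : L1Loc u v) (h' : L1Loc w z) (hu : ∀ k, Measurable (u k)) (hv : Measurable v) :
    L1Loc (fun k x => u k x - w k x) fun x => v x - z x := by
  intro X
  have := (h X).add (h' X)
  rw [add_zero] at this
  refine tendsto_of_tendsto_of_tendsto_of_le_of_le tendsto_const_nhds this (fun _ => zero_le)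
    fun k => ?_
  have := hu k
  simp only
  rw [← lintegral_add_left (by fun_prop)]
  refine lintegral_mono fun x => ?_
  have : u k x - w k x - (v x - z x) = (u k x - v x) + -(w k x - z x) := by ring
  simp only [this]
  exact (enorm_add_le _ _).trans (by rw [enorm_neg])

theorem comp_add (h : L1Loc u v) (a : ℝ) :
    L1Loc (fun k x => u k (x + a)) fun x => v (x + a) := by
  intro X
  refine tendsto_of_tendsto_of_tendsto_of_le_of_le tendsto_const_nhds (h (|X| + |a|))
    (fun _ => zero_le) fun k => ?_
  simp only
  rw [← lintegral_indicator measurableSet_Icc, ← lintegral_indicator measurableSet_Icc,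
    ← lintegral_add_right_eq_self
      ((Icc (-(|X| + |a|)) (|X| + |a|)).indicator fun x => ‖u k x - v x‖ₑ) a]
  refine lintegral_mono fun x => ?_
  by_cases hx : x ∈ Icc (-X) X
  · rw [indicator_of_mem hx, indicator_of_mem]
    exact ⟨by linarith [hx.1, le_abs_self X, neg_abs_le a],
      by linarith [hx.2, le_abs_self X, le_abs_self a]⟩
  · rw [indicator_of_notMem hx]; exact zero_le

/-- Lower semicontinuity: the bound holds on each `[-n, n]` by convergence there, and monotone
exhaustion of the line keeps it. -/
theorem lintegral_le (h : L1Loc u v) (hu : ∀ k, Measurable (u k)) (hv : Measurable v)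
    {c : ℕ → ℝ≥0∞} {C : ℝ≥0∞} (hc : ∀ k, ∫⁻ x, ‖u k x‖ₑ ≤ c k) (hC : Tendsto c atTop (𝓝 C)) :
    ∫⁻ x, ‖v x‖ₑ ≤ C := by
  have hcov : AECover (volume : Measure ℝ) atTop fun n : ℕ => Icc (-(n : ℝ)) n :=
    aecover_Icc (tendsto_neg_atTop_atBot.comp tendsto_natCast_atTop_atTop)
      tendsto_natCast_atTop_atTop
  refine le_of_tendsto' (hcov.lintegral_tendsto_of_countably_generated
    (f := fun x => ‖v x‖ₑ) (by fun_prop)) fun n => ?_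
  have := (h n).add hC
  rw [zero_add] at this
  refine ge_of_tendsto' this fun k => ?_
  have huk := hu k
  calc ∫⁻ x in Icc (-(n : ℝ)) n, ‖v x‖ₑ
      ≤ ∫⁻ x in Icc (-(n : ℝ)) n, (‖u k x - v x‖ₑ + ‖u k x‖ₑ) := by
        refine lintegral_mono fun x => ?_
        have : v x = -(u k x - v x) + u k x := by ring
        calc ‖v x‖ₑ = ‖-(u k x - v x) + u k x‖ₑ := by rw [← this]
          _ ≤ _ := (enorm_add_le _ _).trans (by rw [enorm_neg])
    _ ≤ _ := by
        rw [lintegral_add_left (by fun_prop)]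
        exact add_le_add_right ((setLIntegral_le_lintegral _ _).trans (hc k)) _

theorem lincr_le (h : L1Loc u v) (hu : ∀ k, Measurable (u k)) (hv : Measurable v) {a : ℝ}
    {C : ℝ≥0∞} (hC : ∀ k, lincr (u k) a ≤ C) : lincr v a ≤ C :=
  ((h.comp_add a).sub h (fun k => by have := hu k; fun_prop) (by fun_prop)).lintegral_le
    (fun k => by have := hu k; fun_prop) (by fun_prop) hC tendsto_const_nhds

end L1Loc

/-! ### Compactness -/

theorem intervalIntegrable_of_bound {u : ℝ → ℝ} (hu : Measurable u) {B : ℝ}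
    (hB : ∀ x, |u x| ≤ B) (a b : ℝ) : IntervalIntegrable u volume a b :=
  (intervalIntegrable_const (c := B)).mono_fun hu.aestronglyMeasurable
    (ae_of_all _ fun x => by
      simpa only [Real.norm_eq_abs] using (hB x).trans (le_abs_self B))

theorem abs_primitive_sub_le {u : ℝ → ℝ} (hu : Measurable u) {B : ℝ}
    (hB : ∀ x, |u x| ≤ B) (x y : ℝ) :
    |(∫ s in (0 : ℝ)..x, u s) - ∫ s in (0 : ℝ)..y, u s| ≤ B * |x - y| := by
  have hi := intervalIntegrable_of_bound hu hB
  rw [intervalIntegral.integral_interval_sub_left (hi _ _) (hi _ _)]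
  exact intervalIntegral.norm_integral_le_of_norm_le_const (f := u) (C := B) fun s _ => hB s

/-- The difference quotient of the primitive is the mean of `u` over `[x, x + a]`, so the error is a
mean of increments of steps at most `a`. -/
theorem lintegral_sub_mean_le {u : ℝ → ℝ} (hu : Measurable u) {B C : ℝ} (hB : ∀ x, |u x| ≤ B)
    (hC0 : 0 ≤ C) (hC : ∀ a, 0 < a → lincr u a ≤ ENNReal.ofReal (C * a)) {a : ℝ} (ha : 0 < a) :
    ∫⁻ x, ‖u x - ((∫ s in (0 : ℝ)..(x + a), u s) - ∫ s in (0 : ℝ)..x, u s) / a‖ₑ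
      ≤ ENNReal.ofReal (C * a) := by
  have hi := intervalIntegrable_of_bound hu hB
  have point : ∀ x, ‖u x - ((∫ s in (0 : ℝ)..(x + a), u s) - ∫ s in (0 : ℝ)..x, u s) / a‖ₑ
      ≤ ENNReal.ofReal (1 / a) * ∫⁻ z in Ioc 0 a, ‖u (x + z) - u x‖ₑ := by
    intro x
    have h1 : ∫ s in x..(x + a), u s = ∫ z in (0 : ℝ)..a, u (x + z) := by
      rw [intervalIntegral.integral_comp_add_left (fun y => u y), add_zero]
    have h2 : u x - ((∫ s in (0 : ℝ)..(x + a), u s) - ∫ s in (0 : ℝ)..x, u s) / a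
        = -(1 / a * ∫ z in (0 : ℝ)..a, (u (x + z) - u x)) := by
      have i1 : IntervalIntegrable (fun z => u (x + z)) volume 0 a :=
        intervalIntegrable_of_bound (hu.comp (measurable_const_add x)) (fun z => hB _) _ _
      rw [intervalIntegral.integral_interval_sub_left (hi _ _) (hi _ _), h1,
        intervalIntegral.integral_sub i1 intervalIntegrable_const,
        intervalIntegral.integral_const, smul_eq_mul]
      field_simp
      ring
    rw [h2, enorm_neg, enorm_mul, Real.enorm_eq_ofReal (by positivity),
      intervalIntegral.integral_of_le ha.le]
    gcongr
    exact enorm_integral_le_lintegral_enorm _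
  refine (lintegral_mono point).trans ?_
  rw [lintegral_const_mul' _ _ ENNReal.ofReal_ne_top, lintegral_lintegral_incr hu]
  calc ENNReal.ofReal (1 / a) * ∫⁻ z in Ioc 0 a, lincr u z
      ≤ ENNReal.ofReal (1 / a) * ∫⁻ _ in Ioc 0 a, ENNReal.ofReal (C * a) := by
        refine mul_le_mul_right (setLIntegral_mono measurable_const fun z hz =>
          (hC z hz.1).trans (ENNReal.ofReal_le_ofReal ?_)) _
        exact mul_le_mul_of_nonneg_left hz.2 hC0
    _ = ENNReal.ofReal (C * a) := by
        rw [setLIntegral_const, Real.volume_Ioc, sub_zero, ← ENNReal.ofReal_mul (by positivity),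
          ← ENNReal.ofReal_mul (by positivity)]
        congr 1; field_simp

/-- A bounded sequence with uniformly bounded variation whose primitives converge pointwise
converges in `L¹_loc` to the derivative of the limit. -/
theorem L1Loc.of_primitives {u : ℕ → ℝ → ℝ} (hu : ∀ k, Measurable (u k)) {B C : ℝ}
    (hB : ∀ k x, |u k x| ≤ B) (hC0 : 0 ≤ C)
    (hC : ∀ k a, 0 < a → lincr (u k) a ≤ ENNReal.ofReal (C * a)) {U : ℝ → ℝ}
    (hU : ∀ x, Tendsto (fun k => ∫ s in (0 : ℝ)..x, u k s) atTop (𝓝 (U x))) :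
    L1Loc u (deriv U) := by
  have hB0 : 0 ≤ B := (abs_nonneg _).trans (hB 0 0)
  have hUlip : ∀ x y, |U x - U y| ≤ B * |x - y| := fun x y =>
    le_of_tendsto' ((hU x).sub (hU y)).abs fun k => abs_primitive_sub_le (hu k) (hB k) x y
  have lipc : ∀ {f : ℝ → ℝ}, (∀ x y, |f x - f y| ≤ B * |x - y|) → LipschitzWith ⟨B, hB0⟩ f :=
    fun h => LipschitzWith.of_dist_le_mul fun x y => by
      rw [Real.dist_eq, Real.dist_eq]; exact h x y
  have hUc : Continuous U := (lipc hUlip).continuous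
  have hPc : ∀ k, Continuous fun x => ∫ s in (0 : ℝ)..x, u k s :=
    fun k => (lipc (abs_primitive_sub_le (hu k) (hB k))).continuous
  have hdiff : ∀ᵐ x, DifferentiableAt ℝ U x := (lipc hUlip).ae_differentiableAt_real
  -- The functions `u k` are compared with the quotients `A k a`, uniformly in `k` by the variation
  -- bound. For fixed `a` these tend to the quotients `W a` of the limit primitive, and `W a` tends
  -- to `deriv U` almost everywhere as `a → 0`, `U` being Lipschitz.
  set A : ℕ → ℝ → ℝ → ℝ := fun k a x =>
    ((∫ s in (0 : ℝ)..(x + a), u k s) - ∫ s in (0 : ℝ)..x, u k s) / a with hA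
  set W : ℝ → ℝ → ℝ := fun a x => (U (x + a) - U x) / a with hW
  have hAm : ∀ k a, Measurable (A k a) := fun k a => by
    have := hPc k
    exact (by fun_prop : Continuous (A k a)).measurable
  have hWm : ∀ a, Measurable (W a) := fun a => (by fun_prop : Continuous (W a)).measurable
  have quot : ∀ {f : ℝ → ℝ}, (∀ x y, |f x - f y| ≤ B * |x - y|) → ∀ a, 0 < a → ∀ x,
      |(f (x + a) - f x) / a| ≤ B := fun h a ha x => by
    rw [abs_div, abs_of_pos ha, div_le_iff₀ ha]
    simpa [abs_of_pos ha] using h (x + a) x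
  have bound2 : ∀ {p q : ℝ}, |p| ≤ B → |q| ≤ B → ‖p - q‖ₑ ≤ ENNReal.ofReal (B + B) := by
    intro p q hp hq
    rw [Real.enorm_eq_ofReal_abs]
    exact ENNReal.ofReal_le_ofReal ((abs_sub p q).trans (add_le_add hp hq))
  have hfin : ∀ X : ℝ, ∫⁻ _ in Icc (-X) X, ENNReal.ofReal (B + B) ≠ ∞ := fun X => by
    rw [setLIntegral_const]
    exact ENNReal.mul_ne_top ENNReal.ofReal_ne_top measure_Icc_lt_top.ne
  intro X
  set μ := (volume : Measure ℝ).restrict (Icc (-X) X)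
  have step1 : ∀ k a, 0 < a → ∫⁻ x, ‖u k x - A k a x‖ₑ ∂μ ≤ ENNReal.ofReal (C * a) :=
    fun k a ha => (setLIntegral_le_lintegral _ _).trans
      (lintegral_sub_mean_le (hu k) (hB k) hC0 (hC k) ha)
  have step2 : ∀ a, 0 < a → Tendsto (fun k => ∫⁻ x, ‖A k a x - W a x‖ₑ ∂μ) atTop (𝓝 0) := by
    intro a ha
    have := tendsto_lintegral_of_dominated_convergence (μ := μ)
      (F := fun k x => ‖A k a x - W a x‖ₑ) (f := fun _ => 0) (fun _ => ENNReal.ofReal (B + B))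
      (fun k => by have := hAm k a; have := hWm a; fun_prop)
      (fun k => ae_of_all _ fun x =>
        bound2 (quot (abs_primitive_sub_le (hu k) (hB k)) a ha x) (quot hUlip a ha x))
      (hfin X) (ae_of_all _ fun x => ?_)
    · simpa using this
    · have h1 : Tendsto (fun k => A k a x - W a x) atTop (𝓝 (W a x - W a x)) :=
        (((hU (x + a)).sub (hU x)).div_const a).sub_const (W a x)
      rw [sub_self] at h1
      simpa using h1.enorm
  -- The quotients of the limit are compared with each other through `u k`, letting `k → ∞`. Sending
  -- `b → 0` afterwards gives a rate of convergence to `deriv U`.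
  have step3 : ∀ a b, 0 < a → 0 < b →
      ∫⁻ x, ‖W a x - W b x‖ₑ ∂μ ≤ ENNReal.ofReal (C * a) + ENNReal.ofReal (C * b) := by
    intro a b ha hb
    have := ((step2 a ha).add_const (ENNReal.ofReal (C * a))).add
      ((step2 b hb).add_const (ENNReal.ofReal (C * b)))
    rw [zero_add, zero_add] at this
    refine ge_of_tendsto' this fun k => ?_
    have t1 := lintegral_enorm_sub_le μ (f := W a) (g := u k) (h := W b) (hWm a) (hu k)
    have t2 := lintegral_enorm_sub_le μ (f := W a) (g := A k a) (h := u k) (hWm a) (hAm k a)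
    have t3 := lintegral_enorm_sub_le μ (f := u k) (g := A k b) (h := W b) (hu k) (hAm k b)
    rw [lintegral_enorm_sub_comm μ (W a) (A k a), lintegral_enorm_sub_comm μ (A k a) (u k)] at t2
    refine t1.trans (add_le_add (t2.trans (add_le_add le_rfl (step1 k a ha)))
      (t3.trans ?_))
    rw [add_comm]
    exact add_le_add le_rfl (step1 k b hb)
  set b : ℕ → ℝ := fun n => 1 / ((n : ℝ) + 1) with hb_def
  have hb : ∀ n, 0 < b n := fun n => Nat.one_div_pos_of_nat
  have hb0 : Tendsto b atTop (𝓝 0) := tendsto_one_div_add_atTop_nhds_zero_nat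
  have hCb : Tendsto (fun n => ENNReal.ofReal (C * b n)) atTop (𝓝 0) := by
    simpa using ENNReal.tendsto_ofReal (hb0.const_mul C)
  have hU'm : Measurable (deriv U) := measurable_deriv U
  have step4 : ∀ a, 0 < a → ∫⁻ x, ‖W a x - deriv U x‖ₑ ∂μ ≤ ENNReal.ofReal (C * a) := by
    intro a ha
    have h1 : Tendsto (fun n => ∫⁻ x, ‖W a x - W (b n) x‖ₑ ∂μ) atTop
        (𝓝 (∫⁻ x, ‖W a x - deriv U x‖ₑ ∂μ)) := by
      refine tendsto_lintegral_of_dominated_convergence (fun _ => ENNReal.ofReal (B + B))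
        (fun n => by have := hWm a; have := hWm (b n); fun_prop)
        (fun n => ae_of_all _ fun x => bound2 (quot hUlip a ha x) (quot hUlip _ (hb n) x))
        (hfin X) ?_
      filter_upwards [ae_restrict_of_ae hdiff] with x hx
      refine (Tendsto.const_sub (W a x) ?_).enorm
      have hm : Tendsto b atTop (𝓝[≠] 0) :=
        tendsto_nhdsWithin_iff.2 ⟨hb0, Eventually.of_forall fun n => (hb n).ne'⟩
      refine (hx.hasDerivAt.tendsto_slope_zero.comp hm).congr fun n => ?_
      simp only [Function.comp_apply, smul_eq_mul, hW]
      rw [inv_mul_eq_div]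
    have h2 := (hCb.const_add (ENNReal.ofReal (C * a)))
    rw [add_zero] at h2
    exact le_of_tendsto_of_tendsto' h1 h2 fun n => step3 a (b n) ha (hb n)
  have final : ∀ n k, ∫⁻ x, ‖u k x - deriv U x‖ₑ ∂μ
      ≤ ENNReal.ofReal (C * b n) + ENNReal.ofReal (C * b n)
        + ∫⁻ x, ‖A k (b n) x - W (b n) x‖ₑ ∂μ := by
    intro n k
    have t1 := lintegral_enorm_sub_le μ (f := u k) (g := A k (b n)) (h := deriv U) (hu k) (hAm _ _)
    have t2 := lintegral_enorm_sub_le μ (f := A k (b n)) (g := W (b n)) (h := deriv U)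
      (hAm _ _) (hWm _)
    refine (t1.trans (add_le_add (step1 k _ (hb n)) (t2.trans
      (add_le_add le_rfl (step4 _ (hb n)))))).trans (le_of_eq ?_)
    ring
  rw [ENNReal.tendsto_nhds_zero]
  intro ε hε
  have hε2 : 0 < ε / 2 := ENNReal.half_pos hε.ne'
  have hsum := hCb.add hCb
  rw [add_zero] at hsum
  obtain ⟨n, hn⟩ := ((ENNReal.tendsto_nhds_zero.1 hsum) (ε / 2) hε2).exists
  filter_upwards [(ENNReal.tendsto_nhds_zero.1 (step2 (b n) (hb n))) (ε / 2) hε2] with k hk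
  exact (final n k).trans ((add_le_add hn hk).trans (ENNReal.add_halves ε).le)

/-- Families of densities depending on time, with bounds on the variation in space, and almost
Lipschitz continuous in time, locally uniformly in time. -/
structure IsCompactFamily (R : ℝ) (C K : ℝ → ℝ) (ε : ℕ → ℝ) (u : ℕ → ℝ → ℝ → ℝ) : Prop where
  isDensity : ∀ k t, IsDensity R (u k t)
  C_nonneg : ∀ t, 0 ≤ C t
  K_nonneg : ∀ t, 0 ≤ K t
  K_mono : Monotone K
  ε_nonneg : ∀ k, 0 ≤ ε k
  ε_tendsto : Tendsto ε atTop (𝓝 0)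
  lincr_le : ∀ k t a, 0 < a → lincr (u k t) a ≤ ENNReal.ofReal (C t * a)
  dist_le : ∀ k s t, ∫⁻ x, ‖u k s x - u k t x‖ₑ ≤ ENNReal.ofReal (K (max s t) * (|s - t| + ε k))

theorem IsDensity.abs_le {R : ℝ} {u : ℝ → ℝ} (hu : IsDensity R u) (x : ℝ) : |u x| ≤ R := by
  rw [abs_of_nonneg (hu.mem x).1]; exact (hu.mem x).2

theorem abs_primitive_sub_primitive_le {f g : ℝ → ℝ} (hf : Integrable f) (hg : Integrable g) {D : ℝ}
    (hD : 0 ≤ D) (h : ∫⁻ x, ‖f x - g x‖ₑ ≤ ENNReal.ofReal D) (x : ℝ) :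
    |(∫ s in (0 : ℝ)..x, f s) - ∫ s in (0 : ℝ)..x, g s| ≤ D := by
  rw [← intervalIntegral.integral_sub hf.intervalIntegrable hg.intervalIntegrable]
  have h1 : ∫ x, |f x - g x| ≤ D := by
    have := ofReal_integral_norm_eq_lintegral_enorm (hf.sub hg)
    simp only [Pi.sub_apply] at this
    rw [← this] at h
    exact (ENNReal.ofReal_le_ofReal_iff hD).1 h
  refine le_trans ?_ h1
  refine (intervalIntegral.norm_integral_le_integral_norm_uIoc
    (f := fun s => f s - g s) (μ := volume)).trans ?_
  exact setIntegral_le_integral (hf.sub hg).norm (ae_of_all _ fun x => norm_nonneg _)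

namespace IsCompactFamily

variable {R : ℝ} {C K : ℝ → ℝ} {ε : ℕ → ℝ} {u : ℕ → ℝ → ℝ → ℝ}

theorem abs_primitive_sub_le (hu : IsCompactFamily R C K ε u) (k : ℕ) (s t x y : ℝ) :
    |(∫ r in (0 : ℝ)..x, u k s r) - ∫ r in (0 : ℝ)..y, u k t r|
      ≤ R * |x - y| + K (max s t) * (|s - t| + ε k) := by
  refine (abs_sub_le _ (∫ r in (0 : ℝ)..y, u k s r) _).trans (add_le_add ?_ ?_)
  · exact DelayTraffic.abs_primitive_sub_le (hu.isDensity k s).measurable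
      (hu.isDensity k s).abs_le x y
  · exact abs_primitive_sub_primitive_le (hu.isDensity k s).integrable
      (hu.isDensity k t).integrable
      (mul_nonneg (hu.K_nonneg _) (add_nonneg (abs_nonneg _) (hu.ε_nonneg k)))
      (hu.dist_le k s t) y

/-- An Arzelà-Ascoli argument: compactness of a countable product gives convergence at rational
times and points. The Lipschitz bounds extend it to all times and points, as the defect `ε` of the
time estimate vanishes along the sequence. -/
theorem exists_primitives (hu : IsCompactFamily R C K ε u) :
    ∃ σ : ℕ → ℕ, StrictMono σ ∧ ∃ U : ℝ → ℝ → ℝ, ∀ t x,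
      Tendsto (fun k => ∫ r in (0 : ℝ)..x, u (σ k) t r) atTop (𝓝 (U t x)) := by
  have hR : 0 ≤ R := (abs_nonneg _).trans ((hu.isDensity 0 0).abs_le 0)
  set S : Set (ℚ × ℚ → ℝ) := Set.pi univ fun p => Icc (-(R * |(p.2 : ℝ)|)) (R * |(p.2 : ℝ)|)
  have hS : IsCompact S := isCompact_univ_pi fun p => isCompact_Icc
  obtain ⟨y, -, σ, hσ, hy⟩ := hS.tendsto_subseq
    (x := fun k p => ∫ r in (0 : ℝ)..p.2, u k p.1 r) fun k p _ => by
      have := DelayTraffic.abs_primitive_sub_le (hu.isDensity k p.1).measurable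
        (hu.isDensity k p.1).abs_le p.2 0
      rw [intervalIntegral.integral_same, sub_zero, sub_zero] at this
      exact abs_le.1 this
  rw [tendsto_pi_nhds] at hy
  have hc : ∀ t x, ∃ l, Tendsto (fun k => ∫ r in (0 : ℝ)..x, u (σ k) t r) atTop (𝓝 l) := by
    intro t x
    refine cauchySeq_tendsto_of_complete (Metric.cauchySeq_iff.2 fun e he => ?_)
    set Kt := K (t + 1)
    have hKt : 0 ≤ Kt := hu.K_nonneg _
    -- The rational time stays below `t + 1`, so the locally uniform Lipschitz bound in time can be
    -- frozen at `K (t + 1)`.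
    obtain ⟨q, hq1, hq2⟩ := exists_rat_btwn
      (show t < t + min 1 (e / (8 * (Kt + 1))) from lt_add_of_pos_right _ (by positivity))
    obtain ⟨r, hr1, hr2⟩ := exists_rat_btwn
      (show x < x + e / (8 * (R + 1)) from lt_add_of_pos_right _ (by positivity))
    have hεσ := hu.ε_tendsto.comp hσ.tendsto_atTop
    have hev := hεσ.eventually (gt_mem_nhds (show 0 < e / (8 * (Kt + 1)) by positivity))
    obtain ⟨N₁, hN₁⟩ := eventually_atTop.1 hev
    obtain ⟨N₂, hN₂⟩ := Metric.cauchySeq_iff.1 (hy (q, r)).cauchySeq (e / 4) (by positivity)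
    have close : ∀ k ≥ N₁, |(∫ s in (0 : ℝ)..x, u (σ k) t s) - ∫ s in (0 : ℝ)..r, u (σ k) q s|
        ≤ 3 * e / 8 := by
      intro k hk
      refine (hu.abs_primitive_sub_le (σ k) t q x r).trans ?_
      have h1 : K (max t q) ≤ Kt := hu.K_mono (max_le (by linarith)
        (by linarith [min_le_left 1 (e / (8 * (Kt + 1)))]))
      have h2 : |x - r| ≤ e / (8 * (R + 1)) := by rw [abs_sub_comm, abs_of_pos (by linarith)]; linarith
      have h3 : |t - q| ≤ e / (8 * (Kt + 1)) := by
        rw [abs_sub_comm, abs_of_pos (by linarith)]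
        linarith [min_le_right 1 (e / (8 * (Kt + 1)))]
      have h4 : ε (σ k) ≤ e / (8 * (Kt + 1)) := (hN₁ k hk).le
      have h5 : 0 ≤ |t - q| + ε (σ k) := add_nonneg (abs_nonneg _) (hu.ε_nonneg _)
      have h6 : R * |x - r| ≤ e / 8 := by
        refine (mul_le_mul (by linarith : R ≤ R + 1) h2 (abs_nonneg _) (by linarith)).trans
          (le_of_eq ?_)
        field_simp
      have h7 : K (max t q) * (|t - q| + ε (σ k)) ≤ e / 4 := by
        refine (mul_le_mul (h1.trans (by linarith : Kt ≤ Kt + 1)) (add_le_add h3 h4) h5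
          (by linarith)).trans (le_of_eq ?_)
        field_simp; norm_num
      linarith
    refine ⟨max N₁ N₂, fun m hm n hn => ?_⟩
    have h1 := close m (le_of_max_le_left hm)
    have h2 := close n (le_of_max_le_left hn)
    have h3 := hN₂ m (le_of_max_le_right hm) n (le_of_max_le_right hn)
    simp only [Function.comp_apply, Real.dist_eq] at h3 ⊢
    rw [abs_lt] at h3 ⊢
    rw [abs_le] at h1 h2
    constructor <;> linarith
  choose U hU using hc
  exact ⟨σ, hσ, U, hU⟩

/-- Compactness: a subsequence converges in `L¹_loc(ℝ)` at every time, and the limit is jointly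
measurable. -/
theorem exists_limit (hu : IsCompactFamily R C K ε u) :
    ∃ σ : ℕ → ℕ, StrictMono σ ∧ ∃ ρ : ℝ → ℝ → ℝ, Measurable (Function.uncurry ρ) ∧
      (∀ t x, ρ t x ∈ Icc 0 R) ∧ ∀ t, L1Loc (fun k => u (σ k) t) (ρ t) := by
  obtain ⟨σ, hσ, U, hU⟩ := hu.exists_primitives
  have hR : 0 ≤ R := (abs_nonneg _).trans ((hu.isDensity 0 0).abs_le 0)
  have hεσ := hu.ε_tendsto.comp hσ.tendsto_atTop
  -- The defect `ε` is gone in the limit, so `U` is jointly continuous and its derivative in `x` is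
  -- jointly measurable.
  have hUd : ∀ s t x y, |U s x - U t y| ≤ R * |x - y| + K (max s t) * |s - t| := by
    intro s t x y
    have h1 : Tendsto (fun k => R * |x - y| + K (max s t) * (|s - t| + ε (σ k))) atTop
        (𝓝 (R * |x - y| + K (max s t) * (|s - t| + 0))) :=
      ((hεσ.const_add _).const_mul _).const_add _
    rw [add_zero] at h1
    exact le_of_tendsto_of_tendsto' ((hU s x).sub (hU t y)).abs h1
      fun k => hu.abs_primitive_sub_le (σ k) s t x y
  have hUc : Continuous (Function.uncurry U) := by
    rw [continuous_iff_continuousAt]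
    rintro ⟨t, x⟩
    rw [ContinuousAt, tendsto_iff_dist_tendsto_zero]
    have h1 : Tendsto (fun p : ℝ × ℝ => R * |p.2 - x| + K (t + 1) * |p.1 - t|) (𝓝 (t, x)) (𝓝 0) := by
      have : Continuous fun p : ℝ × ℝ => R * |p.2 - x| + K (t + 1) * |p.1 - t| := by fun_prop
      simpa using this.tendsto (t, x)
    refine squeeze_zero' (Eventually.of_forall fun p => dist_nonneg) ?_ h1
    have h2 : ∀ᶠ p : ℝ × ℝ in 𝓝 (t, x), p.1 < t + 1 :=
      continuous_fst.continuousAt.eventually (gt_mem_nhds (lt_add_one t))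
    filter_upwards [h2] with p hp
    rw [Real.dist_eq]
    refine (hUd p.1 t p.2 x).trans (add_le_add le_rfl ?_)
    exact mul_le_mul_of_nonneg_right (hu.K_mono (max_le hp.le (by linarith))) (abs_nonneg _)
  refine ⟨σ, hσ, fun t => deriv (U t), ?_, fun t x => ?_, fun t => ?_⟩
  · exact measurable_deriv_with_param hUc
  -- The bounds hold at every point, not only almost everywhere: `deriv` is nonnegative for a
  -- monotone function and at most `R` for an `R`-Lipschitz one, also where the derivative does not
  -- exist.
  · constructor
    · have hmono : Monotone (U t) := fun x y hxy => by
        refine le_of_tendsto_of_tendsto' (hU t x) (hU t y) fun k => ?_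
        have hd := hu.isDensity (σ k) t
        have hi := intervalIntegrable_of_bound hd.measurable hd.abs_le
        rw [← intervalIntegral.integral_add_adjacent_intervals (hi 0 x) (hi x y)]
        exact le_add_of_nonneg_right
          (intervalIntegral.integral_nonneg hxy fun s _ => (hd.mem s).1)
      exact hmono.deriv_nonneg
    · have hl : LipschitzWith ⟨R, hR⟩ (U t) := LipschitzWith.of_dist_le_mul fun x y => by
        have := hUd t t x y
        rw [sub_self, abs_zero, mul_zero, add_zero] at this
        rw [Real.dist_eq, Real.dist_eq]; exact this
      exact (le_abs_self _).trans (norm_deriv_le_of_lipschitz hl)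
  · exact L1Loc.of_primitives (fun k => (hu.isDensity _ _).measurable)
      (fun k => (hu.isDensity _ _).abs_le) (hu.C_nonneg t) (fun k => hu.lincr_le (σ k) t) (hU t)

end IsCompactFamily

end DelayTraffic

/-! ### The approximate solutions and the estimates inherited by their limits. -/

namespace DelayTraffic

variable {P : Model} {G : NumFlux} {ρ₀ : ℝ → ℝ}

/-! ### The approximate solutions -/

/-- A sequence of meshes on which the scheme is monotone. -/
structure IsMeshSeq (P : Model) (G : NumFlux) (Λ : ℝ) (N h : ℕ → ℕ) : Prop where
  N_pos : ∀ k, 0 < N k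
  h_pos : ∀ k, 0 < h k
  N_tendsto : Tendsto N atTop atTop
  lam_le : ∀ k, P.lam (N k) (h k) ≤ Λ
  mono : ∀ k, G.IsMonotone P (P.lam (N k) (h k))

/-- The approximate solution. -/
noncomputable def apx (P : Model) (G : NumFlux) (ρ₀ : ℝ → ℝ) (N h : ℕ) (t : ℝ) : ℝ → ℝ :=
  sol P G N h (P.cellMean N ρ₀) ⌊t / P.dt h⌋₊

theorem approxLF_eq (α : ℝ) (N h : ℕ) (ρ₀ : ℝ → ℝ) :
    P.approxLF α N h ρ₀ = apx P (lfFlux P α) ρ₀ N h := by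
  rw [Model.approxLF, stepLF_eq]; rfl

theorem approxHW_eq (N h : ℕ) (ρ₀ : ℝ → ℝ) :
    P.approxHW N h ρ₀ = apx P (hwFlux P) ρ₀ N h := by
  rw [Model.approxHW, stepHW_eq]; rfl

theorem apx_measurable (N h : ℕ) : Measurable (Function.uncurry (apx P G ρ₀ N h)) := by
  have h1 : Measurable fun z : ℝ × ℝ => (⌊z.1 / P.dt h⌋₊, ⌊z.2 / P.dx N⌋) :=
    (Nat.measurable_floor.comp (measurable_fst.div_const _)).prodMk
      (Int.measurable_floor.comp (measurable_snd.div_const _))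
  exact (measurable_of_countable fun p : ℕ × ℤ =>
    Model.iterate (seqStep P G N h) h (P.cellMean N ρ₀) p.1 (p.2 + 1)).comp h1

/-- The natural number floor is `0` at negative times, so the approximate solution is automatically
extended to the past by the discretized datum. -/
theorem apx_of_lt (hP : P.Admissible) {N h : ℕ} (hh : 0 < h) {t : ℝ} (ht : t < P.dt h) :
    apx P G ρ₀ N h t = lift (P.dx N) (P.cellMean N ρ₀) := by
  have : ⌊t / P.dt h⌋₊ = 0 := Nat.floor_eq_zero.2 ((div_lt_one (hP.dt_pos hh)).2 ht)
  rw [apx, this, sol_zero]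

/-- The coefficient of the variation in the Lipschitz constant in time. -/
noncomputable def timeLip (P : Model) (G : NumFlux) (ρ₀ : ℝ → ℝ) (m t : ℝ) : ℝ :=
  (G.β + (1 + P.R * P.normF') * P.V) * P.growth (max t 0) * (totalVar ρ₀).toReal
    + 2 * P.R * P.normω * P.normV' * m

theorem speedCoeff_nonneg (hP : P.Admissible) (hβ : 0 ≤ G.β) :
    0 ≤ G.β + (1 + P.R * P.normF') * P.V :=
  add_nonneg hβ (mul_nonneg (by linarith [hP.one_le_fluxLip]) hP.V_pos.le)

theorem massCoeff_nonneg (hP : P.Admissible) : 0 ≤ 2 * P.R * P.normω * P.normV' :=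
  mul_nonneg (mul_nonneg (mul_nonneg zero_le_two hP.R_pos.le) Model.normω_nonneg)
    Model.normV'_nonneg

theorem timeLip_mono (hP : P.Admissible) (hβ : 0 ≤ G.β) (m : ℝ) :
    Monotone (timeLip P G ρ₀ m) := fun s t hst => by
  have := speedCoeff_nonneg hP hβ
  have := hP.growth_mono (le_max_right s 0) (max_le_max_right 0 hst)
  unfold timeLip
  gcongr

theorem timeLip_nonneg (hP : P.Admissible) (hβ : 0 ≤ G.β) {m : ℝ} (hm : 0 ≤ m) (t : ℝ) :
    0 ≤ timeLip P G ρ₀ m t :=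
  add_nonneg (mul_nonneg (mul_nonneg (speedCoeff_nonneg hP hβ)
    (zero_le_one.trans (hP.one_le_growth (le_max_right _ _)))) ENNReal.toReal_nonneg)
    (mul_nonneg (massCoeff_nonneg hP) hm)

section Mesh

variable {N h : ℕ}

theorem floor_mul_dt_le (hP : P.Admissible) (hh : 0 < h) (t : ℝ) :
    ⌊t / P.dt h⌋₊ * P.dt h ≤ max t 0 := by
  have hδ := hP.dt_pos hh
  rcases lt_or_ge t 0 with ht | ht
  · rw [Nat.floor_of_nonpos (div_nonpos_of_nonpos_of_nonneg ht.le hδ.le)]; simp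
  · rw [← le_div_iff₀ hδ, max_eq_left ht]
    exact Nat.floor_le (div_nonneg ht hδ.le)

theorem apx_isDensity (hP : P.Admissible) (hρ : IsDensity P.R ρ₀) (htv : totalVar ρ₀ ≠ ∞)
    (hN : 0 < N) (hG : G.IsMonotone P (P.lam N h)) (t : ℝ) :
    IsDensity P.R (apx P G ρ₀ N h t) :=
  sol_isDensity hP hN hG (cellMean_isDensity hP hN hρ htv) _

theorem incr_apx_le (hP : P.Admissible) (hρ : IsDensity P.R ρ₀) (htv : totalVar ρ₀ ≠ ∞)
    (hN : 0 < N) (hh : 0 < h) (hG : G.IsMonotone P (P.lam N h)) (t : ℝ) :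
    incr (apx P G ρ₀ N h t) (P.dx N)
      ≤ P.growth (max t 0) * (totalVar ρ₀).toReal * P.dx N := by
  refine (incr_sol_le hP hN hh hG (cellMean_isDensity hP hN hρ htv)
    (incr_cellMean_le hP hN hρ htv) _).trans ?_
  rw [mul_assoc]
  exact mul_le_mul_of_nonneg_right (hP.growth_mono (mul_nonneg (Nat.cast_nonneg _)
    (hP.dt_pos hh).le) (floor_mul_dt_le hP hh t))
    (mul_nonneg ENNReal.toReal_nonneg (hP.dx_pos hN).le)

theorem lincr_apx_le (hP : P.Admissible) (hρ : IsDensity P.R ρ₀) (htv : totalVar ρ₀ ≠ ∞)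
    (hN : 0 < N) (hh : 0 < h) (hG : G.IsMonotone P (P.lam N h)) (t : ℝ) {a : ℝ} (ha : 0 < a) :
    lincr (apx P G ρ₀ N h t) a
      ≤ ENNReal.ofReal (P.growth (max t 0) * (totalVar ρ₀).toReal * a) := by
  have hd := hP.dx_pos hN
  refine (lincr_lift_le_self hd _ ha).trans ?_
  have h1 : lincr (apx P G ρ₀ N h t) (P.dx N)
      ≤ ENNReal.ofReal (P.growth (max t 0) * (totalVar ρ₀).toReal * P.dx N) := by
    rw [lincr_eq_ofReal_incr ((apx_isDensity hP hρ htv hN hG t).integrable.incr _)]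
    exact ENNReal.ofReal_le_ofReal (incr_apx_le hP hρ htv hN hh hG t)
  refine (mul_le_mul_right h1 _).trans (le_of_eq ?_)
  rw [← ENNReal.ofReal_mul (by positivity)]
  congr 1; field_simp

theorem lintegral_sol_sub_le (hP : P.Admissible) (hρ : IsDensity P.R ρ₀) (htv : totalVar ρ₀ ≠ ∞)
    (hN : 0 < N) (hh : 0 < h) (hG : G.IsMonotone P (P.lam N h)) (m j : ℕ) :
    ∫⁻ x, ‖sol P G N h (P.cellMean N ρ₀) (m + j) x - sol P G N h (P.cellMean N ρ₀) m x‖ₑ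
      ≤ ENNReal.ofReal (j * P.dt h *
        timeLip P G ρ₀ (∫ x, lift (P.dx N) (P.cellMean N ρ₀) x) ((m + j : ℕ) * P.dt h)) := by
  have h0 := cellMean_isDensity hP hN hρ htv
  have hs := sol_isDensity hP hN hG h0
  have hδ := hP.dt_pos hh
  have hm : 0 ≤ ∫ x, lift (P.dx N) (P.cellMean N ρ₀) x := integral_nonneg fun x => (h0.mem x).1
  have hβ := (hG.β_nonneg)
  induction j with
  | zero => simp
  | succ j ih =>
    have h1 := integral_abs_sol_succ_sub_le hP hN hh hG h0 (incr_cellMean_le hP hN hρ htv) (m + j)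
    have h2 : ∫⁻ x, ‖sol P G N h (P.cellMean N ρ₀) (m + j + 1) x
        - sol P G N h (P.cellMean N ρ₀) (m + j) x‖ₑ ≤ ENNReal.ofReal (P.dt h *
        timeLip P G ρ₀ (∫ x, lift (P.dx N) (P.cellMean N ρ₀) x) ((m + j : ℕ) * P.dt h)) := by
      have := ofReal_integral_norm_eq_lintegral_enorm
        ((hs (m + j + 1)).integrable.sub (hs (m + j)).integrable)
      simp only [Pi.sub_apply] at this
      rw [← this]
      refine ENNReal.ofReal_le_ofReal (h1.trans (le_of_eq ?_))
      rw [timeLip, max_eq_left (by positivity)]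
    refine (lintegral_enorm_sub_le _ (hs _).measurable (hs (m + j)).measurable).trans
      ((add_le_add h2 ih).trans ?_)
    have hL := timeLip_nonneg (ρ₀ := ρ₀) hP hβ hm
    have hmon := timeLip_mono (ρ₀ := ρ₀) hP hβ (∫ x, lift (P.dx N) (P.cellMean N ρ₀) x)
      (show ((m + j : ℕ) : ℝ) * P.dt h ≤ (m + (j + 1) : ℕ) * P.dt h by
        gcongr; omega)
    rw [← ENNReal.ofReal_add (mul_nonneg hδ.le (hL _)) (mul_nonneg (by positivity) (hL _))]
    refine ENNReal.ofReal_le_ofReal ?_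
    have := mul_le_mul_of_nonneg_left hmon (show 0 ≤ ((j : ℝ) + 1) * P.dt h by positivity)
    push_cast at this ⊢
    linarith

/-- The number of time steps separating `s` and `t` can exceed `|s - t| / Δt` by less than one,
which explains the additional `Δt`. -/
theorem lintegral_apx_sub_le (hP : P.Admissible) (hρ : IsDensity P.R ρ₀) (htv : totalVar ρ₀ ≠ ∞)
    (hN : 0 < N) (hh : 0 < h) (hG : G.IsMonotone P (P.lam N h)) (s t : ℝ) :
    ∫⁻ x, ‖apx P G ρ₀ N h s x - apx P G ρ₀ N h t x‖ₑ
      ≤ ENNReal.ofReal (timeLip P G ρ₀ (∫ x, lift (P.dx N) (P.cellMean N ρ₀) x) (max s t)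
        * (|s - t| + P.dt h)) := by
  wlog hst : t ≤ s generalizing s t
  · rw [lintegral_enorm_sub_comm, max_comm, abs_sub_comm]
    exact this t s (le_of_not_ge hst)
  have hδ := hP.dt_pos hh
  have h0 := cellMean_isDensity hP hN hρ htv
  have hm : 0 ≤ ∫ x, lift (P.dx N) (P.cellMean N ρ₀) x := integral_nonneg fun x => (h0.mem x).1
  obtain ⟨j, hj⟩ := Nat.exists_eq_add_of_le
    (Nat.floor_le_floor (div_le_div_of_nonneg_right hst hδ.le))
  unfold apx
  rw [hj]
  refine (lintegral_sol_sub_le hP hρ htv hN hh hG _ j).trans (ENNReal.ofReal_le_ofReal ?_)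
  rw [← hj, max_eq_left hst, abs_of_nonneg (sub_nonneg.2 hst), mul_comm]
  have hL := timeLip_nonneg (ρ₀ := ρ₀) hP hG.β_nonneg hm
  have h2 : timeLip P G ρ₀ (∫ x, lift (P.dx N) (P.cellMean N ρ₀) x) (⌊s / P.dt h⌋₊ * P.dt h)
      ≤ timeLip P G ρ₀ (∫ x, lift (P.dx N) (P.cellMean N ρ₀) x) s := by
    have e : ∀ r, timeLip P G ρ₀ (∫ x, lift (P.dx N) (P.cellMean N ρ₀) x) r
      = timeLip P G ρ₀ (∫ x, lift (P.dx N) (P.cellMean N ρ₀) x) (max r 0) := fun r => by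
        rw [timeLip, timeLip, max_assoc, max_self]
    rw [e s]
    exact timeLip_mono hP hG.β_nonneg _ (floor_mul_dt_le hP hh s)
  refine mul_le_mul h2 ?_ (by positivity) (hL _)
  rcases Nat.eq_zero_or_pos j with rfl | hj0
  · simp only [Nat.cast_zero, zero_mul]; linarith
  have hs : 0 < s := by
    by_contra! hs
    rw [Nat.floor_of_nonpos (div_nonpos_of_nonpos_of_nonneg hs hδ.le)] at hj
    omega
  have h3 := floor_mul_dt_le hP hh s
  rw [max_eq_left hs.le, hj] at h3
  have h4 := Nat.lt_floor_add_one (t / P.dt h)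
  rw [div_lt_iff₀ hδ] at h4
  push_cast at h3
  linarith

theorem abs_integral_cellMean_sub_le (hP : P.Admissible) (hρ : IsDensity P.R ρ₀)
    (htv : totalVar ρ₀ ≠ ∞) (hN : 0 < N) {ψ : ℝ → ℝ} (hψ : Measurable ψ) (h1 : ∀ x, |ψ x| ≤ 1) :
    |(∫ x, lift (P.dx N) (P.cellMean N ρ₀) x * ψ x) - ∫ x, ρ₀ x * ψ x|
      ≤ 2 * (totalVar ρ₀).toReal * P.dx N := by
  have hi := (cellMean_isDensity hP hN hρ htv).integrable
  have hd := hi.sub hρ.integrable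
  have bd : ∀ {f : ℝ → ℝ}, Integrable f → Integrable fun x => f x * ψ x :=
    fun hf => hf.mul_bdd (c := 1) hψ.aestronglyMeasurable (ae_of_all _ h1)
  rw [← integral_sub (bd hi) (bd hρ.integrable)]
  refine (abs_integral_le_integral_abs).trans ?_
  have h2 : ∫ x, |lift (P.dx N) (P.cellMean N ρ₀) x - ρ₀ x|
      ≤ 2 * (totalVar ρ₀).toReal * P.dx N := by
    have := ofReal_integral_norm_eq_lintegral_enorm hd
    simp only [Pi.sub_apply] at this
    have h3 := lintegral_cellMean_sub_le hP hN hρ htv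
    rw [← this] at h3
    exact (ENNReal.ofReal_le_ofReal_iff
      (mul_nonneg (mul_nonneg zero_le_two ENNReal.toReal_nonneg) (hP.dx_pos hN).le)).1 h3
  refine le_trans (integral_mono ?_ hd.abs fun x => ?_) h2
  · exact ((bd hi).sub (bd hρ.integrable)).abs
  · simp only [← sub_mul, abs_mul, Pi.sub_apply]
    exact mul_le_of_le_one_right (abs_nonneg _) (h1 x)

theorem abs_integral_cellMean_le (hP : P.Admissible) (hρ : IsDensity P.R ρ₀)
    (htv : totalVar ρ₀ ≠ ∞) (hN : 0 < N) :
    |(∫ x, lift (P.dx N) (P.cellMean N ρ₀) x) - ∫ x, ρ₀ x|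
      ≤ 2 * (totalVar ρ₀).toReal * P.dx N := by
  simpa using abs_integral_cellMean_sub_le hP hρ htv hN (ψ := fun _ => 1) measurable_const
    (by simp)

end Mesh

/-! ### Sequences of meshes -/

namespace IsMeshSeq

variable {Λ : ℝ} {N h : ℕ → ℕ}

theorem comp (hm : IsMeshSeq P G Λ N h) {σ : ℕ → ℕ} (hσ : StrictMono σ) :
    IsMeshSeq P G Λ (fun k => N (σ k)) fun k => h (σ k) :=
  ⟨fun _ => hm.N_pos _, fun _ => hm.h_pos _, hm.N_tendsto.comp hσ.tendsto_atTop,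
    fun _ => hm.lam_le _, fun _ => hm.mono _⟩

theorem dx_tendsto (hm : IsMeshSeq P G Λ N h) : Tendsto (fun k => P.dx (N k)) atTop (𝓝 0) :=
  tendsto_const_nhds.div_atTop (tendsto_natCast_atTop_atTop.comp hm.N_tendsto)

theorem dt_tendsto (hP : P.Admissible) (hm : IsMeshSeq P G Λ N h) :
    Tendsto (fun k => P.dt (h k)) atTop (𝓝 0) := by
  have := hm.dx_tendsto.const_mul Λ
  rw [mul_zero] at this
  refine squeeze_zero (fun k => (hP.dt_pos (hm.h_pos k)).le) (fun k => ?_) this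
  rw [← lam_mul_dx hP (hm.N_pos k)]
  exact mul_le_mul_of_nonneg_right (hm.lam_le k) (hP.dx_pos (hm.N_pos k)).le

theorem mass_tendsto (hP : P.Admissible) (hm : IsMeshSeq P G Λ N h) (hρ : IsDensity P.R ρ₀)
    (htv : totalVar ρ₀ ≠ ∞) {ψ : ℝ → ℝ} (hψ : Measurable ψ) (h1 : ∀ x, |ψ x| ≤ 1) :
    Tendsto (fun k => ∫ x, lift (P.dx (N k)) (P.cellMean (N k) ρ₀) x * ψ x) atTop
      (𝓝 (∫ x, ρ₀ x * ψ x)) := by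
  rw [tendsto_iff_dist_tendsto_zero]
  have := hm.dx_tendsto.const_mul (2 * (totalVar ρ₀).toReal)
  rw [mul_zero] at this
  exact squeeze_zero (fun _ => dist_nonneg)
    (fun k => abs_integral_cellMean_sub_le hP hρ htv (hm.N_pos k) hψ h1) this

theorem mass_tendsto' (hP : P.Admissible) (hm : IsMeshSeq P G Λ N h) (hρ : IsDensity P.R ρ₀)
    (htv : totalVar ρ₀ ≠ ∞) :
    Tendsto (fun k => ∫ x, lift (P.dx (N k)) (P.cellMean (N k) ρ₀) x) atTop (𝓝 (∫ x, ρ₀ x)) := by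
  simpa using hm.mass_tendsto hP hρ htv (ψ := fun _ => 1) measurable_const (by simp)

/-- The constant in time must not depend on the mesh, whereas the mass of the discretized datum
might. As `Δx ≤ L`, that mass is bounded uniformly by the mass of `ρ₀` plus `2 TV(ρ₀) L`. -/
theorem isCompactFamily (hP : P.Admissible) (hm : IsMeshSeq P G Λ N h) (hρ : IsDensity P.R ρ₀)
    (htv : totalVar ρ₀ ≠ ∞) :
    IsCompactFamily P.R (fun t => P.growth (max t 0) * (totalVar ρ₀).toReal)
      (timeLip P G ρ₀ ((∫ x, ρ₀ x) + 2 * (totalVar ρ₀).toReal * P.L)) (fun k => P.dt (h k))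
      fun k => apx P G ρ₀ (N k) (h k) where
  isDensity k t := apx_isDensity hP hρ htv (hm.N_pos k) (hm.mono k) t
  C_nonneg t := mul_nonneg (zero_le_one.trans (hP.one_le_growth (le_max_right _ _)))
    ENNReal.toReal_nonneg
  K_nonneg := timeLip_nonneg hP (hm.mono 0).β_nonneg (add_nonneg
    (integral_nonneg fun x => (hρ.mem x).1) (mul_nonneg (mul_nonneg zero_le_two
      ENNReal.toReal_nonneg) hP.L_pos.le))
  K_mono := timeLip_mono hP (hm.mono 0).β_nonneg _
  ε_nonneg k := (hP.dt_pos (hm.h_pos k)).le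
  ε_tendsto := hm.dt_tendsto hP
  lincr_le k t a ha := lincr_apx_le hP hρ htv (hm.N_pos k) (hm.h_pos k) (hm.mono k) t ha
  dist_le k s t := by
    refine (lintegral_apx_sub_le hP hρ htv (hm.N_pos k) (hm.h_pos k) (hm.mono k) s t).trans
      (ENNReal.ofReal_le_ofReal (mul_le_mul_of_nonneg_right ?_
        (add_nonneg (abs_nonneg _) (hP.dt_pos (hm.h_pos k)).le)))
    have h1 := (abs_le.1 (abs_integral_cellMean_le hP hρ htv (hm.N_pos k))).2
    have h2 : P.dx (N k) ≤ P.L :=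
      div_le_self hP.L_pos.le (by exact_mod_cast hm.N_pos k)
    have h3 := mul_le_mul_of_nonneg_left h2
      (mul_nonneg zero_le_two (ENNReal.toReal_nonneg (a := totalVar ρ₀)))
    unfold timeLip
    refine add_le_add le_rfl (mul_le_mul_of_nonneg_left (by linarith) (massCoeff_nonneg hP))

end IsMeshSeq

/-- The limit of the approximate solutions. -/
structure IsLimit (P : Model) (G : NumFlux) (ρ₀ : ℝ → ℝ) (N h : ℕ → ℕ) (ρ : ℝ → ℝ → ℝ) :
    Prop where
  measurable : Measurable (Function.uncurry ρ)
  mem : ∀ t x, ρ t x ∈ Icc 0 P.R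
  tendsto : ∀ t, L1Loc (fun k => apx P G ρ₀ (N k) (h k) t) (ρ t)

theorem L1Loc.unique {u : ℕ → ℝ → ℝ} {v w : ℝ → ℝ} (h : L1Loc u v) (h' : L1Loc u w)
    (hu : ∀ k, Measurable (u k)) (hv : Measurable v) (hw : Measurable w) : v =ᵐ[volume] w := by
  have h1 := (h.sub h' hu hv).lintegral_le (c := fun _ => 0) (C := 0)
    (fun k => by have := hu k; fun_prop) (by fun_prop) (fun k => by simp) tendsto_const_nhds
  have h2 := (lintegral_eq_zero_iff (by fun_prop)).1 (nonpos_iff_eq_zero.1 h1)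
  filter_upwards [h2] with x hx
  simpa [sub_eq_zero] using hx

namespace IsLimit

variable {Λ : ℝ} {N h : ℕ → ℕ} {ρ : ℝ → ℝ → ℝ}

theorem measurable_at (hl : IsLimit P G ρ₀ N h ρ) (t : ℝ) : Measurable (ρ t) :=
  hl.measurable.comp measurable_prodMk_left

theorem initial_tendsto (hP : P.Admissible) (hm : IsMeshSeq P G Λ N h) (hρ : IsDensity P.R ρ₀)
    (htv : totalVar ρ₀ ≠ ∞) :
    Tendsto (fun k => ∫⁻ x, ‖lift (P.dx (N k)) (P.cellMean (N k) ρ₀) x - ρ₀ x‖ₑ) atTop (𝓝 0) := by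
  have := ENNReal.tendsto_ofReal (hm.dx_tendsto.const_mul (2 * (totalVar ρ₀).toReal))
  rw [mul_zero, ENNReal.ofReal_zero] at this
  exact tendsto_of_tendsto_of_tendsto_of_le_of_le tendsto_const_nhds this (fun _ => zero_le)
    fun k => lintegral_cellMean_sub_le hP (hm.N_pos k) hρ htv

theorem past (hP : P.Admissible) (hm : IsMeshSeq P G Λ N h) (hρ : IsDensity P.R ρ₀)
    (htv : totalVar ρ₀ ≠ ∞) (hl : IsLimit P G ρ₀ N h ρ) {t : ℝ} (ht : t ≤ 0) :
    ρ t =ᵐ[volume] ρ₀ := by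
  refine (hl.tendsto t).unique (L1Loc.of_tendsto ?_) (fun k => ?_) (hl.measurable_at t)
    hρ.measurable
  · refine (initial_tendsto hP hm hρ htv).congr fun k => ?_
    rw [apx_of_lt hP (hm.h_pos k) (ht.trans_lt (hP.dt_pos (hm.h_pos k)))]
  · exact (apx_isDensity hP hρ htv (hm.N_pos k) (hm.mono k) t).measurable

theorem lincr_le (hP : P.Admissible) (hm : IsMeshSeq P G Λ N h) (hρ : IsDensity P.R ρ₀)
    (htv : totalVar ρ₀ ≠ ∞) (hl : IsLimit P G ρ₀ N h ρ) (t : ℝ) {a : ℝ} (ha : 0 < a) :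
    lincr (ρ t) a ≤ ENNReal.ofReal (P.growth (max t 0) * (totalVar ρ₀).toReal * a) :=
  (hl.tendsto t).lincr_le
    (fun k => (apx_isDensity hP hρ htv (hm.N_pos k) (hm.mono k) t).measurable)
    (hl.measurable_at t)
    fun k => lincr_apx_le hP hρ htv (hm.N_pos k) (hm.h_pos k) (hm.mono k) t ha

/-- The estimate of each mesh is passed to the limit with its own mass. These masses converge to
that of `ρ₀`, so the exact constant results instead of the cruder one used for compactness. -/
theorem dist_le (hP : P.Admissible) (hm : IsMeshSeq P G Λ N h) (hρ : IsDensity P.R ρ₀)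
    (htv : totalVar ρ₀ ≠ ∞) (hl : IsLimit P G ρ₀ N h ρ) (s t : ℝ) :
    ∫⁻ x, ‖ρ s x - ρ t x‖ₑ
      ≤ ENNReal.ofReal (timeLip P G ρ₀ (∫ x, ρ₀ x) (max s t) * |s - t|) := by
  have hmeas : ∀ t k, Measurable (apx P G ρ₀ (N k) (h k) t) :=
    fun t k => (apx_isDensity hP hρ htv (hm.N_pos k) (hm.mono k) t).measurable
  refine ((hl.tendsto s).sub (hl.tendsto t) (hmeas s) (hl.measurable_at s)).lintegral_le
    (fun k => (hmeas s k).sub (hmeas t k)) ((hl.measurable_at s).sub (hl.measurable_at t))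
    (fun k => lintegral_apx_sub_le hP hρ htv (hm.N_pos k) (hm.h_pos k) (hm.mono k) s t)
    (ENNReal.tendsto_ofReal ?_)
  have h1 := ((hm.mass_tendsto' hP hρ htv).const_mul (2 * P.R * P.normω * P.normV')).const_add
    ((G.β + (1 + P.R * P.normF') * P.V) * P.growth (max (max s t) 0) * (totalVar ρ₀).toReal)
  have h2 := h1.mul ((hm.dt_tendsto hP).const_add |s - t|)
  rw [add_zero] at h2
  exact h2

theorem lintegral_le (hP : P.Admissible) (hm : IsMeshSeq P G Λ N h) (hρ : IsDensity P.R ρ₀)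
    (htv : totalVar ρ₀ ≠ ∞) (hl : IsLimit P G ρ₀ N h ρ) (t : ℝ) :
    ∫⁻ x, ‖ρ t x‖ₑ ≤ ENNReal.ofReal (∫ x, ρ₀ x) := by
  have hd : ∀ k, IsDensity P.R (apx P G ρ₀ (N k) (h k) t) :=
    fun k => apx_isDensity hP hρ htv (hm.N_pos k) (hm.mono k) t
  refine (hl.tendsto t).lintegral_le (fun k => (hd k).measurable) (hl.measurable_at t)
    (fun k => le_of_eq ?_) (ENNReal.tendsto_ofReal (hm.mass_tendsto' hP hρ htv))
  rw [← ofReal_integral_norm_eq_lintegral_enorm (hd k).integrable]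
  congr 1
  rw [← integral_sol hP (hm.N_pos k) (hm.mono k)
    (cellMean_isDensity hP (hm.N_pos k) hρ htv) ⌊t / P.dt (h k)⌋₊]
  exact integral_congr_ae (ae_of_all _ fun x => abs_of_nonneg ((hd k).mem x).1)

theorem isDensity (hP : P.Admissible) (hm : IsMeshSeq P G Λ N h) (hρ : IsDensity P.R ρ₀)
    (htv : totalVar ρ₀ ≠ ∞) (hl : IsLimit P G ρ₀ N h ρ) (t : ℝ) : IsDensity P.R (ρ t) :=
  ⟨hl.measurable_at t, ⟨(hl.measurable_at t).aestronglyMeasurable,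
    (hl.lintegral_le hP hm hρ htv t).trans_lt ENNReal.ofReal_lt_top⟩, hl.mem t⟩

/-- The cut-off which vanishes on `[-X, X]` and is `1` outside `[-2X, 2X]`. -/
noncomputable def _root_.DelayTraffic.cutoff (X x : ℝ) : ℝ := max 0 (min 1 (|x| / X - 1))

theorem _root_.DelayTraffic.cutoff_continuous (X : ℝ) : Continuous (cutoff X) := by
  unfold cutoff; fun_prop

theorem _root_.DelayTraffic.cutoff_mem (X x : ℝ) : cutoff X x ∈ Icc (0 : ℝ) 1 :=
  ⟨le_max_left _ _, max_le zero_le_one (min_le_left _ _)⟩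

theorem _root_.DelayTraffic.cutoff_lipschitz {X : ℝ} (hX : 0 < X) (x y : ℝ) :
    |cutoff X x - cutoff X y| ≤ 1 / X * |x - y| := by
  refine (abs_max_sub_max_le_max _ _ _ _).trans (max_le (by simp; positivity) ?_)
  refine (abs_min_sub_min_le_max _ _ _ _).trans (max_le (by simp; positivity) ?_)
  rw [sub_sub_sub_cancel_right, ← sub_div, abs_div, abs_of_pos hX, one_div_mul_eq_div]
  exact div_le_div_of_nonneg_right (abs_abs_sub_abs_le x y) hX.le

theorem _root_.DelayTraffic.cutoff_eq_one {X x : ℝ} (hX : 0 < X) (hx : 2 * X ≤ |x|) :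
    cutoff X x = 1 := by
  have : 1 ≤ |x| / X - 1 := by rw [le_sub_iff_add_le, le_div_iff₀ hX]; linarith
  simp [cutoff, min_eq_left this]

theorem _root_.DelayTraffic.cutoff_eq_zero {X x : ℝ} (hX : 0 < X) (hx : |x| ≤ X) :
    cutoff X x = 0 := by
  have : |x| / X - 1 ≤ 0 := by rw [sub_nonpos, div_le_one hX]; exact hx
  simp [cutoff, (min_le_right _ _).trans this]

/-- Local convergence controls the mass in `[-2X, 2X]`. The mass outside is at most the integral
against the cut-off, which grows in time at rate at most `(β + V) / X` times the mass, because the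
cut-off is `1 / X`-Lipschitz. -/
theorem mass_le (hP : P.Admissible) (hm : IsMeshSeq P G Λ N h) (hρ : IsDensity P.R ρ₀)
    (htv : totalVar ρ₀ ≠ ∞) (hl : IsLimit P G ρ₀ N h ρ) (t : ℝ) {X : ℝ} (hX : 0 < X) :
    ∫ x, ρ₀ x ≤ (∫ x, ρ t x) + ((∫ x, ρ₀ x * cutoff X x)
      + max t 0 * (1 / X * ((G.β + P.V) * ∫ x, ρ₀ x))) := by
  have hρt := hl.isDensity hP hm hρ htv t
  have hd : ∀ k, IsDensity P.R (apx P G ρ₀ (N k) (h k) t) :=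
    fun k => apx_isDensity hP hρ htv (hm.N_pos k) (hm.mono k) t
  have hc1 : ∀ x, |cutoff X x| ≤ 1 := fun x => by
    rw [abs_of_nonneg (cutoff_mem X x).1]; exact (cutoff_mem X x).2
  set S := Icc (-(2 * X)) (2 * X)
  have bound : ∀ k, ∫ x, lift (P.dx (N k)) (P.cellMean (N k) ρ₀) x
      ≤ (∫ x in S, apx P G ρ₀ (N k) (h k) t x)
        + ((∫ x, lift (P.dx (N k)) (P.cellMean (N k) ρ₀) x * cutoff X x)
        + max t 0 * (1 / X * ((G.β + P.V) *
          ∫ x, lift (P.dx (N k)) (P.cellMean (N k) ρ₀) x))) := by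
    intro k
    have h0 := cellMean_isDensity hP (hm.N_pos k) hρ htv
    have h1 := integral_sol_mul_le hP (hm.N_pos k) (hm.mono k) h0
      (cutoff_continuous X).measurable hc1 (cutoff_lipschitz hX) ⌊t / P.dt (h k)⌋₊
    rw [← integral_sol hP (hm.N_pos k) (hm.mono k) h0 ⌊t / P.dt (h k)⌋₊] at h1 ⊢
    have h2 : ∫ x, apx P G ρ₀ (N k) (h k) t x ≤ (∫ x in S, apx P G ρ₀ (N k) (h k) t x)
        + ∫ x, apx P G ρ₀ (N k) (h k) t x * cutoff X x := by
      have i1 : Integrable fun x => apx P G ρ₀ (N k) (h k) t x * cutoff X x :=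
        (hd k).integrable.mul_bdd (c := 1) (cutoff_continuous X).aestronglyMeasurable
          (ae_of_all _ hc1)
      rw [← integral_indicator measurableSet_Icc,
        ← integral_add ((hd k).integrable.indicator measurableSet_Icc) i1]
      refine integral_mono (hd k).integrable
        (((hd k).integrable.indicator measurableSet_Icc).add i1) fun x => ?_
      by_cases hx : x ∈ S
      · refine le_of_le_of_eq ?_ (congrArg (· + apx P G ρ₀ (N k) (h k) t x * cutoff X x)
          (indicator_of_mem hx _).symm)
        exact le_add_of_nonneg_right (mul_nonneg ((hd k).mem x).1 (cutoff_mem X x).1)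
      · refine le_of_le_of_eq ?_ (congrArg (· + apx P G ρ₀ (N k) (h k) t x * cutoff X x)
          (indicator_of_notMem hx _).symm)
        rw [zero_add, cutoff_eq_one hX, mul_one]
        by_contra! hc
        exact hx (abs_le.1 hc.le)
    have h3 : ⌊t / P.dt (h k)⌋₊ * P.dt (h k) * (1 / X * ((G.β + P.V) *
        ∫ x, sol P G (N k) (h k) (P.cellMean (N k) ρ₀) ⌊t / P.dt (h k)⌋₊ x))
        ≤ max t 0 * (1 / X * ((G.β + P.V) *
        ∫ x, sol P G (N k) (h k) (P.cellMean (N k) ρ₀) ⌊t / P.dt (h k)⌋₊ x)) := by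
      refine mul_le_mul_of_nonneg_right (floor_mul_dt_le hP (hm.h_pos k) t) ?_
      exact mul_nonneg (by positivity) (mul_nonneg (add_nonneg (hm.mono k).β_nonneg hP.V_pos.le)
        (integral_nonneg fun x => ((hd k).mem x).1))
    unfold apx at h2 ⊢
    linarith
  have lim1 : Tendsto (fun k => ∫ x in S, apx P G ρ₀ (N k) (h k) t x) atTop
      (𝓝 (∫ x in S, ρ t x)) :=
    tendsto_integral_of_L1 _ hρt.measurable.aestronglyMeasurable
      (Eventually.of_forall fun k => (hd k).integrable.integrableOn) (hl.tendsto t (2 * X))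
  have lim2 := hm.mass_tendsto hP hρ htv (cutoff_continuous X).measurable hc1
  have lim3 := (((hm.mass_tendsto' hP hρ htv).const_mul (G.β + P.V)).const_mul (1 / X)).const_mul
    (max t 0)
  refine (le_of_tendsto_of_tendsto' (hm.mass_tendsto' hP hρ htv)
    (lim1.add (lim2.add lim3)) bound).trans ?_
  exact add_le_add (setIntegral_le_integral hρt.integrable
    (ae_of_all _ fun x => (hl.mem t x).1)) le_rfl

/-- Lower semicontinuity gives one inequality, and the tail bound with `X → ∞` gives the other. -/
theorem mass_eq (hP : P.Admissible) (hm : IsMeshSeq P G Λ N h) (hρ : IsDensity P.R ρ₀)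
    (htv : totalVar ρ₀ ≠ ∞) (hl : IsLimit P G ρ₀ N h ρ) (t : ℝ) : ∫ x, ρ t x = ∫ x, ρ₀ x := by
  have hρt := hl.isDensity hP hm hρ htv t
  have h0 : 0 ≤ ∫ x, ρ₀ x := integral_nonneg fun x => (hρ.mem x).1
  refine le_antisymm ?_ ?_
  · have h1 := hl.lintegral_le hP hm hρ htv t
    rw [← ofReal_integral_norm_eq_lintegral_enorm hρt.integrable] at h1
    refine le_trans (le_of_eq (integral_congr_ae (ae_of_all _ fun x => ?_)))
      ((ENNReal.ofReal_le_ofReal_iff h0).1 h1)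
    exact (abs_of_nonneg (hl.mem t x).1).symm
  · have lim1 : Tendsto (fun n : ℕ => ∫ x, ρ₀ x * cutoff ((n : ℝ) + 1) x) atTop (𝓝 0) := by
      rw [← integral_zero ℝ ℝ (μ := volume)]
      refine tendsto_integral_of_dominated_convergence ρ₀ (fun n => ?_) hρ.integrable
        (fun n => ae_of_all _ fun x => ?_) (ae_of_all _ fun x => ?_)
      · exact (hρ.measurable.mul (cutoff_continuous _).measurable).aestronglyMeasurable
      · rw [Real.norm_eq_abs, abs_mul, abs_of_nonneg (hρ.mem x).1,
          abs_of_nonneg (cutoff_mem _ x).1]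
        exact mul_le_of_le_one_right (hρ.mem x).1 (cutoff_mem _ x).2
      · refine tendsto_const_nhds.congr' ?_
        obtain ⟨m, hm⟩ := exists_nat_ge |x|
        filter_upwards [eventually_ge_atTop m] with n hn
        rw [cutoff_eq_zero (by positivity), mul_zero]
        have : (m : ℝ) ≤ n := by exact_mod_cast hn
        linarith
    have lim2 : Tendsto (fun n : ℕ => max t 0 * (1 / ((n : ℝ) + 1) *
        ((G.β + P.V) * ∫ x, ρ₀ x))) atTop (𝓝 0) := by
      simpa using ((tendsto_one_div_add_atTop_nhds_zero_nat (𝕜 := ℝ)).mul_const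
        ((G.β + P.V) * ∫ x, ρ₀ x)).const_mul (max t 0)
    have lim3 := (lim1.add lim2).const_add (∫ x, ρ t x)
    rw [add_zero, add_zero] at lim3
    exact ge_of_tendsto' lim3 fun n => hl.mass_le hP hm hρ htv t (by positivity)

/-- Only `β ≤ α` is required, so that the scheme without viscosity satisfies the same Lipschitz
bound. -/
theorem estimates (hP : P.Admissible) (hm : IsMeshSeq P G Λ N h) (hρ : IsDensity P.R ρ₀)
    (htv : totalVar ρ₀ ≠ ∞) (hl : IsLimit P G ρ₀ N h ρ) {α : ℝ} (hα : G.β ≤ α) (T : ℝ) :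
    P.Estimates α T ρ₀ ρ where
  mem_Icc t _ := ae_of_all _ (hl.mem t)
  integrable t _ := (hl.isDensity hP hm hρ htv t).integrable
  norm_eq t _ := by
    have e1 : ∀ x, |ρ t x| = ρ t x := fun x => abs_of_nonneg (hl.mem t x).1
    have e2 : ∀ x, |ρ₀ x| = ρ₀ x := fun x => abs_of_nonneg (hρ.mem x).1
    simp only [e1, e2, hl.mass_eq hP hm hρ htv t]
  totalVar_le t ht := by
    have hρt := hl.isDensity hP hm hρ htv t
    have hg : 0 ≤ P.growth t := zero_le_one.trans (hP.one_le_growth ht.1)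
    rw [← ENNReal.ofReal_toReal htv, ← ENNReal.ofReal_mul hg]
    refine totalVar_le_of_incr_le hρt.integrable fun a ha => ?_
    have h1 := hl.lincr_le hP hm hρ htv t ha
    rw [lincr_eq_ofReal_incr (hρt.integrable.incr a), max_eq_left ht.1] at h1
    exact (ENNReal.ofReal_le_ofReal_iff
      (mul_nonneg (mul_nonneg hg ENNReal.toReal_nonneg) ha.le)).1 h1
  lipschitz s hs t ht := by
    have hi := (hl.isDensity hP hm hρ htv s).integrable.sub
      (hl.isDensity hP hm hρ htv t).integrable
    have h1 := hl.dist_le hP hm hρ htv s t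
    have h2 := ofReal_integral_norm_eq_lintegral_enorm hi
    simp only [Pi.sub_apply] at h2
    have hm0 : 0 ≤ ∫ x, ρ₀ x := integral_nonneg fun x => (hρ.mem x).1
    rw [← h2, ENNReal.ofReal_le_ofReal_iff (mul_nonneg
      (timeLip_nonneg hP (hm.mono 0).β_nonneg hm0 _) (abs_nonneg _))] at h1
    refine h1.trans (mul_le_mul_of_nonneg_right ?_ (abs_nonneg _))
    have e2 : ∀ x, |ρ₀ x| = ρ₀ x := fun x => abs_of_nonneg (hρ.mem x).1
    simp only [timeLip, Model.K, e2]
    have hmx : max s t ≤ T := max_le hs.2 ht.2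
    have h0 : 0 ≤ max s t := hs.1.trans (le_max_left _ _)
    have hc := speedCoeff_nonneg hP (hm.mono 0).β_nonneg
    have hgT := zero_le_one.trans (hP.one_le_growth (h0.trans hmx))
    rw [max_eq_left h0]
    have hg := hP.growth_mono h0 hmx
    have hg0 := zero_le_one.trans (hP.one_le_growth h0)
    have hα' : 0 ≤ α + (1 + P.R * P.normF') * P.V := hc.trans (by linarith)
    gcongr

theorem tendstoL1Loc (hP : P.Admissible) (hm : IsMeshSeq P G Λ N h) (hρ : IsDensity P.R ρ₀)
    (htv : totalVar ρ₀ ≠ ∞) (hl : IsLimit P G ρ₀ N h ρ) (T : ℝ) :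
    TendstoL1Loc T (fun k => apx P G ρ₀ (N k) (h k)) ρ := by
  intro X
  have hmeas : ∀ k, Measurable fun z : ℝ × ℝ => ‖apx P G ρ₀ (N k) (h k) z.1 z.2 - ρ z.1 z.2‖ₑ :=
    fun k => ((apx_measurable (N k) (h k)).sub hl.measurable).enorm
  have e : ∀ k, ∫⁻ z in Icc 0 T ×ˢ Icc (-X) X, ‖apx P G ρ₀ (N k) (h k) z.1 z.2 - ρ z.1 z.2‖ₑ
      = ∫⁻ t in Icc 0 T, ∫⁻ x in Icc (-X) X, ‖apx P G ρ₀ (N k) (h k) t x - ρ t x‖ₑ := by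
    intro k
    rw [Measure.volume_eq_prod, ← Measure.prod_restrict, lintegral_prod _ (hmeas k).aemeasurable]
  simp only [e]
  rw [← lintegral_zero (μ := (volume : Measure ℝ).restrict (Icc 0 T))]
  refine tendsto_lintegral_of_dominated_convergence
    (fun _ => ∫⁻ _ in Icc (-X) X, ENNReal.ofReal (P.R + P.R)) (fun k => ?_) (fun k => ?_) ?_ ?_
  · exact (hmeas k).lintegral_prod_right'
  · refine ae_of_all _ fun t => lintegral_mono fun x => ?_
    rw [Real.enorm_eq_ofReal_abs]
    refine ENNReal.ofReal_le_ofReal ((abs_sub _ _).trans (add_le_add ?_ ?_))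
    · exact (apx_isDensity hP hρ htv (hm.N_pos k) (hm.mono k) t).abs_le x
    · exact (hl.isDensity hP hm hρ htv t).abs_le x
  · simp only [setLIntegral_const]
    exact ENNReal.mul_ne_top (ENNReal.mul_ne_top ENNReal.ofReal_ne_top measure_Icc_lt_top.ne)
      measure_Icc_lt_top.ne
  · exact ae_of_all _ fun t => hl.tendsto t X

theorem integrable_uncurry (hP : P.Admissible) (hm : IsMeshSeq P G Λ N h)
    (hρ : IsDensity P.R ρ₀) (htv : totalVar ρ₀ ≠ ∞) (hl : IsLimit P G ρ₀ N h ρ) (T : ℝ) :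
    Integrable (Function.uncurry ρ) (volume.restrict (Icc 0 T ×ˢ univ)) := by
  refine ⟨hl.measurable.aestronglyMeasurable, ?_⟩
  rw [HasFiniteIntegral, Measure.volume_eq_prod, ← Measure.prod_restrict,
    lintegral_prod _ hl.measurable.enorm.aemeasurable, Measure.restrict_univ]
  refine (lintegral_mono (g := fun _ => ENNReal.ofReal (∫ x, ρ₀ x))
    fun t => hl.lintegral_le hP hm hρ htv t).trans_lt ?_
  rw [setLIntegral_const]
  exact ENNReal.mul_lt_top ENNReal.ofReal_lt_top measure_Icc_lt_top

end IsLimit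

end DelayTraffic

/-! ### Convergence of the discrete speeds and of their difference quotients. -/

namespace DelayTraffic

variable {P : Model} {u w : ℝ → ℝ}

/-! ### The non-local speed -/

namespace Model.Admissible

theorem intervalIntegrable_mul_ω (hP : P.Admissible) (hu : Measurable u) {B : ℝ}
    (hB : ∀ x, |u x| ≤ B) {a b : ℝ} (ha : a ∈ Icc 0 P.L) (hb : b ∈ Icc 0 P.L) (x : ℝ) :
    IntervalIntegrable (fun y => u (x + y) * P.ω y) volume a b := by
  have h1 := hP.ω_intervalIntegrable ha hb
  refine (h1.const_mul B).mono_fun ?_ (ae_of_all _ fun y => ?_)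
  · exact (by fun_prop : Measurable fun y => u (x + y)).aestronglyMeasurable.mul
      h1.aestronglyMeasurable_restrict_uIoc
  · simp only [norm_mul, Real.norm_eq_abs]
    exact mul_le_mul_of_nonneg_right ((hB _).trans (le_abs_self B)) (abs_nonneg _)

theorem enorm_integral_mul_ω_le (hP : P.Admissible) (e : ℝ → ℝ) :
    ‖∫ y in (0 : ℝ)..P.L, e y * P.ω y‖ₑ
      ≤ ENNReal.ofReal P.normω * ∫⁻ y in Icc 0 P.L, ‖e y‖ₑ := by
  rw [intervalIntegral.integral_of_le hP.L_pos.le, ← integral_Icc_eq_integral_Ioc,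
    ← lintegral_const_mul' _ _ ENNReal.ofReal_ne_top]
  refine (enorm_integral_le_lintegral_enorm _).trans
    (setLIntegral_mono' measurableSet_Icc fun y hy => ?_)
  rw [enorm_mul, mul_comm, Real.enorm_of_nonneg (hP.ω_nonneg y hy)]
  gcongr
  exact hP.ω_le hy

theorem enorm_conv_sub_le (hP : P.Admissible) (hu : IsDensity P.R u) (hw : IsDensity P.R w)
    (x y : ℝ) : ‖P.conv u x - P.conv w y‖ₑ
      ≤ ENNReal.ofReal P.normω * ∫⁻ s in Icc 0 P.L, ‖u (x + s) - w (y + s)‖ₑ := by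
  have h0 : (0 : ℝ) ∈ Icc 0 P.L := ⟨le_rfl, hP.L_pos.le⟩
  have hL : P.L ∈ Icc 0 P.L := ⟨hP.L_pos.le, le_rfl⟩
  unfold Model.conv
  rw [← intervalIntegral.integral_sub (hP.intervalIntegrable_mul_ω hu.measurable hu.abs_le h0 hL x)
    (hP.intervalIntegrable_mul_ω hw.measurable hw.abs_le h0 hL y)]
  simp only [← sub_mul]
  exact hP.enorm_integral_mul_ω_le fun s => u (x + s) - w (y + s)

theorem conv_mem (hP : P.Admissible) (hu : IsDensity P.R u) (x : ℝ) :
    P.conv u x ∈ Icc 0 P.R := by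
  have h0 : (0 : ℝ) ∈ Icc 0 P.L := ⟨le_rfl, hP.L_pos.le⟩
  have hL : P.L ∈ Icc 0 P.L := ⟨hP.L_pos.le, le_rfl⟩
  refine ⟨intervalIntegral.integral_nonneg hP.L_pos.le fun y hy =>
    mul_nonneg (hu.mem _).1 (hP.ω_nonneg y hy), ?_⟩
  calc P.conv u x ≤ ∫ y in (0 : ℝ)..P.L, P.R * P.ω y :=
        intervalIntegral.integral_mono_on hP.L_pos.le
          (hP.intervalIntegrable_mul_ω hu.measurable hu.abs_le h0 hL x)
          ((hP.ω_intervalIntegrable h0 hL).const_mul _)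
          fun y hy => mul_le_mul_of_nonneg_right (hu.mem _).2 (hP.ω_nonneg y hy)
    _ = P.R := by rw [intervalIntegral.integral_const_mul, hP.ω_integral, mul_one]

theorem abs_conv_sub_le (hP : P.Admissible) (hu : IsDensity P.R u) {C : ℝ} (hC0 : 0 ≤ C)
    (hC : ∀ a, 0 < a → lincr u a ≤ ENNReal.ofReal (C * a)) (x y : ℝ) :
    |P.conv u x - P.conv u y| ≤ P.normω * C * |x - y| := by
  wlog hxy : y < x generalizing x y
  · rcases eq_or_lt_of_le (not_lt.1 hxy) with rfl | h
    · simp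
    · rw [abs_sub_comm, abs_sub_comm x]; exact this y x h
  have h1 := hP.enorm_conv_sub_le hu hu x y
  have h2 : ∫⁻ s in Icc 0 P.L, ‖u (x + s) - u (y + s)‖ₑ ≤ lincr u (x - y) := by
    refine (setLIntegral_le_lintegral _ _).trans (le_of_eq ?_)
    rw [lincr, ← lintegral_add_right_eq_self (fun s => ‖u (s + (x - y)) - u s‖ₑ) y]
    refine lintegral_congr fun s => ?_
    rw [show s + y + (x - y) = x + s by ring, add_comm y s]
  have h3 := h1.trans (mul_le_mul_right (h2.trans (hC _ (sub_pos.2 hxy))) _)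
  rw [← ENNReal.ofReal_mul normω_nonneg, Real.enorm_eq_ofReal_abs, ENNReal.ofReal_le_ofReal_iff
    (mul_nonneg normω_nonneg (mul_nonneg hC0 (sub_pos.2 hxy).le))] at h3
  rwa [abs_of_pos (sub_pos.2 hxy), mul_assoc]

/-- For a piecewise constant density there is no quadrature error: with the base point at the left
end of a cell, the density is constant while the kernel variable runs through a cell, and kernel
means are exact. -/
theorem avg_lift (hP : P.Admissible) {N : ℕ} (hN : 0 < N) {q : ℤ → ℝ}
    (hq : IsDensity P.R (lift (P.dx N) q)) (x : ℝ) :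
    P.avg N (lift (P.dx N) q) x
      = P.conv (lift (P.dx N) q) (⌊x / P.dx N⌋ * P.dx N) := by
  have hd := hP.dx_pos hN
  have hsum := intervalIntegral.sum_integral_adjacent_intervals
    (f := fun y => lift (P.dx N) q (⌊x / P.dx N⌋ * P.dx N + y) * P.ω y) (μ := volume)
    (a := fun k : ℕ => k * P.dx N) (n := N) fun k hk =>
      hP.intervalIntegrable_mul_ω hq.measurable hq.abs_le (hP.node_mem hN hk.le)
        (hP.node_mem hN hk) _
  simp only [Nat.cast_zero, zero_mul, mul_dx hN] at hsum
  rw [Model.conv, ← hsum, Model.avg, Finset.mul_sum]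
  refine Finset.sum_congr rfl fun k hk => ?_
  have hle : (k : ℝ) * P.dx N ≤ (k + 1) * P.dx N := by nlinarith
  have e : ∫ y in (k * P.dx N)..((k + 1 : ℕ) * P.dx N),
      lift (P.dx N) q (⌊x / P.dx N⌋ * P.dx N + y) * P.ω y
      = ∫ y in (k * P.dx N)..((k + 1) * P.dx N), lift (P.dx N) q (x + k * P.dx N) * P.ω y := by
    push_cast
    -- The endpoints are discarded because the density already takes the value of the next cell at
    -- the right one.
    rw [intervalIntegral.integral_of_le hle, intervalIntegral.integral_of_le hle,
      integral_Ioc_eq_integral_Ioo, integral_Ioc_eq_integral_Ioo]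
    refine setIntegral_congr_fun measurableSet_Ioo fun y hy => ?_
    simp only [lift]
    rw [floor_add_nat_mul_div hd, (floor_div_eq_iff hd _ (⌊x / P.dx N⌋ + k)).2]
    push_cast
    constructor <;> nlinarith [hy.1, hy.2]
  rw [e, intervalIntegral.integral_const_mul, kernelMean]
  field_simp

theorem abs_speed_sub_le (hP : P.Admissible) (hu : IsDensity P.R u) {C : ℝ} (hC0 : 0 ≤ C)
    (hC : ∀ a, 0 < a → lincr u a ≤ ENNReal.ofReal (C * a)) (x y : ℝ) :
    |P.speed u x - P.speed u y| ≤ P.normV' * (P.normω * C) * |x - y| := by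
  refine (hP.v_abs_sub_le (hP.conv_mem hu x) (hP.conv_mem hu y)).trans ?_
  rw [mul_assoc]
  exact mul_le_mul_of_nonneg_left (hP.abs_conv_sub_le hu hC0 hC x y) normV'_nonneg

theorem measurable_vel_uncurry (hP : P.Admissible) {N : ℕ} (hN : 0 < N) {u : ℝ → ℝ → ℝ}
    (hu : Measurable (Function.uncurry u)) (hm : ∀ t x, u t x ∈ Icc 0 P.R) :
    Measurable fun z : ℝ × ℝ => P.vel N (u z.1) z.2 := by
  refine hP.v_comp_measurable ?_ fun z => hP.avg_mem hN (hm z.1) z.2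
  have : ∀ k : ℕ, Measurable fun z : ℝ × ℝ => u z.1 (z.2 + k * P.dx N) := fun k =>
    hu.comp (measurable_fst.prodMk (measurable_snd.add_const _))
  unfold Model.avg
  fun_prop

end Model.Admissible

theorem abs_floor_mul_sub_le {d : ℝ} (hd : 0 < d) (x : ℝ) : |⌊x / d⌋ * d - x| ≤ d := by
  have h := (floor_div_eq_iff hd x ⌊x / d⌋).1 rfl
  rw [abs_le]; constructor <;> nlinarith [h.1, h.2]

/-- A sequence of piecewise constant densities of uniformly bounded variation, with its limit. -/
structure IsLiftLimit (P : Model) (N : ℕ → ℕ) (C : ℝ) (w : ℕ → ℝ → ℝ) (r : ℝ → ℝ) : Prop where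
  N_pos : ∀ k, 0 < N k
  dx_tendsto : Tendsto (fun k => P.dx (N k)) atTop (𝓝 0)
  C_nonneg : 0 ≤ C
  isLift : ∀ k, ∃ q, w k = lift (P.dx (N k)) q
  isDensity : ∀ k, IsDensity P.R (w k)
  lincr_le : ∀ k a, 0 < a → lincr (w k) a ≤ ENNReal.ofReal (C * a)
  isDensity_limit : IsDensity P.R r
  tendsto : L1Loc w r

namespace IsLiftLimit

variable {N : ℕ → ℕ} {C : ℝ} {w : ℕ → ℝ → ℝ} {r : ℝ → ℝ}

theorem conv_tendsto (hP : P.Admissible) (h : IsLiftLimit P N C w r) (x : ℝ) :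
    Tendsto (fun k => P.conv (w k) x) atTop (𝓝 (P.conv r x)) := by
  rw [tendsto_iff_edist_tendsto_0]
  have h1 := ENNReal.Tendsto.const_mul (a := ENNReal.ofReal P.normω)
    (h.tendsto.comp_add x P.L) (Or.inr ENNReal.ofReal_ne_top)
  rw [mul_zero] at h1
  refine tendsto_of_tendsto_of_tendsto_of_le_of_le tendsto_const_nhds h1 (fun _ => zero_le)
    fun k => ?_
  rw [edist_eq_enorm_sub]
  refine (hP.enorm_conv_sub_le (h.isDensity k) h.isDensity_limit x x).trans
    (mul_le_mul_right ?_ _)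
  simp only [add_comm x]
  exact lintegral_mono_set (Icc_subset_Icc (by linarith [hP.L_pos]) le_rfl)

theorem avg_eq (hP : P.Admissible) (h : IsLiftLimit P N C w r) (k : ℕ) (x : ℝ) :
    P.avg (N k) (w k) x = P.conv (w k) (⌊x / P.dx (N k)⌋ * P.dx (N k)) := by
  obtain ⟨q, hq⟩ := h.isLift k
  have := h.isDensity k
  rw [hq] at this ⊢
  exact hP.avg_lift (h.N_pos k) this x

theorem abs_vel_sub_speed_le (hP : P.Admissible) (h : IsLiftLimit P N C w r) (k : ℕ) (x : ℝ) :
    |P.vel (N k) (w k) x - P.speed (w k) x|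
      ≤ P.normV' * (P.normω * C) * P.dx (N k) := by
  have hk := h.isDensity k
  unfold Model.vel
  rw [h.avg_eq hP]
  refine (hP.abs_speed_sub_le hk h.C_nonneg (h.lincr_le k) _ x).trans ?_
  exact mul_le_mul_of_nonneg_left (abs_floor_mul_sub_le (hP.dx_pos (h.N_pos k)) x)
    (mul_nonneg Model.normV'_nonneg (mul_nonneg Model.normω_nonneg h.C_nonneg))

theorem speed_tendsto (hP : P.Admissible) (h : IsLiftLimit P N C w r) (x : ℝ) :
    Tendsto (fun k => P.speed (w k) x) atTop (𝓝 (P.speed r x)) := by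
  have h1 := hP.v_continuousOn (P.conv r x) (hP.conv_mem h.isDensity_limit x)
  exact h1.tendsto.comp (tendsto_nhdsWithin_iff.2 ⟨h.conv_tendsto hP x,
    Eventually.of_forall fun k => hP.conv_mem (h.isDensity k) x⟩)

theorem abs_sub_speed_le (hP : P.Admissible) (h : IsLiftLimit P N C w r) (k : ℕ) (x y : ℝ) :
    |P.vel (N k) (w k) x - P.speed (w k) y|
      ≤ P.normV' * (P.normω * C) * (P.dx (N k) + |x - y|) := by
  rw [mul_add]
  exact (abs_sub_le _ (P.speed (w k) x) _).trans (add_le_add (h.abs_vel_sub_speed_le hP k x)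
    (hP.abs_speed_sub_le (h.isDensity k) h.C_nonneg (h.lincr_le k) x y))

/-- The discrete speeds converge, also along vanishing shifts. -/
theorem vel_tendsto (hP : P.Admissible) (h : IsLiftLimit P N C w r) {x : ℝ} {y : ℕ → ℝ}
    (hy : Tendsto y atTop (𝓝 x)) :
    Tendsto (fun k => P.vel (N k) (w k) (y k)) atTop (𝓝 (P.speed r x)) := by
  have h1 : Tendsto (fun k => P.normV' * (P.normω * C) * (P.dx (N k) + |y k - x|)) atTop (𝓝 0) := by
    have := (h.dx_tendsto.add (hy.sub_const x).abs).const_mul (P.normV' * (P.normω * C))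
    simpa using this
  have h2 := squeeze_zero (fun k => abs_nonneg _) (fun k => h.abs_sub_speed_le hP k (y k) x) h1
  have h3 := ((tendsto_zero_iff_abs_tendsto_zero _).2 h2).add (h.speed_tendsto hP x)
  simpa using h3

/-- The difference quotients of the discrete speeds. -/
noncomputable def _root_.DelayTraffic.quot (P : Model) (N : ℕ) (w : ℝ → ℝ) (x : ℝ) : ℝ :=
  (P.vel N w (x + P.dx N) - P.vel N w x) / P.dx N

theorem _root_.DelayTraffic.abs_quot_le (hP : P.Admissible) {N : ℕ} (hN : 0 < N) {w : ℝ → ℝ}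
    (hw : IsDensity P.R w) (x : ℝ) : |quot P N w x| ≤ 2 * P.normω * P.R * P.normV' := by
  rw [quot, abs_div, abs_of_pos (hP.dx_pos hN), div_le_iff₀ (hP.dx_pos hN)]
  exact hP.abs_vel_increment_le hN hw x

theorem _root_.DelayTraffic.quot_measurable (hP : P.Admissible) {N : ℕ} (hN : 0 < N) {w : ℝ → ℝ}
    (hw : IsDensity P.R w) : Measurable (quot P N w) := by
  have := hP.vel_measurable hN hw
  unfold quot
  fun_prop

theorem _root_.DelayTraffic.curv_nonneg (hP : P.Admissible) : 0 ≤ P.curv := by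
  have := hP.R_pos
  have := Model.normω_nonneg (P := P)
  have := Model.normV'_nonneg (P := P)
  have := Model.normV''_nonneg (P := P)
  unfold Model.curv
  positivity

/-- Increments of the difference quotient over one cell are second differences of the speed divided
by the cell size. As the quotient is piecewise constant, this one step controls all others. -/
theorem lincr_quot_le (hP : P.Admissible) (h : IsLiftLimit P N C w r) (k : ℕ) {a : ℝ}
    (ha : 0 < a) : lincr (quot P (N k) (w k)) a ≤ ENNReal.ofReal (P.curv * C * a) := by
  have hd := hP.dx_pos (h.N_pos k)
  have hw := h.isDensity k
  obtain ⟨q, hq⟩ := h.isLift k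
  have e : quot P (N k) (w k) = lift (P.dx (N k)) fun j =>
      (P.cellSpeed (N k) q (j + 1) - P.cellSpeed (N k) q j) / P.dx (N k) := by
    ext x
    rw [quot, hq, vel_lift hP (h.N_pos k), vel_lift hP (h.N_pos k), floor_add_div hd, lift]
  have h1 : lincr (quot P (N k) (w k)) (P.dx (N k))
      ≤ ENNReal.ofReal (P.curv * C * P.dx (N k)) := by
    have e2 : ∀ x, quot P (N k) (w k) (x + P.dx (N k)) - quot P (N k) (w k) x
        = (1 / P.dx (N k)) * ((P.vel (N k) (w k) (x + P.dx (N k) + P.dx (N k))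
          - P.vel (N k) (w k) (x + P.dx (N k)))
          - (P.vel (N k) (w k) (x + P.dx (N k)) - P.vel (N k) (w k) x)) := fun x => by
      unfold quot; ring
    have hi := hP.vel_increment_integrable (h.N_pos k) hw (P.dx (N k))
    have hi2 : Integrable fun x => quot P (N k) (w k) (x + P.dx (N k)) - quot P (N k) (w k) x := by
      simp only [e2]
      exact (hi.incr (P.dx (N k))).const_mul _
    rw [lincr_eq_ofReal_incr hi2]
    refine ENNReal.ofReal_le_ofReal ?_
    have h2 : incr (quot P (N k) (w k)) (P.dx (N k)) = (1 / P.dx (N k)) *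
        incr (fun x => P.vel (N k) (w k) (x + P.dx (N k)) - P.vel (N k) (w k) x) (P.dx (N k)) := by
      unfold incr
      simp only [e2, abs_mul]
      rw [integral_const_mul, abs_of_pos (one_div_pos.2 hd)]
    have h3 := h.lincr_le k _ hd
    rw [lincr_eq_ofReal_incr (hw.integrable.incr _),
      ENNReal.ofReal_le_ofReal_iff (mul_nonneg h.C_nonneg hd.le)] at h3
    rw [h2]
    refine (mul_le_mul_of_nonneg_left ((hP.integral_abs_vel_second_le (h.N_pos k) hw).trans
      (mul_le_mul_of_nonneg_left h3 (mul_nonneg (curv_nonneg hP) hd.le)))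
      (one_div_pos.2 hd).le).trans (le_of_eq ?_)
    field_simp
  rw [e] at h1 ⊢
  refine (lincr_lift_le_self hd _ ha).trans ((mul_le_mul_right h1 _).trans (le_of_eq ?_))
  rw [← ENNReal.ofReal_mul (by positivity)]
  congr 1; field_simp

theorem mean_vel_tendsto (hP : P.Admissible) (h : IsLiftLimit P N C w r) (x : ℝ) :
    Tendsto (fun k => (∫ s in x..(x + P.dx (N k)), P.vel (N k) (w k) s) / P.dx (N k)) atTop
      (𝓝 (P.speed r x)) := by
  set B := P.normV' * (P.normω * C) with hBdef
  have hB : 0 ≤ B := mul_nonneg Model.normV'_nonneg (mul_nonneg Model.normω_nonneg h.C_nonneg)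
  have h1 : Tendsto (fun k => B * (P.dx (N k) + P.dx (N k))) atTop (𝓝 0) := by
    simpa using (h.dx_tendsto.add h.dx_tendsto).const_mul B
  have h2 : ∀ k, |(∫ s in x..(x + P.dx (N k)), P.vel (N k) (w k) s) / P.dx (N k)
      - P.speed (w k) x| ≤ B * (P.dx (N k) + P.dx (N k)) := by
    intro k
    have hd := hP.dx_pos (h.N_pos k)
    have hi := intervalIntegrable_of_bound (hP.vel_measurable (h.N_pos k) (h.isDensity k))
      (B := P.V) (fun y => by
        have := hP.vel_mem (h.N_pos k) (h.isDensity k) y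
        rw [abs_of_nonneg this.1]; exact this.2) x (x + P.dx (N k))
    have e : (∫ s in x..(x + P.dx (N k)), P.vel (N k) (w k) s) / P.dx (N k) - P.speed (w k) x
        = (∫ s in x..(x + P.dx (N k)), (P.vel (N k) (w k) s - P.speed (w k) x)) / P.dx (N k) := by
      rw [intervalIntegral.integral_sub hi intervalIntegrable_const,
        intervalIntegral.integral_const, smul_eq_mul]
      field_simp
      ring
    rw [e, abs_div, abs_of_pos hd, div_le_iff₀ hd]
    have := intervalIntegral.norm_integral_le_of_norm_le_const (a := x) (b := x + P.dx (N k))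
      (f := fun s => P.vel (N k) (w k) s - P.speed (w k) x)
      (C := B * (P.dx (N k) + P.dx (N k))) fun s hs => by
        refine (h.abs_sub_speed_le hP k s x).trans (mul_le_mul_of_nonneg_left ?_ hB)
        rw [uIoc_of_le (by linarith)] at hs
        rw [abs_of_nonneg (by linarith [hs.1])]
        linarith [hs.2]
    rwa [add_sub_cancel_left, abs_of_pos hd] at this
  have h3 := ((tendsto_zero_iff_abs_tendsto_zero _).2
    (squeeze_zero (fun k => abs_nonneg _) h2 h1)).add (h.speed_tendsto hP x)
  simpa using h3

/-- Integrating a difference quotient telescopes to the difference of the means of the speed over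
one cell length starting at `x` and at `0`. -/
theorem primitive_quot_tendsto (hP : P.Admissible) (h : IsLiftLimit P N C w r) (x : ℝ) :
    Tendsto (fun k => ∫ s in (0 : ℝ)..x, quot P (N k) (w k) s) atTop
      (𝓝 (P.speed r x - P.speed r 0)) := by
  refine ((h.mean_vel_tendsto hP x).sub (h.mean_vel_tendsto hP 0)).congr fun k => ?_
  have hb : ∀ y, |P.vel (N k) (w k) y| ≤ P.V := fun y => by
    have := hP.vel_mem (h.N_pos k) (h.isDensity k) y
    rw [abs_of_nonneg this.1]; exact this.2
  have hm := hP.vel_measurable (h.N_pos k) (h.isDensity k)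
  have hi := intervalIntegrable_of_bound hm hb
  have hi2 := intervalIntegrable_of_bound (u := fun y => P.vel (N k) (w k) (y + P.dx (N k)))
    (by fun_prop) (fun y => hb _)
  unfold quot
  rw [intervalIntegral.integral_div, intervalIntegral.integral_sub (hi2 _ _) (hi _ _),
    intervalIntegral.integral_comp_add_right, ← sub_div]
  congr 1
  rw [← intervalIntegral.integral_add_adjacent_intervals (hi x 0) (hi 0 (x + P.dx (N k))),
    ← intervalIntegral.integral_add_adjacent_intervals (hi (0 + P.dx (N k)) 0)
      (hi 0 (x + P.dx (N k))), intervalIntegral.integral_symm 0 x,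
    intervalIntegral.integral_symm 0 (0 + P.dx (N k))]
  ring

/-- The uniform bound on the discrete quotients survives in the limit of their primitives. The
constant does not involve the variation of the density and is thus uniform in time. -/
theorem abs_speed_limit_sub_le (hP : P.Admissible) (h : IsLiftLimit P N C w r) (x y : ℝ) :
    |P.speed r x - P.speed r y| ≤ 2 * P.normω * P.R * P.normV' * |x - y| := by
  have h1 := ((h.primitive_quot_tendsto hP x).sub (h.primitive_quot_tendsto hP y)).abs
  rw [sub_sub_sub_cancel_right] at h1
  exact le_of_tendsto' h1 fun k => abs_primitive_sub_le
    (quot_measurable hP (h.N_pos k) (h.isDensity k))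
    (abs_quot_le hP (h.N_pos k) (h.isDensity k)) x y

/-- The compactness lemma for primitives is applied to the difference quotients, which are bounded
and of uniformly bounded variation. -/
theorem quot_tendsto (hP : P.Admissible) (h : IsLiftLimit P N C w r) :
    L1Loc (fun k => quot P (N k) (w k)) (deriv (P.speed r)) := by
  have h1 := L1Loc.of_primitives
    (fun k => quot_measurable hP (h.N_pos k) (h.isDensity k))
    (fun k => abs_quot_le hP (h.N_pos k) (h.isDensity k))
    (mul_nonneg (curv_nonneg hP) h.C_nonneg) (fun k a ha => h.lincr_quot_le hP k ha)
    (h.primitive_quot_tendsto hP)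
  simpa only [deriv_sub_const_fun] using h1

end IsLiftLimit

end DelayTraffic

/-! ### Limits of integrals of nonlinear expressions in convergent sequences. -/

namespace DelayTraffic

/-! ### Convergence almost everywhere up to subsequences -/

/-- Every subsequence has a further subsequence which converges almost everywhere on `[-A, A]`. -/
def SubAE {E : Type*} [TopologicalSpace E] (A : ℝ) (u : ℕ → ℝ → E) (v : ℝ → E) : Prop :=
  ∀ σ : ℕ → ℕ, Tendsto σ atTop atTop → ∃ σ' : ℕ → ℕ, Tendsto σ' atTop atTop ∧
    ∀ᵐ x ∂volume.restrict (Icc (-A) A), Tendsto (fun k => u (σ (σ' k)) x) atTop (𝓝 (v x))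

theorem L1Loc.subAE {u : ℕ → ℝ → ℝ} {v : ℝ → ℝ} (h : L1Loc u v) (hu : ∀ k, Measurable (u k))
    (hv : Measurable v) (A : ℝ) : SubAE A u v := by
  intro σ hσ
  have h1 : TendstoInMeasure (volume.restrict (Icc (-A) A)) (fun k => u (σ k)) atTop v := by
    refine tendstoInMeasure_of_tendsto_eLpNorm one_ne_zero
      (fun k => (hu _).aestronglyMeasurable) hv.aestronglyMeasurable ?_
    simp only [eLpNorm_one_eq_lintegral_enorm, Pi.sub_apply]
    exact (h A).comp hσ
  obtain ⟨σ', hσ', h2⟩ := h1.exists_seq_tendsto_ae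
  exact ⟨σ', hσ'.tendsto_atTop, h2⟩

namespace SubAE

variable {E F : Type*} [TopologicalSpace E] [TopologicalSpace F] {A : ℝ}

theorem of_tendsto {u : ℕ → ℝ → E} {v : ℝ → E}
    (h : ∀ x, Tendsto (fun k => u k x) atTop (𝓝 (v x))) : SubAE A u v :=
  fun _ hσ => ⟨id, tendsto_id, ae_of_all _ fun x => (h x).comp hσ⟩

theorem prodMk {u : ℕ → ℝ → E} {v : ℝ → E} {u' : ℕ → ℝ → F} {v' : ℝ → F} (h : SubAE A u v)
    (h' : SubAE A u' v') : SubAE A (fun k x => (u k x, u' k x)) fun x => (v x, v' x) := by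
  intro σ hσ
  obtain ⟨σ₁, h1, h1'⟩ := h σ hσ
  obtain ⟨σ₂, h2, h2'⟩ := h' (σ ∘ σ₁) (hσ.comp h1)
  refine ⟨σ₁ ∘ σ₂, h1.comp h2, ?_⟩
  filter_upwards [h1', h2'] with x hx hx'
  exact (hx.comp h2).prodMk_nhds hx'

/-- Continuity is needed only at the values of the limit; this admits the sign function when the
limit almost never takes the critical value. -/
theorem comp_continuousAt {u : ℕ → ℝ → E} {v : ℝ → E} (h : SubAE A u v) {g : E → F}
    (hg : ∀ᵐ x ∂volume.restrict (Icc (-A) A), ContinuousAt g (v x)) :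
    SubAE A (fun k x => g (u k x)) fun x => g (v x) := by
  intro σ hσ
  obtain ⟨σ', h1, h2⟩ := h σ hσ
  refine ⟨σ', h1, ?_⟩
  filter_upwards [h2, hg] with x hx hgx
  exact hgx.tendsto.comp hx

theorem comp_continuous {u : ℕ → ℝ → E} {v : ℝ → E} (h : SubAE A u v) {g : E → F}
    (hg : Continuous g) : SubAE A (fun k x => g (u k x)) fun x => g (v x) :=
  h.comp_continuousAt (ae_of_all _ fun _ => hg.continuousAt)

theorem mul {u u' : ℕ → ℝ → ℝ} {v v' : ℝ → ℝ} (h : SubAE A u v) (h' : SubAE A u' v') :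
    SubAE A (fun k x => u k x * u' k x) fun x => v x * v' x :=
  (h.prodMk h').comp_continuous continuous_mul

/-- A sequence of numbers converges as soon as every subsequence has a further subsequence with the
right limit, and along those dominated convergence applies. -/
theorem integral_tendsto {u : ℕ → ℝ → ℝ} {v : ℝ → ℝ} (h : SubAE A u v)
    (hu : ∀ k, Measurable (u k)) {B : ℝ} (hB : ∀ k x, |u k x| ≤ B)
    (h0 : ∀ k x, A < |x| → u k x = 0) (h0' : ∀ x, A < |x| → v x = 0) :
    Tendsto (fun k => ∫ x, u k x) atTop (𝓝 (∫ x, v x)) := by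
  have e : ∀ {f : ℝ → ℝ}, (∀ x, A < |x| → f x = 0) → ∫ x in Icc (-A) A, f x = ∫ x, f x :=
    fun hf => setIntegral_eq_integral_of_forall_compl_eq_zero fun x hx => hf x (by
      by_contra! hc; exact hx (abs_le.1 hc))
  simp only [← e (h0 _), ← e h0']
  refine tendsto_of_subseq_tendsto fun σ hσ => ?_
  obtain ⟨σ', -, h2⟩ := h σ hσ
  refine ⟨σ', tendsto_integral_of_dominated_convergence (fun _ => B)
    (fun k => (hu _).aestronglyMeasurable) ?_ (fun k => ae_of_all _ fun x => hB _ x) h2⟩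
  exact integrableOn_const measure_Icc_lt_top.ne

end SubAE

/-! ### Bounded functions on the plane which vanish outside of a square -/

/-- Measurable functions bounded by `B` which vanish outside of `[-A, A]²`. -/
structure IsBoxed (A B : ℝ) (I : ℝ → ℝ → ℝ) : Prop where
  measurable : Measurable (Function.uncurry I)
  bound : ∀ t x, |I t x| ≤ B
  zero_fst : ∀ t x, A < |t| → I t x = 0
  zero_snd : ∀ t x, A < |x| → I t x = 0

namespace IsBoxed

variable {A B C : ℝ} {I J f : ℝ → ℝ → ℝ}

theorem bdd_mul (h : IsBoxed A B I) (hf : Measurable (Function.uncurry f))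
    (hC : ∀ t x, |f t x| ≤ C) : IsBoxed A (C * B) fun t x => f t x * I t x where
  measurable := hf.mul h.measurable
  bound t x := by
    rw [abs_mul]
    exact mul_le_mul (hC t x) (h.bound t x) (abs_nonneg _) ((abs_nonneg _).trans (hC t x))
  zero_fst t x ht := by rw [h.zero_fst t x ht, mul_zero]
  zero_snd t x hx := by rw [h.zero_snd t x hx, mul_zero]

theorem comp_add (h : IsBoxed A B I) {S a b : ℝ} (ha : |a| ≤ S) (hb : |b| ≤ S) :
    IsBoxed (A + S) B fun t x => I (t + a) (x + b) where
  measurable := h.measurable.comp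
    ((measurable_fst.add_const a).prodMk (measurable_snd.add_const b))
  bound t x := h.bound _ _
  zero_fst t x ht := h.zero_fst _ _ (by
    have := abs_sub_abs_le_abs_sub t (-a)
    rw [abs_neg, sub_neg_eq_add] at this
    linarith)
  zero_snd t x hx := h.zero_snd _ _ (by
    have := abs_sub_abs_le_abs_sub x (-b)
    rw [abs_neg, sub_neg_eq_add] at this
    linarith)

theorem measurable_at (h : IsBoxed A B I) (t : ℝ) : Measurable (I t) :=
  h.measurable.comp measurable_prodMk_left

theorem integrable (h : IsBoxed A B I) (t : ℝ) : Integrable (I t) := by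
  refine IntegrableOn.integrable_of_forall_notMem_eq_zero (s := Icc (-A) A) ?_ fun x hx => ?_
  · exact Measure.integrableOn_of_bounded measure_Icc_lt_top.ne
      (h.measurable_at t).aestronglyMeasurable (ae_of_all _ fun x => h.bound t x)
  · exact h.zero_snd t x (by by_contra! hc; exact hx (abs_le.1 hc))

theorem integrable_uncurry (h : IsBoxed A B I) :
    Integrable (Function.uncurry I) (volume.prod volume) := by
  refine IntegrableOn.integrable_of_forall_notMem_eq_zero (s := Icc (-A) A ×ˢ Icc (-A) A) ?_
    fun z hz => ?_
  · refine Measure.integrableOn_of_bounded (M := B) ?_ h.measurable.aestronglyMeasurable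
      (ae_of_all _ fun z => h.bound z.1 z.2)
    rw [Measure.prod_prod]
    exact ENNReal.mul_ne_top measure_Icc_lt_top.ne measure_Icc_lt_top.ne
  · by_cases h1 : z.1 ∈ Icc (-A) A
    · refine h.zero_snd z.1 z.2 ?_
      by_contra! hc; exact hz ⟨h1, abs_le.1 hc⟩
    · refine h.zero_fst z.1 z.2 ?_
      by_contra! hc; exact h1 (abs_le.1 hc)

theorem integrable_integral (h : IsBoxed A B I) : Integrable fun t => ∫ x, I t x :=
  h.integrable_uncurry.integral_prod_left

theorem abs_integral_le (h : IsBoxed A B I) (hA : 0 ≤ A) (t : ℝ) :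
    |∫ x, I t x| ≤ B * (2 * A) := by
  rw [← setIntegral_eq_integral_of_forall_compl_eq_zero (s := Icc (-A) A) fun x hx =>
    h.zero_snd t x (by by_contra! hc; exact hx (abs_le.1 hc))]
  refine (norm_setIntegral_le_of_norm_le_const measure_Icc_lt_top
    (f := I t) fun x _ => h.bound t x).trans (le_of_eq ?_)
  rw [measureReal_def, Real.volume_Icc, ENNReal.toReal_ofReal (by linarith)]
  ring

theorem of_tendsto {I : ℕ → ℝ → ℝ → ℝ} (hI : ∀ k, IsBoxed A B (I k))
    (h : ∀ t x, Tendsto (fun k => I k t x) atTop (𝓝 (J t x))) : IsBoxed A B J where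
  measurable := measurable_of_tendsto_metrizable (fun k => (hI k).measurable)
    (tendsto_pi_nhds.2 fun z => h z.1 z.2)
  bound t x := le_of_tendsto' (h t x).abs fun k => (hI k).bound t x
  zero_fst t x ht := tendsto_nhds_unique (h t x) (by
    simp only [(hI _).zero_fst t x ht, tendsto_const_nhds])
  zero_snd t x hx := tendsto_nhds_unique (h t x) (by
    simp only [(hI _).zero_snd t x hx, tendsto_const_nhds])

/-- Convergence of iterated integrals. -/
theorem integral_tendsto {I : ℕ → ℝ → ℝ → ℝ} (hA : 0 ≤ A) (hI : ∀ k, IsBoxed A B (I k))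
    (hJ : ∀ t x, A < |x| → J t x = 0) (S : Set ℝ)
    (h : ∀ᵐ t ∂volume.restrict S, SubAE A (fun k => I k t) (J t)) :
    Tendsto (fun k => ∫ t in S, ∫ x, I k t x) atTop (𝓝 (∫ t in S, ∫ x, J t x)) := by
  have hbound : ∀ k t, |∫ x, I k t x| ≤ (Icc (-A) A).indicator (fun _ => B * (2 * A)) t := by
    intro k t
    by_cases ht : t ∈ Icc (-A) A
    · rw [indicator_of_mem ht]; exact (hI k).abs_integral_le hA t
    · rw [indicator_of_notMem ht]
      have : ∀ x, I k t x = 0 := fun x =>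
        (hI k).zero_fst t x (by by_contra! hc; exact ht (abs_le.1 hc))
      simp [this]
  refine tendsto_integral_of_dominated_convergence _
    (fun k => (hI k).integrable_integral.aestronglyMeasurable.restrict) ?_
    (fun k => ae_of_all _ fun t => hbound k t) ?_
  · exact (((integrable_indicator_iff measurableSet_Icc).2
      (integrableOn_const measure_Icc_lt_top.ne))).restrict
  · filter_upwards [h] with t ht
    exact ht.integral_tendsto (fun k => (hI k).measurable_at t) (fun k => (hI k).bound t)
      (fun k => (hI k).zero_snd t) (hJ t)

end IsBoxed

end DelayTraffic

/-! ### The discrete entropy inequality tested against a function of time and space. -/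

namespace DelayTraffic

variable {P : Model} {G : NumFlux} {ρ₀ : ℝ → ℝ}

/-! ### Test functions -/

namespace Model.IsTest

variable {T : ℝ} {φ : ℝ → ℝ → ℝ}

theorem exists_box (hφ : Model.IsTest T φ) : ∃ A K : ℝ, 0 ≤ A ∧ 0 ≤ K ∧ IsBoxed A K φ ∧
    (∀ t x a, |φ (t + a) x - φ t x| ≤ K * |a|) ∧ ∀ t x a, |φ t (x + a) - φ t x| ≤ K * |a| := by
  obtain ⟨A, hA⟩ := hφ.compact.isCompact.isBounded.subset_closedBall (0 : ℝ × ℝ)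
  obtain ⟨K₁, hK₁⟩ := hφ.compact.exists_bound_of_continuous hφ.contDiff.continuous
  obtain ⟨K₂, hK₂⟩ := hφ.contDiff.lipschitzWith_of_hasCompactSupport hφ.compact one_ne_zero
  have hz : ∀ t x, A < max |t| |x| → φ t x = 0 := by
    intro t x h
    by_contra hne
    have h1 := hA (subset_tsupport (Function.uncurry φ)
      (show (t, x) ∈ Function.support (Function.uncurry φ) from hne))
    rw [mem_closedBall_zero_iff, Prod.norm_def] at h1
    exact absurd h (not_lt.2 h1)
  refine ⟨max A 0, max K₁ K₂, le_max_right _ _, K₂.2.trans (le_max_right _ _),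
    ⟨hφ.contDiff.continuous.measurable, fun t x => (hK₁ (t, x)).trans (le_max_left _ _),
      fun t x h => hz t x (((le_max_left _ _).trans_lt h).trans_le (le_max_left _ _)),
      fun t x h => hz t x (((le_max_left _ _).trans_lt h).trans_le (le_max_right _ _))⟩,
    fun t x a => ?_, fun t x a => ?_⟩
  · have := hK₂.dist_le_mul (t + a, x) (t, x)
    rw [Real.dist_eq, Prod.dist_eq, dist_self, Real.dist_eq, add_sub_cancel_left,
      max_eq_left (abs_nonneg a)] at this
    exact this.trans (mul_le_mul_of_nonneg_right (le_max_right _ _) (abs_nonneg a))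
  · have := hK₂.dist_le_mul (t, x + a) (t, x)
    rw [Real.dist_eq, Prod.dist_eq, dist_self, Real.dist_eq, add_sub_cancel_left,
      max_eq_right (abs_nonneg a)] at this
    exact this.trans (mul_le_mul_of_nonneg_right (le_max_right _ _) (abs_nonneg a))

theorem contDiff_fst (hφ : Model.IsTest T φ) (x : ℝ) : ContDiff ℝ 1 fun s => φ s x :=
  hφ.contDiff.comp (contDiff_id.prodMk contDiff_const)

theorem contDiff_snd (hφ : Model.IsTest T φ) (t : ℝ) : ContDiff ℝ 1 fun y => φ t y :=
  hφ.contDiff.comp (contDiff_const.prodMk contDiff_id)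

end Model.IsTest

theorem slope_tendsto {g : ℝ → ℝ} (hg : ContDiff ℝ 1 g) (x : ℝ) {a : ℕ → ℝ}
    (ha : Tendsto a atTop (𝓝 0)) (h0 : ∀ k, a k ≠ 0) :
    Tendsto (fun k => (g (x + a k) - g x) / a k) atTop (𝓝 (deriv g x)) := by
  have h1 := (hg.differentiable one_ne_zero x).hasDerivAt.tendsto_slope_zero
  refine (h1.comp (tendsto_nhdsWithin_iff.2 ⟨ha, Eventually.of_forall h0⟩)).congr fun k => ?_
  simp [div_eq_inv_mul]

namespace IsBoxed

variable {A K S a : ℝ} {φ : ℝ → ℝ → ℝ}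

theorem quot_fst (h : IsBoxed A K φ) (hK : ∀ t x a, |φ (t + a) x - φ t x| ≤ K * |a|)
    (ha : |a| ≤ S) (h0 : a ≠ 0) : IsBoxed (A + S) K fun t x => (φ (t + a) x - φ t x) / a := by
  have hS : 0 ≤ S := (abs_nonneg a).trans ha
  have h1 := h.comp_add ha (b := 0) (by simpa using hS)
  have h2 := h.comp_add (S := S) (a := 0) (b := 0) (by simpa using hS) (by simpa using hS)
  simp only [add_zero] at h1 h2
  refine ⟨(h1.measurable.sub h2.measurable).div_const a, fun t x => ?_, fun t x ht => ?_,
    fun t x hx => ?_⟩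
  · rw [abs_div, div_le_iff₀ (abs_pos.2 h0)]; exact hK t x a
  · rw [h1.zero_fst t x ht, h2.zero_fst t x ht]; simp
  · rw [h1.zero_snd t x hx, h2.zero_snd t x hx]; simp

theorem quot_snd (h : IsBoxed A K φ) (hK : ∀ t x a, |φ t (x + a) - φ t x| ≤ K * |a|)
    (ha : |a| ≤ S) (h0 : a ≠ 0) : IsBoxed (A + S) K fun t x => (φ t (x + a) - φ t x) / a := by
  have hS : 0 ≤ S := (abs_nonneg a).trans ha
  have h1 := h.comp_add (a := 0) (by simpa using hS) ha
  have h2 := h.comp_add (S := S) (a := 0) (b := 0) (by simpa using hS) (by simpa using hS)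
  simp only [add_zero] at h1 h2
  refine ⟨(h1.measurable.sub h2.measurable).div_const a, fun t x => ?_, fun t x ht => ?_,
    fun t x hx => ?_⟩
  · rw [abs_div, div_le_iff₀ (abs_pos.2 h0)]; exact hK t x a
  · rw [h1.zero_fst t x ht, h2.zero_fst t x ht]; simp
  · rw [h1.zero_snd t x hx, h2.zero_snd t x hx]; simp

end IsBoxed

/-! ### The entropy inequality for the approximations -/

theorem continuous_entFlux {lam : ℝ} (hG : G.IsMonotone P lam) (κ : ℝ) :
    Continuous fun z : ℝ × ℝ × ℝ × ℝ => G.entFlux z.1 z.2.1 κ κ z.2.2.1 z.2.2.2 := by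
  have c1 : ∀ {f g : ℝ × ℝ × ℝ × ℝ → ℝ}, Continuous f → Continuous g →
      Continuous fun z => G.g₁ (f z) (g z) := fun hf hg => hG.continuous₁.comp (hf.prodMk hg)
  have c2 : ∀ {f g : ℝ × ℝ × ℝ × ℝ → ℝ}, Continuous f → Continuous g →
      Continuous fun z => G.g₂ (f z) (g z) := fun hf hg => hG.continuous₂.comp (hf.prodMk hg)
  have m1 : Continuous fun z : ℝ × ℝ × ℝ × ℝ => max z.1 κ := by fun_prop
  have m2 : Continuous fun z : ℝ × ℝ × ℝ × ℝ => max z.2.1 κ := by fun_prop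
  have m3 : Continuous fun z : ℝ × ℝ × ℝ × ℝ => min z.1 κ := by fun_prop
  have m4 : Continuous fun z : ℝ × ℝ × ℝ × ℝ => min z.2.1 κ := by fun_prop
  have := c1 m1 m2
  have := c2 m1 m2
  have := c1 m3 m4
  have := c2 m3 m4
  unfold NumFlux.entFlux NumFlux.flux
  fun_prop

theorem exists_entFlux_bound {lam : ℝ} (hG : G.IsMonotone P lam) (κ : ℝ) :
    ∃ B, ∀ a ∈ Icc 0 P.R, ∀ b ∈ Icc 0 P.R, ∀ p ∈ Icc 0 P.V, ∀ q ∈ Icc 0 P.V,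
      |G.entFlux a b κ κ p q| ≤ B := by
  obtain ⟨B, hB⟩ := (isCompact_Icc.prod (isCompact_Icc.prod (isCompact_Icc.prod isCompact_Icc)) :
    IsCompact (Icc 0 P.R ×ˢ Icc 0 P.R ×ˢ Icc 0 P.V ×ˢ Icc 0 P.V)).exists_bound_of_continuousOn
    (continuous_entFlux hG κ).continuousOn
  exact ⟨B, fun a ha b hb p hp q hq => hB (a, b, p, q) ⟨ha, hb, hp, hq⟩⟩

theorem integral_sub_div_sub_div_sub {μ : Measure ℝ} {f₁ f₂ f₃ f₄ f₅ : ℝ → ℝ}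
    (h₁ : Integrable f₁ μ) (h₂ : Integrable f₂ μ) (h₃ : Integrable f₃ μ) (h₄ : Integrable f₄ μ)
    (h₅ : Integrable f₅ μ) (δ d : ℝ) :
    ∫ x, ((f₁ x - f₂ x) / δ - (f₃ x - f₄ x) / d - f₅ x) ∂μ
      = ((∫ x, f₁ x ∂μ) - ∫ x, f₂ x ∂μ) / δ - ((∫ x, f₃ x ∂μ) - ∫ x, f₄ x ∂μ) / d
        - ∫ x, f₅ x ∂μ := by
  have i1 : Integrable (fun x => (f₁ x - f₂ x) / δ) μ := (h₁.sub h₂).div_const δ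
  have i2 : Integrable (fun x => (f₃ x - f₄ x) / d) μ := (h₃.sub h₄).div_const d
  have i3 : Integrable (fun x => (f₁ x - f₂ x) / δ - (f₃ x - f₄ x) / d) μ := i1.sub i2
  rw [integral_sub i3 h₅, integral_sub i1 i2, integral_div, integral_div, integral_sub h₁ h₂,
    integral_sub h₃ h₄]

/-- The numerical entropy flux of the approximate solution. -/
noncomputable def apxEntFlux (P : Model) (G : NumFlux) (N : ℕ) (U : ℝ → ℝ → ℝ) (κ t x : ℝ) : ℝ :=
  G.entFlux (U t x) (U t (x + P.dx N)) κ κ (P.vel N (U (t - P.τ)) x)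
    (P.vel N (U (t - P.τ)) (x + P.dx N))

/-- The discrete gradient of the speed of the approximate solution. -/
noncomputable def apxGrad (P : Model) (G : NumFlux) (N : ℕ) (U : ℝ → ℝ → ℝ) (t x : ℝ) : ℝ :=
  (1 - G.θ) * quot P N (U (t - P.τ)) (x - P.dx N) + G.θ * quot P N (U (t - P.τ)) x

section Mesh

variable {N h : ℕ}

/-- The delay is exactly `h` time steps, and both the truncated subtraction and the natural floor
send negative indices to `0`. -/
theorem apx_sub_τ (hP : P.Admissible) (hh : 0 < h) (t : ℝ) :
    apx P G ρ₀ N h (t - P.τ) = sol P G N h (P.cellMean N ρ₀) (⌊t / P.dt h⌋₊ - h) := by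
  have hδ := hP.dt_pos hh
  rw [apx, ← Nat.floor_sub_natCast, sub_div]
  congr 3
  rw [div_eq_iff hδ.ne', Model.Admissible.mul_dt hh]

theorem apx_add_dt (hP : P.Admissible) (hN : 0 < N) (hh : 0 < h) {t : ℝ} (ht : 0 ≤ t) :
    apx P G ρ₀ N h (t + P.dt h) = G.step (P.lam N h) (P.dx N)
      (P.vel N (apx P G ρ₀ N h (t - P.τ))) (apx P G ρ₀ N h t) := by
  have hδ := hP.dt_pos hh
  rw [apx_sub_τ hP hh, apx, add_div, div_self hδ.ne', Nat.floor_add_one (div_nonneg ht hδ.le),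
    sol_succ hP G hN]
  rfl

theorem apx_entropy_le (hP : P.Admissible) (hρ : IsDensity P.R ρ₀) (htv : totalVar ρ₀ ≠ ∞)
    (hN : 0 < N) (hh : 0 < h) (hG : G.IsMonotone P (P.lam N h)) (κ : ℝ) {t : ℝ} (ht : 0 ≤ t)
    (x : ℝ) :
    0 ≤ (|apx P G ρ₀ N h t x - κ| - |apx P G ρ₀ N h (t + P.dt h) x - κ|) / P.dt h
      - (apxEntFlux P G N (apx P G ρ₀ N h) κ t x
        - apxEntFlux P G N (apx P G ρ₀ N h) κ t (x - P.dx N)) / P.dx N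
      - Real.sign (apx P G ρ₀ N h (t + P.dt h) x - κ) * P.F κ
        * apxGrad P G N (apx P G ρ₀ N h) t x := by
  have hδ := hP.dt_pos hh
  have hd := hP.dx_pos hN
  have hU := apx_isDensity (G := G) hP hρ htv hN hG
  have hV := hP.vel_mem hN (hU (t - P.τ))
  have h1 := NumFlux.entropy_le hP hG ((hU t).mem (x - P.dx N)) ((hU t).mem x)
    ((hU t).mem (x + P.dx N)) (hV (x - P.dx N)) (hV x) (hV (x + P.dx N)) κ
  have e : G.next (P.lam N h) (apx P G ρ₀ N h t (x - P.dx N)) (apx P G ρ₀ N h t x)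
      (apx P G ρ₀ N h t (x + P.dx N)) (P.vel N (apx P G ρ₀ N h (t - P.τ)) (x - P.dx N))
      (P.vel N (apx P G ρ₀ N h (t - P.τ)) x) (P.vel N (apx P G ρ₀ N h (t - P.τ)) (x + P.dx N))
      = apx P G ρ₀ N h (t + P.dt h) x := by
    rw [apx_add_dt hP hN hh ht]; rfl
  rw [e] at h1
  have hl : P.lam N h = P.dt h / P.dx N := rfl
  unfold apxEntFlux apxGrad quot
  rw [sub_add_cancel]
  rw [hl] at h1
  have h2 := div_nonneg (sub_nonneg.2 h1) hδ.le
  refine h2.trans (le_of_eq ?_)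
  field_simp
  ring

variable {φ : ℝ → ℝ → ℝ} {A K T : ℝ}

theorem apx_isBoxed (hP : P.Admissible) (hρ : IsDensity P.R ρ₀) (htv : totalVar ρ₀ ≠ ∞)
    (hN : 0 < N) (hG : G.IsMonotone P (P.lam N h)) (κ a : ℝ) (hφ : IsBoxed A K φ) :
    IsBoxed A ((P.R + |κ|) * K) fun t x => |apx P G ρ₀ N h (t + a) x - κ| * φ t x := by
  refine hφ.bdd_mul ?_ fun t x => ?_
  · have : Measurable fun z : ℝ × ℝ => apx P G ρ₀ N h (z.1 + a) z.2 :=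
      (apx_measurable N h).comp ((measurable_fst.add_const a).prodMk measurable_snd)
    exact (this.sub_const κ).abs
  · rw [abs_abs]
    exact (abs_sub _ _).trans (add_le_add ((apx_isDensity hP hρ htv hN hG _).abs_le x) le_rfl)

theorem measurable_apx_vel (hP : P.Admissible) (hρ : IsDensity P.R ρ₀) (htv : totalVar ρ₀ ≠ ∞)
    (hN : 0 < N) (hG : G.IsMonotone P (P.lam N h)) (a : ℝ) :
    Measurable fun z : ℝ × ℝ => P.vel N (apx P G ρ₀ N h (z.1 - P.τ)) (z.2 + a) := by
  have h1 := hP.measurable_vel_uncurry hN (u := fun t => apx P G ρ₀ N h (t - P.τ))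
    ((apx_measurable N h).comp ((measurable_fst.sub_const P.τ).prodMk measurable_snd))
    fun t x => (apx_isDensity hP hρ htv hN hG _).mem x
  exact h1.comp (measurable_fst.prodMk (measurable_snd.add_const a))

theorem apxEntFlux_isBoxed (hP : P.Admissible) (hρ : IsDensity P.R ρ₀) (htv : totalVar ρ₀ ≠ ∞)
    (hN : 0 < N) (hG : G.IsMonotone P (P.lam N h)) (κ a : ℝ) (hφ : IsBoxed A K φ) {B : ℝ}
    (hB : ∀ a ∈ Icc 0 P.R, ∀ b ∈ Icc 0 P.R, ∀ p ∈ Icc 0 P.V, ∀ q ∈ Icc 0 P.V,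
      |G.entFlux a b κ κ p q| ≤ B) :
    IsBoxed A (B * K) fun t x => apxEntFlux P G N (apx P G ρ₀ N h) κ t (x + a) * φ t x := by
  have hU := apx_isDensity (G := G) hP hρ htv hN hG
  refine hφ.bdd_mul ?_ fun t x => hB _ ((hU _).mem _) _ ((hU _).mem _) _
    (hP.vel_mem hN (hU _) _) _ (hP.vel_mem hN (hU _) _)
  have hu : ∀ a, Measurable fun z : ℝ × ℝ => apx P G ρ₀ N h z.1 (z.2 + a) := fun a =>
    (apx_measurable N h).comp (measurable_fst.prodMk (measurable_snd.add_const a))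
  have h1 := (hu a).prodMk ((hu (a + P.dx N)).prodMk ((measurable_apx_vel hP hρ htv hN hG a).prodMk
    (measurable_apx_vel hP hρ htv hN hG (a + P.dx N))))
  have h2 := (continuous_entFlux hG κ).measurable.comp h1
  have e : Function.uncurry (fun t x => apxEntFlux P G N (apx P G ρ₀ N h) κ t (x + a))
      = (fun z : ℝ × ℝ × ℝ × ℝ => G.entFlux z.1 z.2.1 κ κ z.2.2.1 z.2.2.2) ∘ fun z : ℝ × ℝ =>
        (apx P G ρ₀ N h z.1 (z.2 + a), apx P G ρ₀ N h z.1 (z.2 + (a + P.dx N)),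
          P.vel N (apx P G ρ₀ N h (z.1 - P.τ)) (z.2 + a),
          P.vel N (apx P G ρ₀ N h (z.1 - P.τ)) (z.2 + (a + P.dx N))) := by
    ext z
    simp only [Function.uncurry, apxEntFlux, Function.comp_apply, add_assoc]
  rw [e]
  exact h2

theorem abs_sign_le (x : ℝ) : |Real.sign x| ≤ 1 := by
  rcases Real.sign_apply_eq x with h | h | h <;> simp [h]

theorem measurable_sign : Measurable Real.sign := by
  unfold Real.sign
  exact Measurable.ite measurableSet_Iio measurable_const
    (Measurable.ite measurableSet_Ioi measurable_const measurable_const)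

theorem apxGrad_isBoxed (hP : P.Admissible) (hρ : IsDensity P.R ρ₀) (htv : totalVar ρ₀ ≠ ∞)
    (hN : 0 < N) (hG : G.IsMonotone P (P.lam N h)) (κ a : ℝ) (hφ : IsBoxed A K φ) :
    IsBoxed A (|P.F κ| * (2 * P.normω * P.R * P.normV') * K) fun t x =>
      Real.sign (apx P G ρ₀ N h (t + a) x - κ) * P.F κ
        * apxGrad P G N (apx P G ρ₀ N h) t x * φ t x := by
  have hU := apx_isDensity (G := G) hP hρ htv hN hG
  refine hφ.bdd_mul ?_ fun t x => ?_
  · have h1 : Measurable fun z : ℝ × ℝ => apx P G ρ₀ N h (z.1 + a) z.2 :=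
      (apx_measurable N h).comp ((measurable_fst.add_const a).prodMk measurable_snd)
    have h2 := measurable_sign.comp (h1.sub_const κ)
    have h3 := measurable_apx_vel (G := G) hP hρ htv hN hG
    have h4 := h3 (-P.dx N)
    have h5 := h3 (-P.dx N + P.dx N)
    have h6 := h3 0
    have h7 := h3 (P.dx N)
    simp only [← add_assoc, ← sub_eq_add_neg, add_zero] at h4 h5 h6 h7
    exact (h2.mul_const (P.F κ)).mul
      ((((h5.sub h4).div_const (P.dx N)).const_mul (1 - G.θ)).add
        (((h7.sub h6).div_const (P.dx N)).const_mul G.θ))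
  · have h1 := abs_quot_le hP hN (hU (t - P.τ)) (x - P.dx N)
    have h2 := abs_quot_le hP hN (hU (t - P.τ)) x
    have hθ := hG.θ_mem
    have h3 : |apxGrad P G N (apx P G ρ₀ N h) t x| ≤ 2 * P.normω * P.R * P.normV' := by
      unfold apxGrad
      refine (abs_add_le _ _).trans ?_
      rw [abs_mul, abs_mul, abs_of_nonneg hθ.1, abs_of_nonneg (sub_nonneg.2 hθ.2)]
      have := mul_le_mul_of_nonneg_left h1 (sub_nonneg.2 hθ.2)
      have := mul_le_mul_of_nonneg_left h2 hθ.1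
      linarith
    rw [abs_mul, abs_mul]
    refine mul_le_mul ?_ h3 (abs_nonneg _) (abs_nonneg _)
    exact mul_le_of_le_one_left (abs_nonneg _) (abs_sign_le _)

/-- The entropy inequality for the approximate solution, with the differences on the test
function. -/
theorem apx_entropy (hP : P.Admissible) (hρ : IsDensity P.R ρ₀) (htv : totalVar ρ₀ ≠ ∞)
    (hN : 0 < N) (hh : 0 < h) (hG : G.IsMonotone P (P.lam N h)) (κ : ℝ) (hφ : IsBoxed A K φ)
    (hpos : ∀ t x, 0 ≤ t → 0 ≤ φ t x) :
    0 ≤ (∫ t, ∫ x, |apx P G ρ₀ N h t x - κ| * ((φ (t + -P.dt h) x - φ t x) / -P.dt h))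
      + (∫ t in Ici 0, ∫ x, apxEntFlux P G N (apx P G ρ₀ N h) κ t x
          * ((φ t (x + P.dx N) - φ t x) / P.dx N))
      - ∫ t in Ici 0, ∫ x, Real.sign (apx P G ρ₀ N h (t + P.dt h) x - κ) * P.F κ
          * apxGrad P G N (apx P G ρ₀ N h) t x * φ t x := by
  have hδ := hP.dt_pos hh
  have hd := hP.dx_pos hN
  obtain ⟨B, hB⟩ := exists_entFlux_bound hG κ
  set U := apx P G ρ₀ N h with hU
  set Q := apxEntFlux P G N U κ with hQ
  have hφδ : IsBoxed (A + P.dt h) K fun t x => φ (t + -P.dt h) x := by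
    simpa using hφ.comp_add (S := P.dt h) (a := -P.dt h) (b := 0) (by simp [abs_of_pos hδ])
      (by simpa using hδ.le)
  have hφd : IsBoxed (A + P.dx N) K fun t x => φ t (x + P.dx N) := by
    simpa using hφ.comp_add (S := P.dx N) (a := 0) (b := P.dx N) (by simpa using hd.le)
      (by simp [abs_of_pos hd])
  have b1 : IsBoxed A ((P.R + |κ|) * K) fun t x => |U t x - κ| * φ t x := by
    simpa using apx_isBoxed hP hρ htv hN hG κ 0 hφ
  have b2 : IsBoxed A ((P.R + |κ|) * K) fun t x => |U (t + P.dt h) x - κ| * φ t x :=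
    apx_isBoxed hP hρ htv hN hG κ (P.dt h) hφ
  have b3 : IsBoxed A (B * K) fun t x => Q t x * φ t x := by
    simpa using apxEntFlux_isBoxed hP hρ htv hN hG κ 0 hφ hB
  have b4 : IsBoxed A (B * K) fun t x => Q t (x - P.dx N) * φ t x := by
    simpa [← sub_eq_add_neg] using apxEntFlux_isBoxed hP hρ htv hN hG κ (-P.dx N) hφ hB
  have b5 := apxGrad_isBoxed hP hρ htv hN hG κ (P.dt h) hφ
  have b6 : IsBoxed (A + P.dx N) (B * K) fun t x => Q t x * φ t (x + P.dx N) := by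
    simpa using apxEntFlux_isBoxed hP hρ htv hN hG κ 0 hφd hB
  have b7 : IsBoxed (A + P.dt h) ((P.R + |κ|) * K) fun t x => |U t x - κ| * φ (t + -P.dt h) x := by
    simpa using apx_isBoxed hP hρ htv hN hG κ 0 hφδ
  rw [← hU] at b5
  -- Summation by parts in space and in time is a translation of the integration variable.
  have shift_x : ∀ t, ∫ x, Q t (x - P.dx N) * φ t x = ∫ x, Q t x * φ t (x + P.dx N) := by
    intro t
    rw [← integral_add_right_eq_self (fun x => Q t (x - P.dx N) * φ t x) (P.dx N)]
    simp only [add_sub_cancel_right]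
  have shift_t : ∫ t, ∫ x, |U (t + P.dt h) x - κ| * φ t x
      = ∫ t, ∫ x, |U t x - κ| * φ (t + -P.dt h) x := by
    rw [← integral_add_right_eq_self (fun t => ∫ x, |U t x - κ| * φ (t + -P.dt h) x) (P.dt h)]
    simp only [add_neg_cancel_right]
  have hx : ∀ t ∈ Ici (0 : ℝ), 0 ≤ ((∫ x, |U t x - κ| * φ t x)
      - ∫ x, |U (t + P.dt h) x - κ| * φ t x) / P.dt h
      - ((∫ x, Q t x * φ t x) - ∫ x, Q t x * φ t (x + P.dx N)) / P.dx N
      - ∫ x, Real.sign (U (t + P.dt h) x - κ) * P.F κ * apxGrad P G N U t x * φ t x := by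
    intro t ht
    rw [← shift_x, ← integral_sub_div_sub_div_sub (b1.integrable t) (b2.integrable t)
      (b3.integrable t) (b4.integrable t) (b5.integrable t)]
    refine integral_nonneg fun x => ?_
    have := mul_nonneg (apx_entropy_le hP hρ htv hN hh hG κ ht x) (hpos t x ht)
    refine this.trans (le_of_eq ?_)
    simp only [← hU, ← hQ]
    ring
  have ht := setIntegral_nonneg (μ := volume) measurableSet_Ici hx
  rw [integral_sub_div_sub_div_sub b1.integrable_integral.restrict
    b2.integrable_integral.restrict b3.integrable_integral.restrict
    b6.integrable_integral.restrict b5.integrable_integral.restrict] at ht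
  -- At negative times both `U t` and `U (t + Δt)` equal the discretized datum, so the time
  -- difference may be integrated over the whole line. The initial term is thereby encoded in the
  -- negative times and needs no separate treatment.
  have e1 : (∫ t in Ici 0, ∫ x, |U t x - κ| * φ t x)
      - ∫ t in Ici 0, ∫ x, |U (t + P.dt h) x - κ| * φ t x
      = (∫ t, ∫ x, |U t x - κ| * φ t x) - ∫ t, ∫ x, |U t x - κ| * φ (t + -P.dt h) x := by
    rw [← shift_t, ← integral_sub b1.integrable_integral.restrict b2.integrable_integral.restrict,
      ← integral_sub b1.integrable_integral b2.integrable_integral]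
    refine setIntegral_eq_integral_of_forall_compl_eq_zero fun t ht => ?_
    have ht' : t < 0 := not_le.1 ht
    rw [hU, apx_of_lt hP hh (ht'.trans hδ), apx_of_lt hP hh (by linarith), sub_self]
  have e2 : ∫ t, ∫ x, |U t x - κ| * ((φ (t + -P.dt h) x - φ t x) / -P.dt h)
      = ((∫ t, ∫ x, |U t x - κ| * φ t x) - ∫ t, ∫ x, |U t x - κ| * φ (t + -P.dt h) x)
        / P.dt h := by
    rw [← integral_sub b1.integrable_integral b7.integrable_integral, ← integral_div]
    refine integral_congr_ae (ae_of_all _ fun t => ?_)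
    simp only
    rw [← integral_sub (b1.integrable t) (b7.integrable t), ← integral_div]
    refine integral_congr_ae (ae_of_all _ fun x => ?_)
    simp only
    field_simp
    ring
  have e3 : ∫ t in Ici 0, ∫ x, Q t x * ((φ t (x + P.dx N) - φ t x) / P.dx N)
      = -(((∫ t in Ici 0, ∫ x, Q t x * φ t x)
        - ∫ t in Ici 0, ∫ x, Q t x * φ t (x + P.dx N)) / P.dx N) := by
    rw [← integral_sub b3.integrable_integral.restrict b6.integrable_integral.restrict,
      ← integral_div, ← integral_neg]
    refine integral_congr_ae (ae_of_all _ fun t => ?_)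
    simp only
    rw [← integral_sub (b3.integrable t) (b6.integrable t), ← integral_div, ← integral_neg]
    refine integral_congr_ae (ae_of_all _ fun x => ?_)
    simp only
    ring
  rw [e2, ← e1, e3]
  linarith

end Mesh

end DelayTraffic

/-! ### The limit entropy inequality for constants attained on a null set only. -/

namespace DelayTraffic

variable {P : Model} {G : NumFlux} {ρ₀ : ℝ → ℝ}

/-! ### Pointwise properties of test functions -/

namespace Model.IsTest

variable {T : ℝ} {φ : ℝ → ℝ → ℝ}

theorem eventuallyEq_zero (hφ : Model.IsTest T φ) {t : ℝ} (ht : T ≤ t) (x : ℝ) :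
    Function.uncurry φ =ᶠ[𝓝 (t, x)] 0 :=
  notMem_tsupport_iff_eventuallyEq.1 fun h => not_lt.2 ht (hφ.support h).1

theorem eq_zero (hφ : Model.IsTest T φ) {t : ℝ} (ht : T ≤ t) (x : ℝ) : φ t x = 0 :=
  (hφ.eventuallyEq_zero ht x).self_of_nhds

theorem deriv_fst_eq_zero (hφ : Model.IsTest T φ) {t : ℝ} (ht : T ≤ t) (x : ℝ) :
    deriv (fun s => φ s x) t = 0 := by
  have h1 : Tendsto (fun s : ℝ => (s, x)) (𝓝 t) (𝓝 (t, x)) :=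
    (continuous_id.prodMk continuous_const).tendsto t
  have h2 : (fun s => φ s x) =ᶠ[𝓝 t] fun _ => 0 := h1.eventually (hφ.eventuallyEq_zero ht x)
  rw [h2.deriv_eq, deriv_const]

theorem hasCompactSupport_fst (hφ : Model.IsTest T φ) (x : ℝ) :
    HasCompactSupport fun s => φ s x := by
  obtain ⟨A, K, -, -, hA, -, -⟩ := hφ.exists_box
  refine HasCompactSupport.intro (isCompact_Icc (a := -A) (b := A)) fun s hs => ?_
  exact hA.zero_fst s x (by by_contra! hc; exact hs (abs_le.1 hc))

end Model.IsTest

/-- Partial derivatives are pointwise limits of difference quotients with steps at most `S`, which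
share a bound and a box enlarged by `S`. -/
theorem deriv_isBoxed {T A K S : ℝ} {φ : ℝ → ℝ → ℝ} (hφ : Model.IsTest T φ) (hA : IsBoxed A K φ)
    (h₁ : ∀ t x a, |φ (t + a) x - φ t x| ≤ K * |a|)
    (h₂ : ∀ t x a, |φ t (x + a) - φ t x| ≤ K * |a|) (hS : 0 < S) :
    IsBoxed (A + S) K (fun t x => deriv (fun s => φ s x) t) ∧
      IsBoxed (A + S) K fun t x => deriv (fun y => φ t y) x := by
  set a : ℕ → ℝ := fun k => S * (1 / ((k : ℝ) + 1)) with ha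
  have a0 : ∀ k, a k ≠ 0 := fun k => by positivity
  have aS : ∀ k, |a k| ≤ S := fun k => by
    rw [abs_of_nonneg (by positivity)]
    refine mul_le_of_le_one_right hS.le ?_
    rw [div_le_one (by positivity)]
    linarith [k.cast_nonneg (α := ℝ)]
  have at0 : Tendsto a atTop (𝓝 0) := by
    have := (tendsto_one_div_add_atTop_nhds_zero_nat (𝕜 := ℝ)).const_mul S
    rwa [mul_zero] at this
  exact ⟨IsBoxed.of_tendsto (fun k => hA.quot_fst h₁ (aS k) (a0 k))
      fun t x => slope_tendsto (hφ.contDiff_fst x) t at0 a0,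
    IsBoxed.of_tendsto (fun k => hA.quot_snd h₂ (aS k) (a0 k))
      fun t x => slope_tendsto (hφ.contDiff_snd t) x at0 a0⟩

/-! ### Limits of the coefficients -/

theorem entFlux_diag {lam : ℝ} (hG : G.IsMonotone P lam) (r κ p : ℝ) :
    G.entFlux r r κ κ p p = Real.sign (r - κ) * (P.F r - P.F κ) * p := by
  rw [NumFlux.entFlux, NumFlux.flux_diag hG, NumFlux.flux_diag hG]
  rcases lt_trichotomy r κ with h | rfl | h
  · rw [max_eq_right h.le, min_eq_left h.le, Real.sign_of_neg (sub_neg.2 h)]; ring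
  · simp
  · rw [max_eq_left h.le, min_eq_right h.le, Real.sign_of_pos (sub_pos.2 h)]; ring

theorem continuousAt_sign {x : ℝ} (hx : x ≠ 0) : ContinuousAt Real.sign x := by
  rcases lt_or_gt_of_ne hx with h | h
  · refine (continuousAt_const (y := (-1 : ℝ))).congr ?_
    filter_upwards [Iio_mem_nhds h] with y hy
    rw [Real.sign_of_neg hy]
  · refine (continuousAt_const (y := (1 : ℝ))).congr ?_
    filter_upwards [Ioi_mem_nhds h] with y hy
    rw [Real.sign_of_pos hy]

namespace IsLiftLimit

variable {N : ℕ → ℕ} {C : ℝ} {w : ℕ → ℝ → ℝ} {r : ℝ → ℝ}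

theorem quot_sub_tendsto (hP : P.Admissible) (h : IsLiftLimit P N C w r) :
    L1Loc (fun k x => quot P (N k) (w k) (x - P.dx (N k))) (deriv (P.speed r)) := by
  have hq : ∀ k, Measurable (quot P (N k) (w k)) :=
    fun k => quot_measurable hP (h.N_pos k) (h.isDensity k)
  refine (h.quot_tendsto hP).of_close hq (fun k => by have := hq k; fun_prop) ?_
  have h1 := ENNReal.tendsto_ofReal (h.dx_tendsto.const_mul (P.curv * C))
  rw [mul_zero, ENNReal.ofReal_zero] at h1
  refine tendsto_of_tendsto_of_tendsto_of_le_of_le tendsto_const_nhds h1 (fun _ => zero_le)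
    fun k => ?_
  refine le_trans (le_of_eq ?_) (h.lincr_quot_le hP k (hP.dx_pos (h.N_pos k)))
  rw [← lincr_neg]
  rfl

theorem add_dx_tendsto (hP : P.Admissible) (h : IsLiftLimit P N C w r) :
    L1Loc (fun k x => w k (x + P.dx (N k))) r := by
  have hm : ∀ k, Measurable (w k) := fun k => (h.isDensity k).measurable
  refine h.tendsto.of_close hm (fun k => by have := hm k; fun_prop) ?_
  have h1 := ENNReal.tendsto_ofReal (h.dx_tendsto.const_mul C)
  rw [mul_zero, ENNReal.ofReal_zero] at h1
  exact tendsto_of_tendsto_of_tendsto_of_le_of_le tendsto_const_nhds h1 (fun _ => zero_le)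
    fun k => h.lincr_le k _ (hP.dx_pos (h.N_pos k))

theorem norm_deriv_speed_le (hP : P.Admissible) (h : IsLiftLimit P N C w r) (x : ℝ) :
    |deriv (P.speed r) x| ≤ 2 * P.normω * P.R * P.normV' := by
  have hB : 0 ≤ 2 * P.normω * P.R * P.normV' := by
    have := hP.R_pos
    have := Model.normω_nonneg (P := P)
    have := Model.normV'_nonneg (P := P)
    positivity
  have hlip : LipschitzWith ⟨_, hB⟩ (P.speed r) := LipschitzWith.of_dist_le_mul fun x y => by
    rw [Real.dist_eq, Real.dist_eq]; exact h.abs_speed_limit_sub_le hP x y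
  exact norm_deriv_le_of_lipschitz hlip

end IsLiftLimit

namespace IsLimit

variable {Λ : ℝ} {N h : ℕ → ℕ} {ρ : ℝ → ℝ → ℝ}

theorem isLiftLimit (hP : P.Admissible) (hm : IsMeshSeq P G Λ N h) (hρ : IsDensity P.R ρ₀)
    (htv : totalVar ρ₀ ≠ ∞) (hl : IsLimit P G ρ₀ N h ρ) (t : ℝ) :
    IsLiftLimit P N (P.growth (max t 0) * (totalVar ρ₀).toReal)
      (fun k => apx P G ρ₀ (N k) (h k) t) (ρ t) where
  N_pos := hm.N_pos
  dx_tendsto := hm.dx_tendsto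
  C_nonneg := (hm.isCompactFamily hP hρ htv).C_nonneg t
  isLift _ := ⟨_, rfl⟩
  isDensity k := apx_isDensity hP hρ htv (hm.N_pos k) (hm.mono k) t
  lincr_le k _ ha := lincr_apx_le hP hρ htv (hm.N_pos k) (hm.h_pos k) (hm.mono k) t ha
  isDensity_limit := hl.isDensity hP hm hρ htv t
  tendsto := hl.tendsto t

theorem add_dt_tendsto (hP : P.Admissible) (hm : IsMeshSeq P G Λ N h) (hρ : IsDensity P.R ρ₀)
    (htv : totalVar ρ₀ ≠ ∞) (hl : IsLimit P G ρ₀ N h ρ) (t : ℝ) :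
    L1Loc (fun k => apx P G ρ₀ (N k) (h k) (t + P.dt (h k))) (ρ t) := by
  have hc := hm.isCompactFamily hP hρ htv
  refine (hl.tendsto t).of_close (fun k => (hc.isDensity k t).measurable)
    (fun k => (hc.isDensity k _).measurable) ?_
  set K := timeLip P G ρ₀ ((∫ x, ρ₀ x) + 2 * (totalVar ρ₀).toReal * P.L)
  have h1 := ENNReal.tendsto_ofReal
    (((hm.dt_tendsto hP).add (hm.dt_tendsto hP)).const_mul (K (t + P.τ)))
  rw [add_zero, mul_zero, ENNReal.ofReal_zero] at h1
  refine tendsto_of_tendsto_of_tendsto_of_le_of_le tendsto_const_nhds h1 (fun _ => zero_le)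
    fun k => (hc.dist_le k _ t).trans (ENNReal.ofReal_le_ofReal ?_)
  have hδ := hP.dt_pos (hm.h_pos k)
  have hτ : P.dt (h k) ≤ P.τ := div_le_self hP.τ_pos.le (by exact_mod_cast hm.h_pos k)
  rw [add_sub_cancel_left, abs_of_pos hδ, max_eq_left (by linarith)]
  exact mul_le_mul_of_nonneg_right (hc.K_mono (by linarith)) (by linarith)

/-- The speed is Lipschitz in space uniformly in time, and continuous in time at fixed `x` because
the density is locally Lipschitz in time with values in `L¹`. Joint continuity is what makes the
spatial derivative jointly measurable. -/
theorem speed_continuous (hP : P.Admissible) (hm : IsMeshSeq P G Λ N h) (hρ : IsDensity P.R ρ₀)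
    (htv : totalVar ρ₀ ≠ ∞) (hl : IsLimit P G ρ₀ N h ρ) :
    Continuous fun z : ℝ × ℝ => P.speed (ρ z.1) z.2 := by
  have hd := hl.isDensity hP hm hρ htv
  have hB : 0 ≤ 2 * P.normω * P.R * P.normV' := by
    have := hP.R_pos
    have := Model.normω_nonneg (P := P)
    have := Model.normV'_nonneg (P := P)
    positivity
  refine continuous_prod_of_continuous_lipschitzWith' _ ⟨_, hB⟩ (fun t =>
    LipschitzWith.of_dist_le_mul fun x y => by
      rw [Real.dist_eq, Real.dist_eq]
      exact (hl.isLiftLimit hP hm hρ htv t).abs_speed_limit_sub_le hP x y) fun x => ?_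
  simp only
  have hconv : Continuous fun t => P.conv (ρ t) x := by
    refine continuous_iff_continuousAt.2 fun s => ?_
    rw [ContinuousAt, tendsto_iff_edist_tendsto_0]
    set m := timeLip P G ρ₀ (∫ x, ρ₀ x) (s + 1)
    have h1 : Tendsto (fun t => ENNReal.ofReal P.normω * ENNReal.ofReal (m * |t - s|)) (𝓝 s)
        (𝓝 0) := by
      have h2 : Tendsto (fun t => m * |t - s|) (𝓝 s) (𝓝 0) := by
        have : Continuous fun t => m * |t - s| := by fun_prop
        simpa using this.tendsto s
      have h3 := ENNReal.Tendsto.const_mul (a := ENNReal.ofReal P.normω)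
        (ENNReal.tendsto_ofReal h2) (Or.inr ENNReal.ofReal_ne_top)
      rwa [ENNReal.ofReal_zero, mul_zero] at h3
    refine tendsto_of_tendsto_of_tendsto_of_le_of_le' tendsto_const_nhds h1
      (Eventually.of_forall fun _ => zero_le) ?_
    filter_upwards [Iio_mem_nhds (lt_add_one s)] with t ht
    rw [edist_eq_enorm_sub]
    refine (hP.enorm_conv_sub_le (hd t) (hd s) x x).trans (mul_le_mul_right ?_ _)
    refine (setLIntegral_le_lintegral _ _).trans ?_
    have h4 := hl.dist_le hP hm hρ htv t s
    rw [← lintegral_add_right_eq_self (fun y => ‖ρ t y - ρ s y‖ₑ) x] at h4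
    simp only [add_comm x]
    refine h4.trans (ENNReal.ofReal_le_ofReal (mul_le_mul_of_nonneg_right ?_ (abs_nonneg _)))
    exact timeLip_mono hP (hm.mono 0).β_nonneg _ (max_le (le_of_lt ht) (by linarith))
  exact hP.v_continuousOn.comp_continuous hconv fun t => hP.conv_mem (hd t) x

/-- The integral of a weight of the density against a function of time and space. -/
noncomputable def _root_.DelayTraffic.weighted (ρ : ℝ → ℝ → ℝ) (S : Set ℝ) (a : ℝ → ℝ)
    (ψ : ℝ → ℝ → ℝ) : ℝ := ∫ t in S, ∫ x, a (ρ t x) * ψ t x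

/-- The entropy inequality in the limit, for the constants which the limit attains only on a
null set. -/
theorem entropy_of_ae_ne (hP : P.Admissible) (hm : IsMeshSeq P G Λ N h) (hρ : IsDensity P.R ρ₀)
    (htv : totalVar ρ₀ ≠ ∞) (hl : IsLimit P G ρ₀ N h ρ) {T : ℝ} {φ : ℝ → ℝ → ℝ}
    (hφ : Model.IsTest T φ) {κ : ℝ} (hκ : ∀ᵐ t, ∀ᵐ x, ρ t x ≠ κ) :
    0 ≤ weighted ρ univ (fun r => |r - κ|) (fun t x => deriv (fun s => φ s x) t)
      + weighted ρ (Ici 0) (fun r => Real.sign (r - κ) * (P.F r - P.F κ))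
        (fun t x => P.speed (ρ (t - P.τ)) x * deriv (fun y => φ t y) x)
      - weighted ρ (Ici 0) (fun r => Real.sign (r - κ) * P.F κ)
        (fun t x => deriv (P.speed (ρ (t - P.τ))) x * φ t x) := by
  obtain ⟨A, K, hA0, -, hA, hK₁, hK₂⟩ := hφ.exists_box
  obtain ⟨B, hB⟩ := exists_entFlux_bound (hm.mono 0) κ
  have hL := hP.L_pos
  have hτ := hP.τ_pos
  -- `S` dominates every space step and every time step, so one box serves all difference quotients
  -- of the test function.
  set S := P.L + P.τ with hS
  have hS0 : 0 < S := by positivity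
  obtain ⟨hD₁, hD₂⟩ := deriv_isBoxed hφ hA hK₁ hK₂ hS0
  have hδ : ∀ k, 0 < P.dt (h k) := fun k => hP.dt_pos (hm.h_pos k)
  have hd : ∀ k, 0 < P.dx (N k) := fun k => hP.dx_pos (hm.N_pos k)
  have hδS : ∀ k, |-P.dt (h k)| ≤ S := fun k => by
    rw [abs_neg, abs_of_pos (hδ k)]
    have : P.dt (h k) ≤ P.τ := div_le_self hτ.le (by exact_mod_cast hm.h_pos k)
    linarith
  have hdS : ∀ k, |P.dx (N k)| ≤ S := fun k => by
    rw [abs_of_pos (hd k)]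
    have : P.dx (N k) ≤ P.L := div_le_self hL.le (by exact_mod_cast hm.N_pos k)
    linarith
  have hU := fun k t => apx_isDensity (G := G) hP hρ htv (hm.N_pos k) (hm.mono k) t
  have sU : ∀ t A, SubAE A (fun k => apx P G ρ₀ (N k) (h k) t) (ρ t) := fun t =>
    (hl.tendsto t).subAE (fun k => (hU k t).measurable) (hl.measurable_at t)
  have lim₁ := IsBoxed.integral_tendsto (by positivity : 0 ≤ A + S)
    (I := fun k t x => |apx P G ρ₀ (N k) (h k) t x - κ|
      * ((φ (t + -P.dt (h k)) x - φ t x) / -P.dt (h k)))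
    (J := fun t x => |ρ t x - κ| * deriv (fun s => φ s x) t)
    (fun k => by
      simpa using apx_isBoxed hP hρ htv (hm.N_pos k) (hm.mono k) κ 0
        (hA.quot_fst hK₁ (hδS k) (neg_ne_zero.2 (hδ k).ne')))
    (fun t x hx => by rw [hD₁.zero_snd t x hx, mul_zero]) univ
    (ae_of_all _ fun t => ((sU t _).comp_continuous (by fun_prop : Continuous fun r => |r - κ|)).mul
      (SubAE.of_tendsto fun x => slope_tendsto (hφ.contDiff_fst x) t
        (by simpa using (hm.dt_tendsto hP).neg) fun k => neg_ne_zero.2 (hδ k).ne'))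
  have lim₂ := IsBoxed.integral_tendsto (by positivity : 0 ≤ A + S)
    (I := fun k t x => apxEntFlux P G (N k) (apx P G ρ₀ (N k) (h k)) κ t x
      * ((φ t (x + P.dx (N k)) - φ t x) / P.dx (N k)))
    (J := fun t x => Real.sign (ρ t x - κ) * (P.F (ρ t x) - P.F κ)
      * (P.speed (ρ (t - P.τ)) x * deriv (fun y => φ t y) x))
    (fun k => by
      simpa using apxEntFlux_isBoxed hP hρ htv (hm.N_pos k) (hm.mono k) κ 0
        (hA.quot_snd hK₂ (hdS k) (hd k).ne') hB)
    (fun t x hx => by rw [hD₂.zero_snd t x hx, mul_zero, mul_zero]) (Ici 0)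
    (ae_of_all _ fun t => by
      have hL := hl.isLiftLimit hP hm hρ htv t
      have hLτ := hl.isLiftLimit hP hm hρ htv (t - P.τ)
      have s2 := (hL.add_dx_tendsto hP).subAE
        (fun k => (hU k t).measurable.comp (measurable_id.add_const _))
        (hl.measurable_at t) (A + S)
      have s3 : SubAE (A + S) (fun k => P.vel (N k) (apx P G ρ₀ (N k) (h k) (t - P.τ)))
          (P.speed (ρ (t - P.τ))) :=
        SubAE.of_tendsto fun x => hLτ.vel_tendsto hP tendsto_const_nhds
      have s4 : SubAE (A + S) (fun k x => P.vel (N k) (apx P G ρ₀ (N k) (h k) (t - P.τ))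
          (x + P.dx (N k))) (P.speed (ρ (t - P.τ))) :=
        SubAE.of_tendsto fun x => hLτ.vel_tendsto hP (by
          simpa using hm.dx_tendsto.const_add x)
      have s5 := (((sU t _).prodMk (s2.prodMk (s3.prodMk s4))).comp_continuous
        (continuous_entFlux (hm.mono 0) κ)).mul (SubAE.of_tendsto fun x =>
          slope_tendsto (hφ.contDiff_snd t) x hm.dx_tendsto fun k => (hd k).ne')
      simp only [entFlux_diag (hm.mono 0), mul_assoc] at s5 ⊢
      exact s5)
  have lim₃ := IsBoxed.integral_tendsto hA0
    (I := fun k t x => Real.sign (apx P G ρ₀ (N k) (h k) (t + P.dt (h k)) x - κ) * P.F κ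
      * apxGrad P G (N k) (apx P G ρ₀ (N k) (h k)) t x * φ t x)
    (J := fun t x => Real.sign (ρ t x - κ) * P.F κ * (deriv (P.speed (ρ (t - P.τ))) x * φ t x))
    (fun k => apxGrad_isBoxed hP hρ htv (hm.N_pos k) (hm.mono k) κ (P.dt (h k)) hA)
    (fun t x hx => by rw [hA.zero_snd t x hx, mul_zero, mul_zero]) (Ici 0)
    (by
      filter_upwards [ae_restrict_of_ae hκ] with t ht
      have hLτ := hl.isLiftLimit hP hm hρ htv (t - P.τ)
      have hq : ∀ k, Measurable (quot P (N k) (apx P G ρ₀ (N k) (h k) (t - P.τ))) :=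
        fun k => quot_measurable hP (hm.N_pos k) (hU k _)
      -- The sign at the new time level is the only discontinuous coefficient, and the only place
      -- where `κ` has to be generic.
      have s1 := ((hl.add_dt_tendsto hP hm hρ htv t).subAE (fun k => (hU k _).measurable)
        (hl.measurable_at t) A).comp_continuousAt (g := fun r => Real.sign (r - κ) * P.F κ) (by
          filter_upwards [ae_restrict_of_ae ht] with x hx
          have : ContinuousAt (fun r => Real.sign (r - κ)) (ρ t x) :=
            (continuousAt_sign (sub_ne_zero.2 hx)).comp (f := fun r => r - κ)
              (by fun_prop : Continuous fun r : ℝ => r - κ).continuousAt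
          exact this.mul_const _)
      have s2 := (hLτ.quot_tendsto hP).subAE hq (measurable_deriv _) A
      have s3 := (hLτ.quot_sub_tendsto hP).subAE
        (fun k => (hq k).comp (measurable_id.sub_const _)) (measurable_deriv _) A
      have s4 := (s3.prodMk s2).comp_continuous
        (by fun_prop : Continuous fun z : ℝ × ℝ => (1 - G.θ) * z.1 + G.θ * z.2)
      have s5 := (s1.mul s4).mul (SubAE.of_tendsto (u := fun _ => φ t) (v := φ t)
        fun x => tendsto_const_nhds)
      -- The shifted and the unshifted quotients have the same limit, so the weights `1 - θ` and `θ`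
      -- disappear.
      simp only [← add_mul, sub_add_cancel, one_mul, mul_assoc] at s5 ⊢
      exact s5)
  refine ge_of_tendsto' ((lim₁.add lim₂).sub lim₃) fun k => ?_
  have := apx_entropy hP hρ htv (hm.N_pos k) (hm.h_pos k) (hm.mono k) κ hA hφ.nonneg
  rwa [Measure.restrict_univ]

end IsLimit

end DelayTraffic

/-! ### The entropy inequality for all constants, with the initial term. -/

namespace DelayTraffic

variable {P : Model} {G : NumFlux} {ρ₀ : ℝ → ℝ}

section Weighted

variable {R A K C : ℝ} {ρ ψ : ℝ → ℝ → ℝ}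

theorem IsBoxed.weight (hρ : Measurable (Function.uncurry ρ)) (hm : ∀ t x, ρ t x ∈ Icc 0 R)
    (hψ : IsBoxed A K ψ) {a : ℝ → ℝ} (ha : Measurable a) (hC : ∀ r ∈ Icc 0 R, |a r| ≤ C) :
    IsBoxed A (C * K) fun t x => a (ρ t x) * ψ t x :=
  hψ.bdd_mul (ha.comp hρ) fun t x => hC _ (hm t x)

theorem weighted_tendsto (hρ : Measurable (Function.uncurry ρ)) (hm : ∀ t x, ρ t x ∈ Icc 0 R)
    (hA : 0 ≤ A) (hψ : IsBoxed A K ψ) (S : Set ℝ) {a : ℕ → ℝ → ℝ} {b : ℝ → ℝ}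
    (ha : ∀ n, Measurable (a n)) (hC : ∀ n, ∀ r ∈ Icc 0 R, |a n r| ≤ C)
    (h : ∀ r, Tendsto (fun n => a n r) atTop (𝓝 (b r))) :
    Tendsto (fun n => weighted ρ S (a n) ψ) atTop (𝓝 (weighted ρ S b ψ)) :=
  IsBoxed.integral_tendsto hA (fun n => hψ.weight hρ hm (ha n) (hC n))
    (fun t x hx => by rw [hψ.zero_snd t x hx, mul_zero]) S
    (ae_of_all _ fun t => SubAE.of_tendsto fun x => (h (ρ t x)).mul_const _)

theorem weighted_add (hρ : Measurable (Function.uncurry ρ)) (hm : ∀ t x, ρ t x ∈ Icc 0 R)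
    (hψ : IsBoxed A K ψ) (S : Set ℝ) {a b : ℝ → ℝ} (ha : Measurable a) (hb : Measurable b)
    (hC : ∀ r ∈ Icc 0 R, |a r| ≤ C) (hC' : ∀ r ∈ Icc 0 R, |b r| ≤ C) :
    weighted ρ S (fun r => a r + b r) ψ = weighted ρ S a ψ + weighted ρ S b ψ := by
  have h1 := hψ.weight hρ hm ha hC
  have h2 := hψ.weight hρ hm hb hC'
  unfold weighted
  rw [← integral_add h1.integrable_integral.restrict h2.integrable_integral.restrict]
  refine integral_congr_ae (ae_of_all _ fun t => ?_)
  simp only [add_mul]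
  exact integral_add (h1.integrable t) (h2.integrable t)

end Weighted

/-- In this form the entropy flux is visibly continuous in `κ`, unlike the source term. -/
theorem sign_mul_sub_eq (F : ℝ → ℝ) (r κ : ℝ) :
    Real.sign (r - κ) * (F r - F κ) = F (max r κ) - F (min r κ) := by
  rcases lt_trichotomy r κ with h | rfl | h
  · rw [max_eq_right h.le, min_eq_left h.le, Real.sign_of_neg (sub_neg.2 h)]; ring
  · simp
  · rw [max_eq_left h.le, min_eq_right h.le, Real.sign_of_pos (sub_pos.2 h)]; ring

/-- The mean of the one-sided limits of the sign is the sign. -/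
theorem tendsto_sign_mul_add {F : ℝ → ℝ} (hF : Continuous F) {κ : ℝ} {p q : ℕ → ℝ}
    (hp : Tendsto p atTop (𝓝 κ)) (hq : Tendsto q atTop (𝓝 κ)) (hp' : ∀ n, κ < p n)
    (hq' : ∀ n, q n < κ) (r : ℝ) :
    Tendsto (fun n => Real.sign (r - p n) * F (p n) + Real.sign (r - q n) * F (q n)) atTop
      (𝓝 (Real.sign (r - κ) * F κ + Real.sign (r - κ) * F κ)) := by
  have Fp := (hF.tendsto κ).comp hp
  have Fq := (hF.tendsto κ).comp hq
  by_cases h : r = κ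
  · subst h
    -- On the level set itself the signs from above and from below are opposite, so the sum tends to
    -- `0`, in agreement with the sign vanishing at `0`.
    have e : ∀ n, Real.sign (r - p n) * F (p n) + Real.sign (r - q n) * F (q n)
        = F (q n) - F (p n) := fun n => by
      rw [Real.sign_of_neg (sub_neg.2 (hp' n)), Real.sign_of_pos (sub_pos.2 (hq' n))]; ring
    simp only [e]
    simpa using Fq.sub Fp
  · have hs : ∀ {s : ℕ → ℝ}, Tendsto s atTop (𝓝 κ) →
        Tendsto (fun n => Real.sign (r - s n)) atTop (𝓝 (Real.sign (r - κ))) := fun hs =>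
      (continuousAt_sign (sub_ne_zero.2 h)).tendsto.comp (hs.const_sub r)
    exact ((hs hp).mul Fp).add ((hs hq).mul Fq)

namespace IsLimit

variable {Λ : ℝ} {N h : ℕ → ℕ} {ρ : ℝ → ℝ → ℝ}

/-- At most countably many level sets of a measurable function on the plane have positive measure,
and the complement of a countable set is dense. -/
theorem dense_generic (hl : IsLimit P G ρ₀ N h ρ) : Dense {κ | ∀ᵐ t, ∀ᵐ x, ρ t x ≠ κ} := by
  have h1 := Measure.countable_meas_level_set_pos (μ := (volume : Measure ℝ).prod
    (volume : Measure ℝ)) hl.measurable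
  refine (h1.dense_compl ℝ).mono fun κ hκ => ?_
  have h2 : ((volume : Measure ℝ).prod volume) {z | Function.uncurry ρ z = κ} = 0 := by
    simpa using hκ
  filter_upwards [Measure.measure_ae_null_of_prod_null h2] with t ht
  rw [ae_iff]
  simpa using ht

variable {T : ℝ} {φ : ℝ → ℝ → ℝ}

/-- The inequalities for generic constants `p n` above and `q n` below `κ` are added. The entropy
and flux terms are continuous in the constant, the two source terms combine into a convergent one,
and the limit is twice the inequality for `κ`. -/
theorem entropy_weighted (hP : P.Admissible) (hm : IsMeshSeq P G Λ N h) (hρ : IsDensity P.R ρ₀)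
    (htv : totalVar ρ₀ ≠ ∞) (hl : IsLimit P G ρ₀ N h ρ) (hφ : Model.IsTest T φ) (κ : ℝ)
    {A B₁ B₂ B₃ : ℝ} (hA : 0 ≤ A) (b₁ : IsBoxed A B₁ fun t x => deriv (fun s => φ s x) t)
    (b₂ : IsBoxed A B₂ fun t x => P.speed (ρ (t - P.τ)) x * deriv (fun y => φ t y) x)
    (b₃ : IsBoxed A B₃ fun t x => deriv (P.speed (ρ (t - P.τ))) x * φ t x) :
    0 ≤ weighted ρ univ (fun r => |r - κ|) (fun t x => deriv (fun s => φ s x) t)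
      + weighted ρ (Ici 0) (fun r => Real.sign (r - κ) * (P.F r - P.F κ))
        (fun t x => P.speed (ρ (t - P.τ)) x * deriv (fun y => φ t y) x)
      - weighted ρ (Ici 0) (fun r => Real.sign (r - κ) * P.F κ)
        (fun t x => deriv (P.speed (ρ (t - P.τ))) x * φ t x) := by
  have hF := hP.F_continuous
  have hR := hP.R_pos
  obtain ⟨B, hB⟩ := (isCompact_Icc (a := -(P.R + |κ| + 1)) (b := P.R + |κ| + 1)
    ).exists_bound_of_continuousOn hF.continuousOn
  have hε : ∀ n : ℕ, 0 < 1 / ((n : ℝ) + 1) := fun n => by positivity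
  have hε1 : ∀ n : ℕ, 1 / ((n : ℝ) + 1) ≤ 1 := fun n => by
    rw [div_le_one (by positivity)]; linarith [n.cast_nonneg (α := ℝ)]
  have hε0 := tendsto_one_div_add_atTop_nhds_zero_nat (𝕜 := ℝ)
  choose p hpg hp using fun n : ℕ => hl.dense_generic.exists_between
    (show κ < κ + 1 / ((n : ℝ) + 1) by linarith [hε n])
  choose q hqg hq using fun n : ℕ => hl.dense_generic.exists_between
    (show κ - 1 / ((n : ℝ) + 1) < κ by linarith [hε n])
  have hpt : Tendsto p atTop (𝓝 κ) :=
    tendsto_of_tendsto_of_tendsto_of_le_of_le tendsto_const_nhds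
      (by simpa using hε0.const_add κ) (fun n => (hp n).1.le) fun n => (hp n).2.le
  have hqt : Tendsto q atTop (𝓝 κ) :=
    tendsto_of_tendsto_of_tendsto_of_le_of_le (by simpa using hε0.const_sub κ)
      tendsto_const_nhds (fun n => (hq n).1.le) fun n => (hq n).2.le
  have hp1 : ∀ n, |p n| ≤ |κ| + 1 := fun n => by
    have h1 : |p n - κ| ≤ 1 := by
      rw [abs_le]; constructor <;> linarith [(hp n).1, (hp n).2, hε1 n]
    linarith [abs_sub_abs_le_abs_sub (p n) κ]
  have hq1 : ∀ n, |q n| ≤ |κ| + 1 := fun n => by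
    have h1 : |q n - κ| ≤ 1 := by
      rw [abs_le]; constructor <;> linarith [(hq n).1, (hq n).2, hε1 n]
    linarith [abs_sub_abs_le_abs_sub (q n) κ]
  have hFk : ∀ {s : ℝ}, |s| ≤ |κ| + 1 → |P.F s| ≤ B := fun hs =>
    hB _ (abs_le.1 (hs.trans (by linarith)))
  have hFr : ∀ {r : ℝ}, r ∈ Icc 0 P.R → |P.F r| ≤ B := fun hr =>
    hB _ ⟨by linarith [hr.1, abs_nonneg κ], by linarith [hr.2, abs_nonneg κ]⟩
  have hsm : ∀ s : ℝ, Measurable fun r => Real.sign (r - s) := fun s =>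
    measurable_sign.comp (measurable_id.sub_const s)
  have sgn_le : ∀ x y : ℝ, |Real.sign x * y| ≤ |y| := fun x y => by
    rw [abs_mul]; exact mul_le_of_le_one_left (abs_nonneg _) (abs_sign_le x)
  have lim₁ : ∀ {s : ℕ → ℝ}, Tendsto s atTop (𝓝 κ) → (∀ n, |s n| ≤ |κ| + 1) →
      Tendsto (fun n => weighted ρ univ (fun r => |r - s n|) fun t x => deriv (fun s => φ s x) t)
        atTop (𝓝 (weighted ρ univ (fun r => |r - κ|) fun t x => deriv (fun s => φ s x) t)) :=
    fun hs hs1 => weighted_tendsto (C := P.R + (|κ| + 1)) hl.measurable hl.mem hA b₁ univ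
      (fun n => by fun_prop)
      (fun n r hr => by
        rw [abs_abs]
        exact (abs_sub _ _).trans (add_le_add (by rw [abs_of_nonneg hr.1]; exact hr.2) (hs1 n)))
      fun r => (hs.const_sub r).abs
  have lim₂ : ∀ {s : ℕ → ℝ}, Tendsto s atTop (𝓝 κ) → (∀ n, |s n| ≤ |κ| + 1) →
      Tendsto (fun n => weighted ρ (Ici 0) (fun r => Real.sign (r - s n) * (P.F r - P.F (s n)))
          fun t x => P.speed (ρ (t - P.τ)) x * deriv (fun y => φ t y) x) atTop
        (𝓝 (weighted ρ (Ici 0) (fun r => Real.sign (r - κ) * (P.F r - P.F κ))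
          fun t x => P.speed (ρ (t - P.τ)) x * deriv (fun y => φ t y) x)) :=
    fun hs hs1 => weighted_tendsto (C := B + B) hl.measurable hl.mem hA b₂ (Ici 0)
      (fun n => (hsm _).mul (hF.measurable.sub_const _))
      (fun n r hr => (sgn_le _ _).trans ((abs_sub _ _).trans (add_le_add (hFr hr) (hFk (hs1 n)))))
      fun r => by
        simp only [sign_mul_sub_eq]
        have c : Continuous fun s => P.F (max r s) - P.F (min r s) := by fun_prop
        exact (c.tendsto κ).comp hs
  have hk := hFk (show |κ| ≤ |κ| + 1 by linarith)
  have lim₃ := weighted_tendsto (C := B + B) hl.measurable hl.mem hA b₃ (Ici 0)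
    (a := fun n r => Real.sign (r - p n) * P.F (p n) + Real.sign (r - q n) * P.F (q n))
    (fun n => ((hsm _).mul_const _).add ((hsm _).mul_const _))
    (fun n r hr => (abs_add_le _ _).trans (add_le_add
      ((sgn_le _ _).trans (hFk (hp1 n))) ((sgn_le _ _).trans (hFk (hq1 n)))))
    (tendsto_sign_mul_add hF hpt hqt (fun n => (hp n).1) fun n => (hq n).2)
  have hadd : ∀ {s s' : ℝ}, |s| ≤ |κ| + 1 → |s'| ≤ |κ| + 1 →
      weighted ρ (Ici 0) (fun r => Real.sign (r - s) * P.F s + Real.sign (r - s') * P.F s')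
        (fun t x => deriv (P.speed (ρ (t - P.τ))) x * φ t x)
      = weighted ρ (Ici 0) (fun r => Real.sign (r - s) * P.F s)
          (fun t x => deriv (P.speed (ρ (t - P.τ))) x * φ t x)
        + weighted ρ (Ici 0) (fun r => Real.sign (r - s') * P.F s')
          fun t x => deriv (P.speed (ρ (t - P.τ))) x * φ t x :=
    fun hs hs' => weighted_add (C := B) hl.measurable hl.mem b₃ (Ici 0) ((hsm _).mul_const _)
      ((hsm _).mul_const _) (fun r _ => (sgn_le _ _).trans (hFk hs))
      fun r _ => (sgn_le _ _).trans (hFk hs')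
  have hκ1 : |κ| ≤ |κ| + 1 := by linarith
  have key := ge_of_tendsto' ((((lim₁ hpt hp1).add (lim₁ hqt hq1)).add
    ((lim₂ hpt hp1).add (lim₂ hqt hq1))).sub lim₃) (b := 0) fun n => by
      have h1 := hl.entropy_of_ae_ne hP hm hρ htv hφ (hpg n)
      have h2 := hl.entropy_of_ae_ne hP hm hρ htv hφ (hqg n)
      rw [hadd (hp1 n) (hq1 n)]
      linarith
  rw [hadd hκ1 hκ1] at key
  linarith

/-- In the past the solution is the constant `ρ₀`, so after exchanging the integrals only the time
derivative of the test function is integrated, which leaves its value at time `0`. -/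
theorem weighted_Iic (hP : P.Admissible) (hm : IsMeshSeq P G Λ N h) (hρ : IsDensity P.R ρ₀)
    (htv : totalVar ρ₀ ≠ ∞) (hl : IsLimit P G ρ₀ N h ρ) (hφ : Model.IsTest T φ) (κ : ℝ)
    {A B : ℝ} (b : IsBoxed A B fun t x => deriv (fun s => φ s x) t) :
    weighted ρ (Iic 0) (fun r => |r - κ|) (fun t x => deriv (fun s => φ s x) t)
      = ∫ x, |ρ₀ x - κ| * φ 0 x := by
  have hb : IsBoxed A ((P.R + |κ|) * B) fun t x => |ρ₀ x - κ| * deriv (fun s => φ s x) t := by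
    have := hρ.measurable
    refine b.bdd_mul (f := fun _ x => |ρ₀ x - κ|) ?_ fun t x => ?_
    · exact ((hρ.measurable.comp measurable_snd).sub_const κ).abs
    · rw [abs_abs]; exact (abs_sub _ _).trans (add_le_add (hρ.abs_le x) le_rfl)
  have e1 : weighted ρ (Iic 0) (fun r => |r - κ|) (fun t x => deriv (fun s => φ s x) t)
      = ∫ t in Iic 0, ∫ x, |ρ₀ x - κ| * deriv (fun s => φ s x) t := by
    refine setIntegral_congr_fun measurableSet_Iic fun t ht => integral_congr_ae ?_
    filter_upwards [hl.past hP hm hρ htv ht] with x hx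
    rw [hx]
  rw [e1, integral_integral_swap]
  · refine integral_congr_ae (ae_of_all _ fun x => ?_)
    simp only
    rw [integral_const_mul,
      (hφ.hasCompactSupport_fst x).integral_Iic_deriv_eq (hφ.contDiff_fst x)]
  · have h1 := hb.integrable_uncurry.restrict (s := Iic 0 ×ˢ univ)
    rwa [← Measure.prod_restrict, Measure.restrict_univ] at h1

theorem isEntropyWeakSolution (hP : P.Admissible) (hm : IsMeshSeq P G Λ N h)
    (hρ : IsDensity P.R ρ₀) (htv : totalVar ρ₀ ≠ ∞) (hl : IsLimit P G ρ₀ N h ρ) (hT : 0 < T) :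
    P.IsEntropyWeakSolution T ρ₀ ρ where
  integrable := hl.integrable_uncurry hP hm hρ htv T
  past t ht := hl.past hP hm hρ htv ht.2
  entropy φ hφ κ := by
    obtain ⟨A, K, hA0, -, hA, hK₁, hK₂⟩ := hφ.exists_box
    obtain ⟨b₁, hD₂⟩ := deriv_isBoxed hφ hA hK₁ hK₂ one_pos
    have hd := hl.isDensity hP hm hρ htv
    have hcont : Continuous fun z : ℝ × ℝ => P.speed (ρ (z.1 - P.τ)) z.2 :=
      (hl.speed_continuous hP hm hρ htv).comp
        ((continuous_fst.sub continuous_const).prodMk continuous_snd)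
    have hA' : IsBoxed (A + 1) K φ := ⟨hA.measurable, hA.bound,
      fun t x ht => hA.zero_fst t x (by linarith), fun t x hx => hA.zero_snd t x (by linarith)⟩
    have b₂ : IsBoxed (A + 1) (P.V * K)
        fun t x => P.speed (ρ (t - P.τ)) x * deriv (fun y => φ t y) x :=
      hD₂.bdd_mul (f := fun t x => P.speed (ρ (t - P.τ)) x) hcont.measurable fun t x => by
        have := hP.v_mapsTo (hP.conv_mem (hd (t - P.τ)) x)
        exact (abs_of_nonneg this.1).trans_le this.2
    have b₃ : IsBoxed (A + 1) (2 * P.normω * P.R * P.normV' * K)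
        fun t x => deriv (P.speed (ρ (t - P.τ))) x * φ t x :=
      hA'.bdd_mul (f := fun t x => deriv (P.speed (ρ (t - P.τ))) x)
        (measurable_deriv_with_param (f := fun t x => P.speed (ρ (t - P.τ)) x) hcont)
        fun t x => (hl.isLiftLimit hP hm hρ htv (t - P.τ)).norm_deriv_speed_le hP x
    have hent := hl.entropy_weighted hP hm hρ htv hφ κ (by positivity) b₁ b₂ b₃
    obtain ⟨B, hB⟩ := (isCompact_Icc (a := 0) (b := P.R)).exists_bound_of_continuousOn
      hP.F_continuous.continuousOn
    have hsm : Measurable fun r => Real.sign (r - κ) :=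
      measurable_sign.comp (measurable_id.sub_const κ)
    have sgn_le : ∀ x y : ℝ, |Real.sign x * y| ≤ |y| := fun x y => by
      rw [abs_mul]; exact mul_le_of_le_one_left (abs_nonneg _) (abs_sign_le x)
    have w₁ := b₁.weight hl.measurable hl.mem (a := fun r => |r - κ|) (C := P.R + |κ|)
      (by fun_prop) fun r hr => by
        rw [abs_abs]
        exact (abs_sub _ _).trans (add_le_add (by rw [abs_of_nonneg hr.1]; exact hr.2) le_rfl)
    have w₂ := b₂.weight hl.measurable hl.mem
      (a := fun r => Real.sign (r - κ) * (P.F r - P.F κ)) (C := B + |P.F κ|)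
      (hsm.mul (hP.F_continuous.measurable.sub_const (P.F κ))) fun r hr =>
        (sgn_le _ _).trans ((abs_sub _ _).trans (add_le_add (hB r hr) le_rfl))
    have w₃ := b₃.weight hl.measurable hl.mem (C := |P.F κ|) (hsm.mul_const (P.F κ))
      fun r _ => sgn_le _ _
    have split : weighted ρ univ (fun r => |r - κ|) (fun t x => deriv (fun s => φ s x) t)
        = (∫ x, |ρ₀ x - κ| * φ 0 x)
          + ∫ t in Ioi 0, ∫ x, |ρ t x - κ| * deriv (fun s => φ s x) t := by
      rw [← hl.weighted_Iic hP hm hρ htv hφ κ b₁]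
      unfold weighted
      rw [Measure.restrict_univ, intervalIntegral.integral_Iic_add_Ioi
        w₁.integrable_integral.integrableOn w₁.integrable_integral.integrableOn]
    rw [split] at hent
    unfold weighted at hent
    rw [integral_Ici_eq_integral_Ioi, integral_Ici_eq_integral_Ioi] at hent
    refine hent.trans (le_of_eq ?_)
    have i₁₂ : Integrable (fun t => (∫ x, |ρ t x - κ| * deriv (fun s => φ s x) t)
        + ∫ x, Real.sign (ρ t x - κ) * (P.F (ρ t x) - P.F κ)
          * (P.speed (ρ (t - P.τ)) x * deriv (fun y => φ t y) x)) (volume.restrict (Ioi 0)) :=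
      w₁.integrable_integral.restrict.add w₂.integrable_integral.restrict
    have e : ∫ t in (0 : ℝ)..T, ∫ x,
          (|ρ t x - κ| * deriv (fun s => φ s x) t
            + Real.sign (ρ t x - κ) * (P.F (ρ t x) - P.F κ) * P.speed (ρ (t - P.τ)) x
                * deriv (fun y => φ t y) x
            - Real.sign (ρ t x - κ) * P.F κ * deriv (fun y => P.speed (ρ (t - P.τ)) y) x
                * φ t x)
        = ∫ t in Ioi 0, ((∫ x, |ρ t x - κ| * deriv (fun s => φ s x) t)
          + (∫ x, Real.sign (ρ t x - κ) * (P.F (ρ t x) - P.F κ)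
            * (P.speed (ρ (t - P.τ)) x * deriv (fun y => φ t y) x))
          - ∫ x, Real.sign (ρ t x - κ) * P.F κ
            * (deriv (P.speed (ρ (t - P.τ))) x * φ t x)) := by
      -- At times `t ≥ T` the test function, its derivative in time and its slice in space all
      -- vanish, so `(0, T]` can be replaced by the half line.
      rw [intervalIntegral.integral_of_le hT.le, ← setIntegral_eq_of_subset_of_forall_sdiff_eq_zero
        measurableSet_Ioi (fun t ht => ht.1 : Ioc 0 T ⊆ Ioi 0) fun t ht => ?_]
      · refine integral_congr_ae (ae_of_all _ fun t => ?_)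
        simp only
        have i : Integrable fun x => |ρ t x - κ| * deriv (fun s => φ s x) t
            + Real.sign (ρ t x - κ) * (P.F (ρ t x) - P.F κ)
              * (P.speed (ρ (t - P.τ)) x * deriv (fun y => φ t y) x) :=
          (w₁.integrable t).add (w₂.integrable t)
        rw [← integral_add (w₁.integrable t) (w₂.integrable t), ← integral_sub i (w₃.integrable t)]
        simp only [mul_assoc]
      · have hTt : T ≤ t := by
          by_contra! hc; exact ht.2 ⟨ht.1, hc.le⟩
        simp [hφ.eq_zero hTt, hφ.deriv_fst_eq_zero hTt]
    rw [e, integral_sub i₁₂ w₃.integrable_integral.restrict,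
      integral_add w₁.integrable_integral.restrict w₂.integrable_integral.restrict]
    ring

end IsLimit

end DelayTraffic

/-! ### Arbitrary representatives of the datum and admissible meshes. -/

namespace DelayTraffic

variable {P : Model} {G : NumFlux} {ρ₀ ρ₁ : ℝ → ℝ}

/-! ### Dependence on the representative of the datum -/

theorem totalVar_congr (h : ρ₀ =ᵐ[volume] ρ₁) : totalVar ρ₀ = totalVar ρ₁ := by
  unfold totalVar
  refine iSup_congr fun φ => iSup_congr fun _ => congrArg _ (integral_congr_ae ?_)
  filter_upwards [h] with x hx
  rw [hx]

theorem cellMean_congr (h : ρ₀ =ᵐ[volume] ρ₁) (N : ℕ) : P.cellMean N ρ₀ = P.cellMean N ρ₁ := by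
  ext j
  unfold Model.cellMean
  rw [intervalIntegral.integral_congr_ae]
  filter_upwards [h] with x hx _ using hx

theorem apx_congr (h : ρ₀ =ᵐ[volume] ρ₁) (N n : ℕ) : apx P G ρ₀ N n = apx P G ρ₁ N n := by
  ext t
  rw [apx, apx, cellMean_congr h]

theorem Model.IsEntropyWeakSolution.congr_datum {T : ℝ} {ρ : ℝ → ℝ → ℝ}
    (hs : P.IsEntropyWeakSolution T ρ₁ ρ) (h : ρ₀ =ᵐ[volume] ρ₁) :
    P.IsEntropyWeakSolution T ρ₀ ρ where
  integrable := hs.integrable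
  past t ht := (hs.past t ht).trans h.symm
  entropy φ hφ κ := by
    have e : ∫ x, |ρ₀ x - κ| * φ 0 x = ∫ x, |ρ₁ x - κ| * φ 0 x := by
      refine integral_congr_ae ?_
      filter_upwards [h] with x hx
      rw [hx]
    rw [e]
    exact hs.entropy φ hφ κ

theorem Model.Estimates.congr_datum {α T : ℝ} {ρ : ℝ → ℝ → ℝ} (hs : P.Estimates α T ρ₁ ρ)
    (h : ρ₀ =ᵐ[volume] ρ₁) : P.Estimates α T ρ₀ ρ := by
  have e : ∫ x, |ρ₀ x| = ∫ x, |ρ₁ x| := by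
    refine integral_congr_ae ?_
    filter_upwards [h] with x hx
    rw [hx]
  refine ⟨hs.mem_Icc, hs.integrable, fun t ht => ?_, fun t ht => ?_, fun s hs' t ht => ?_⟩
  · rw [e]; exact hs.norm_eq t ht
  · rw [totalVar_congr h]; exact hs.totalVar_le t ht
  · unfold Model.K
    rw [e, totalVar_congr h]
    exact hs.lipschitz s hs' t ht

/-- A measurable representative is truncated to `[0, R]`, which changes it on a null set only;
everything above may then assume bounds at every point. -/
theorem IsBV.exists_isDensity (hP : P.Admissible) (h : IsBV P.R ρ₀) :
    ∃ ρ₁, ρ₀ =ᵐ[volume] ρ₁ ∧ IsDensity P.R ρ₁ ∧ totalVar ρ₁ ≠ ∞ := by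
  have hm := h.integrable.aestronglyMeasurable
  set ρ₁ : ℝ → ℝ := fun x => max 0 (min P.R (hm.mk ρ₀ x)) with hρ₁
  have e : ρ₀ =ᵐ[volume] ρ₁ := by
    filter_upwards [hm.ae_eq_mk, h.mem_Icc] with x hx hx'
    rw [hρ₁]
    simp only
    rw [← hx, min_eq_right hx'.2, max_eq_right hx'.1]
  refine ⟨ρ₁, e, ⟨?_, h.integrable.congr e, fun x => ⟨le_max_left _ _,
    max_le hP.R_pos.le (min_le_left _ _)⟩⟩, ?_⟩
  · have := hm.stronglyMeasurable_mk.measurable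
    fun_prop
  · rw [← totalVar_congr e]; exact h.totalVar_lt_top.ne

/-- Along a sequence of meshes on which the scheme is monotone, the approximate solutions converge,
up to a subsequence, to an entropy weak solution. -/
theorem exists_limit_solution (hP : P.Admissible) (h₀ : IsBV P.R ρ₀) {T : ℝ} (hT : 0 < T) {α : ℝ}
    (hα : G.β ≤ α) {Λ : ℝ} {N h : ℕ → ℕ} (hm : IsMeshSeq P G Λ N h) :
    ∃ σ : ℕ → ℕ, StrictMono σ ∧ ∃ ρ : ℝ → ℝ → ℝ,
      P.IsEntropyWeakSolution T ρ₀ ρ ∧ P.Estimates α T ρ₀ ρ ∧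
      TendstoL1Loc T (fun k => apx P G ρ₀ (N (σ k)) (h (σ k))) ρ := by
  obtain ⟨ρ₁, e, hρ, htv⟩ := h₀.exists_isDensity hP
  obtain ⟨σ, hσ, ρ, hmeas, hmem, hlim⟩ := (hm.isCompactFamily hP hρ htv).exists_limit
  have hl : IsLimit P G ρ₁ (fun k => N (σ k)) (fun k => h (σ k)) ρ := ⟨hmeas, hmem, hlim⟩
  have hmσ := hm.comp hσ
  refine ⟨σ, hσ, ρ, (hl.isEntropyWeakSolution hP hmσ hρ htv hT).congr_datum e,
    (hl.estimates hP hmσ hρ htv hα T).congr_datum e, ?_⟩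
  simp only [apx_congr e]
  exact hl.tendstoL1Loc hP hmσ hρ htv T

/-- The number of time steps per delay is at free disposal, and increasing it makes the mesh ratio
arbitrarily small. -/
theorem exists_lam_le (hP : P.Admissible) {Λ : ℝ} (hΛ : 0 < Λ) {N : ℕ} (hN : 0 < N) :
    ∃ h : ℕ, 0 < h ∧ P.lam N h ≤ Λ := by
  obtain ⟨h, hh⟩ := exists_nat_gt (P.τ / (Λ * P.dx N))
  have hd := hP.dx_pos hN
  have h0 : (0 : ℝ) < h := (div_pos hP.τ_pos (mul_pos hΛ hd)).trans hh
  refine ⟨h, by exact_mod_cast h0, ?_⟩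
  rw [div_lt_iff₀ (mul_pos hΛ hd)] at hh
  rw [Model.lam, Model.dt, div_le_iff₀ hd, div_le_iff₀ h0]
  linarith

end DelayTraffic

theorem mainTheorem1 (P : DelayTraffic.Model) (hP : P.Admissible)
    (ρ₀ : ℝ → ℝ) (hρ₀ : DelayTraffic.IsBV P.R ρ₀) (T : ℝ) (hT : 0 < T)
    (α : ℝ) (hα : P.V * (1 + P.R * P.normF') ≤ α) :
    -- existence of an entropy weak solution with the four properties
    (∃ ρ : ℝ → ℝ → ℝ, P.IsEntropyWeakSolution T ρ₀ ρ ∧ P.Estimates α T ρ₀ ρ) ∧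
    -- such solutions are limits of Lax-Friedrichs approximations
    (∀ N h : ℕ → ℕ, (∀ k, 0 < N k) → (∀ k, 0 < h k) → Tendsto N atTop atTop →
      (∀ k, P.lam (N k) (h k) ≤ 1 / (α + P.V * (1 + P.R * P.normF'))) →
      ∃ σ : ℕ → ℕ, StrictMono σ ∧ ∃ ρ : ℝ → ℝ → ℝ,
        P.IsEntropyWeakSolution T ρ₀ ρ ∧ P.Estimates α T ρ₀ ρ ∧
        DelayTraffic.TendstoL1Loc T
          (fun k => P.approxLF α (N (σ k)) (h (σ k)) ρ₀) ρ) ∧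
    -- and of Hilliges-Weidlich approximations
    (∀ N h : ℕ → ℕ, (∀ k, 0 < N k) → (∀ k, 0 < h k) → Tendsto N atTop atTop →
      (∀ k, P.lam (N k) (h k) ≤ 1 / (P.V * (1 + P.R * P.normF'))) →
      ∃ σ : ℕ → ℕ, StrictMono σ ∧ ∃ ρ : ℝ → ℝ → ℝ,
        P.IsEntropyWeakSolution T ρ₀ ρ ∧ P.Estimates α T ρ₀ ρ ∧
        DelayTraffic.TendstoL1Loc T
          (fun k => P.approxHW (N (σ k)) (h (σ k)) ρ₀) ρ) := by
  have hc : 0 < P.V * (1 + P.R * P.normF') :=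
    mul_pos hP.V_pos (zero_lt_one.trans_le hP.one_le_fluxLip)
  have hLF : ∀ N h : ℕ → ℕ, (∀ k, 0 < N k) → (∀ k, 0 < h k) → Tendsto N atTop atTop →
      (∀ k, P.lam (N k) (h k) ≤ 1 / (α + P.V * (1 + P.R * P.normF'))) →
      ∃ σ : ℕ → ℕ, StrictMono σ ∧ ∃ ρ : ℝ → ℝ → ℝ,
        P.IsEntropyWeakSolution T ρ₀ ρ ∧ P.Estimates α T ρ₀ ρ ∧
        DelayTraffic.TendstoL1Loc T (fun k => P.approxLF α (N (σ k)) (h (σ k)) ρ₀) ρ := by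
    intro N h hN hh ht hlam
    simp only [DelayTraffic.approxLF_eq]
    exact DelayTraffic.exists_limit_solution hP hρ₀ hT le_rfl ⟨hN, hh, ht, hlam, fun k =>
      DelayTraffic.lfFlux_isMonotone hP hα (DelayTraffic.lam_nonneg hP (hN k) (hh k)) (hlam k)⟩
  refine ⟨?_, hLF, fun N h hN hh ht hlam => ?_⟩
  -- Existence follows from the Lax-Friedrichs scheme on the meshes with `k + 1` cells per
  -- look-ahead distance.
  · choose h hh hlam using fun k : ℕ => DelayTraffic.exists_lam_le hP
      (one_div_pos.2 (add_pos_of_pos_of_nonneg (hc.trans_le hα) hc.le)) k.succ_pos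
    obtain ⟨-, -, ρ, h1, h2, -⟩ := hLF (fun k => k + 1) h (fun k => k.succ_pos) hh
      (tendsto_add_atTop_nat 1) hlam
    exact ⟨ρ, h1, h2⟩
  · simp only [DelayTraffic.approxHW_eq]
    -- This scheme has `β = 0`, so its estimates hold for every nonnegative `α`.
    exact DelayTraffic.exists_limit_solution hP hρ₀ hT (hc.le.trans hα) ⟨hN, hh, ht, hlam, fun k =>
      DelayTraffic.hwFlux_isMonotone hP (DelayTraffic.lam_nonneg hP (hN k) (hh k)) (hlam k)⟩
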